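/- All automata are complete, deterministic and finite. An acceptor $A=\langle\Sigma,Q,q_\iota,\delta,\alpha\rangle$ is a Büchi (DBA), coBüchi (DCA), parity (DPA) or Muller (DMA) acceptor of $\omega$-words: with $I$ the set of states visited infinitely often in the run on $w$, the word $w$ is accepted iff, respectively, $I\cap F\neq\emptyset$; $I\cap F=\emptyset$; the minimum colour of the states in $I$ is odd; $I\in\mathcal F$. The accepted language is $[\![A]\!]$, and $A^q$ is $A$ with initial state changed to $q$. The size of $A$ is $|Q|\cdot|\Sigma|$, plus $|Q|\cdot|\mathcal F|$ for a DMA. The right congruence of $L\subseteq\Sigma^\omega$ is $x\sim_L y\iff\forall z\in\Sigma^\omega\,(xz\in L\Leftrightarrow yz\in L)$ on $\Sigma^*$, and the right congruence automaton of $L$ has the classes of $\sim_L$ as states, initial state $[\varepsilon]$, and transitions $[u]\mapsto[ua]$ on $a\in\Sigma$. For an automaton $M$ and $x\in\Sigma^*$, $M(x)$ is the state reached on $x$. Running time is the number of steps of a random access machine with tables, unit cost, and arithmetic limited to addition, truncated subtraction, comparison, halving and parity. A state test is a procedure that, given an acceptor $A$ and two of its states $q_1,q_2$, in time polynomial in the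 size of $A$ answers "yes" if $[\![A^{q_1}]\!]=[\![A^{q_2}]\!]$, and otherwise answers "no" and returns a word $u(v)^\omega$ ($v\neq\varepsilon$), with $|u|+|v|$ polynomially bounded in the size of $A$, that is accepted from exactly one of $q_1,q_2$. The algorithm Right-Con, with input $A$, uses a state test as a subroutine. It starts with $Q'=\{\varepsilon\}$, $D=\emptyset$ and $\delta'$ undefined. While $\delta'(x,\sigma)$ is undefined for some $x\in Q'$, $\sigma\in\Sigma$, it tests the state $\delta(q_\iota,x\sigma)$ against the states $\delta(q_\iota,y)$, $y\in Q'$. If the answer is "yes" for some $y$, it sets $\delta'(x,\sigma)=y$; otherwise it adds $x\sigma$ to $Q'$, sets $\delta'(x,\sigma)=x\sigma$, and adds to $D$ the words returned by these tests. It returns $M=\langle\Sigma,Q',\varepsilon,\delta'\rangle$ and $D$. **Theorem.** A state test exists. With any state test as its subroutine, Right-Con runs on every DBA, DCA, DPA and DMA $A$ in time polynomial in the size of $A$, and returns - an automaton $M$ isomorphic to the right congruence automaton of $[\![A]\!]$, whose states are finite words, whose initial state is $\varepsilon$, and which satisfies $M(x)=x$ for every state $x$; - a finite set $D$ of ultimately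 periodic words $u(v)^\omega$ such that for all $x_1,x_2\in\Sigma^*$ with $M(x_1)\neq M(x_2)$ there is some $u(v)^\omega\in D$ such that exactly one of $x_1u(v)^\omega$ and $x_2u(v)^\omega$ is in $[\![A]\!]$. -/

import Mathlib

open Filter

namespace OmegaAutomata

/-! Complete deterministic automata and acceptors of infinite words. -/

/-- A complete deterministic automaton with alphabet `S` and state set `Q`. -/
structure Automaton (S Q : Type) where
  init : Q
  step : Q → S → Q

namespace Automaton

variable {S Q Q' : Type}

/-- The state reached on a finite word. -/
def reach (M : Automaton S Q) (u : List S) : Q := u.foldl M.step M.init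

/-- The run on an infinite word. -/
def run (M : Automaton S Q) (w : Stream' S) : ℕ → Q
  | 0 => M.init
  | i + 1 => M.step (run M w i) (w.get i)

/-- The set of states that occur infinitely often in the run on `w`. -/
def infStates (M : Automaton S Q) (w : Stream' S) : Set Q :=
  {q | ∃ᶠ i in atTop, M.run w i = q}

/-- Isomorphism of automata over the same alphabet. -/
def Isomorphic (M : Automaton S Q) (N : Automaton S Q') : Prop :=
  ∃ e : Q ≃ Q', e M.init = N.init ∧ ∀ q a, e (M.step q a) = N.step (e q) a

end Automaton

/-- The Büchi, coBüchi, parity and Muller acceptance conditions. -/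
inductive Acceptance (Q : Type) where
  | buchi (F : Finset Q)
  | cobuchi (F : Finset Q)
  | parity (color : Q → ℕ)
  | muller (family : Finset (Finset Q))

/-- Whether a run whose set of infinitely recurring states is `I` is accepting. -/
def Acceptance.Accepts {Q : Type} : Acceptance Q → Set Q → Prop
  | buchi F, I => (I ∩ F).Nonempty
  | cobuchi F, I => I ∩ F = ∅
  | parity color, I => Odd (sInf (color '' I))
  | muller family, I => ∃ F ∈ family, (F : Set Q) = I

/-- A DBA, DCA, DPA or DMA, according to its acceptance condition. -/
structure Acceptor (S Q : Type) extends Automaton S Q where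
  acc : Acceptance Q

namespace Acceptor

variable {S Q : Type}

/-- The set of infinite words accepted by an acceptor. -/
def language (A : Acceptor S Q) : Set (Stream' S) :=
  {w | A.acc.Accepts (A.infStates w)}

/-- The acceptor with its initial state changed to `q`. -/
def withInit (A : Acceptor S Q) (q : Q) : Acceptor S Q := { A with init := q }

/-- The number of table entries that specify the transitions, plus, for a Muller acceptor,
the number of table entries that specify its family of final state sets. -/
def size [Fintype S] [Fintype Q] (A : Acceptor S Q) : ℕ :=
  Fintype.card Q * Fintype.card S +
    match A.acc with
    | .muller family => Fintype.card Q * family.card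
    | _ => 0

end Acceptor

/-- The pair `(u, v)`, with `v` nonempty, that presents the word `u v^ω`. -/
structure UPWord (S : Type) where
  pre : List S
  per : List S
  per_ne : per ≠ []

/-- The ultimately periodic infinite word `u v^ω`. -/
def UPWord.word {S : Type} (w : UPWord S) : Stream' S :=
  w.pre ++ₛ Stream'.cycle w.per w.per_ne

/-- The right congruence of a set `L` of infinite words. -/
def rightCongruence {S : Type} (L : Set (Stream' S)) : Setoid (List S) where
  r x y := ∀ z : Stream' S, x ++ₛ z ∈ L ↔ y ++ₛ z ∈ L
  iseqv :=
    ⟨fun _ _ => Iff.rfl, fun h z => (h z).symm, fun h₁ h₂ z => (h₁ z).trans (h₂ z)⟩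

/-- The right congruence automaton: its states are the classes of the right congruence,
its initial state is the class of the empty word, and `[u]` goes to `[ua]` on `a`. -/
def rightCongruenceAutomaton {S : Type} (L : Set (Stream' S)) :
    Automaton S (Quotient (rightCongruence L)) where
  init := Quotient.mk _ []
  step q a := Quotient.map' (s₁ := rightCongruence L) (s₂ := rightCongruence L)
    (fun u => u ++ [a])
    (fun x y h z => by
      have := h (Stream'.cons a z)
      simpa [Stream'.append_append_stream] using this) q

/-! The machine model: structured programs for a random access machine. The memory consists
of registers and of tables with two indices, all holding natural numbers. Every assignment,
table write and evaluation of a guard takes one step. The only arithmetic operations are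
addition, truncated subtraction, comparison, halving and parity, so numbers cannot grow by
more than a bounded number of bits in a step. -/

/-- The registers. -/
inductive Var where
  /-- Input: the kind of acceptor, `0` for DBA, `1` for DCA, `2` for DPA, `3` for DMA. -/
  | kind
  /-- Input: the number of states. -/
  | numStates
  /-- Input: the number of symbols. -/
  | numSyms
  /-- Input: the initial state. -/
  | initState
  /-- Input: the number of final state sets (DMA). -/
  | numSets
  /-- The two states given to the test of two states. -/
  | arg₁ | arg₂
  /-- The results of the test: its answer and the lengths of the two parts of a witness. -/
  | ans | testULen | testVLen
  /-- Local registers of the main program. -/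
  | curWord | curSym | cand | found | oldWits | pos
  /-- Output: the number of states and the number of witnesses. -/
  | outStates | outWits
  /-- Working registers of the test. -/
  | tmp (i : ℕ)
  deriving DecidableEq

/-- The tables. -/
inductive Tab where
  /-- Input: the transition table and the acceptance table. -/
  | delta | acc
  /-- The results of the test: the two parts of a witness, in row `0`. -/
  | testU | testV
  /-- Column `0` holds, for each word in `outWord`, the state that the input reaches on it. -/
  | reached
  /-- Output: the transition table. -/
  | outDelta
  /-- Output: the words that represent the states (one per row) and, in column `0`,
  their lengths. -/
  | outWord | outWordLen
  /-- Output: the two parts of each witness (one per row) and, in column `0`, their lengths. -/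
  | outU | outULen | outV | outVLen
  /-- Working tables of the test. -/
  | work (i : ℕ)
  deriving DecidableEq

/-- The contents of the memory. -/
structure Store where
  var : Var → ℕ
  tab : Tab → ℕ → ℕ → ℕ

namespace Store

def setVar (s : Store) (x : Var) (n : ℕ) : Store :=
  { s with var := Function.update s.var x n }

def setTab (s : Store) (t : Tab) (i j n : ℕ) : Store :=
  { s with
    tab := Function.update s.tab t
      (Function.update (s.tab t) i (Function.update (s.tab t i) j n)) }

/-- The first `len` entries of row `i` of table `t`. -/
def row (s : Store) (t : Tab) (i len : ℕ) : List ℕ := (List.range len).map (s.tab t i)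

end Store

/-- Arithmetic expressions. -/
inductive Arith where
  | lit (n : ℕ)
  | var (x : Var)
  | get (t : Tab) (i j : Arith)
  | add (e f : Arith)
  | sub (e f : Arith)
  | half (e : Arith)
  | parity (e : Arith)
  | lt (e f : Arith)
  | eq (e f : Arith)

def Arith.eval (s : Store) : Arith → ℕ
  | lit n => n
  | var x => s.var x
  | get t i j => s.tab t (i.eval s) (j.eval s)
  | add e f => e.eval s + f.eval s
  | sub e f => e.eval s - f.eval s
  | half e => e.eval s / 2
  | parity e => e.eval s % 2
  | lt e f => if e.eval s < f.eval s then 1 else 0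
  | eq e f => if e.eval s = f.eval s then 1 else 0

/-- Programs. A guard holds when its value is not `0`. -/
inductive Cmd where
  | skip
  | assign (x : Var) (e : Arith)
  | write (t : Tab) (i j e : Arith)
  | seq (c d : Cmd)
  | cond (e : Arith) (c d : Cmd)
  | loop (e : Arith) (c : Cmd)

def Cmd.block : List Cmd → Cmd
  | [] => .skip
  | c :: cs => .seq c (block cs)

/-- `Exec c s t s'`: the program `c` started in `s` halts after `t` steps in `s'`. -/
inductive Exec : Cmd → Store → ℕ → Store → Prop
  | skip (s : Store) : Exec .skip s 1 s
  | assign (x : Var) (e : Arith) (s : Store) :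
      Exec (.assign x e) s 1 (s.setVar x (e.eval s))
  | write (t : Tab) (i j e : Arith) (s : Store) :
      Exec (.write t i j e) s 1 (s.setTab t (i.eval s) (j.eval s) (e.eval s))
  | seq {c d : Cmd} {s s' s'' : Store} {t t' : ℕ} :
      Exec c s t s' → Exec d s' t' s'' → Exec (.seq c d) s (t + t') s''
  | cond_true {e : Arith} {c d : Cmd} {s s' : Store} {t : ℕ} :
      e.eval s ≠ 0 → Exec c s t s' → Exec (.cond e c d) s (t + 1) s'
  | cond_false {e : Arith} {c d : Cmd} {s s' : Store} {t : ℕ} :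
      e.eval s = 0 → Exec d s t s' → Exec (.cond e c d) s (t + 1) s'
  | loop_true {e : Arith} {c : Cmd} {s s' s'' : Store} {t t' : ℕ} :
      e.eval s ≠ 0 → Exec c s t s' → Exec (.loop e c) s' t' s'' →
        Exec (.loop e c) s (t + t' + 1) s''
  | loop_false {e : Arith} {c : Cmd} {s : Store} :
      e.eval s = 0 → Exec (.loop e c) s 1 s

/-! Input and output. -/

/-- The memory `s` holds the acceptor `A`, whose symbols are `0, …, k - 1` and whose states are
`0, …, n - 1`, as tables. Nothing is assumed about the rest of the memory. -/
def Store.HoldsInput {k n : ℕ} (s : Store) (A : Acceptor (Fin k) (Fin n)) : Prop :=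
  s.var .numStates = n ∧ s.var .numSyms = k ∧ s.var .initState = (A.init : ℕ) ∧
  (∀ (q : Fin n) (a : Fin k), s.tab .delta q a = (A.step q a : ℕ)) ∧
  match A.acc with
  | .buchi F => s.var .kind = 0 ∧ ∀ q : Fin n, s.tab .acc 0 q = if q ∈ F then 1 else 0
  | .cobuchi F => s.var .kind = 1 ∧ ∀ q : Fin n, s.tab .acc 0 q = if q ∈ F then 1 else 0
  | .parity color => s.var .kind = 2 ∧ ∀ q : Fin n, s.tab .acc 0 q = color q
  | .muller family => s.var .kind = 3 ∧ s.var .numSets = family.card ∧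
      ∃ e : Fin family.card ≃ {F // F ∈ family}, ∀ (i : Fin family.card) (q : Fin n),
        s.tab .acc i q = if q ∈ (e i).1 then 1 else 0

/-- The memory `s` holds the result of the algorithm: an automaton `M` with states
`0, …, r - 1`, the words `name` that represent the states, and the list `D` of witnesses. -/
def Store.HoldsOutput {k r : ℕ} (s : Store) (M : Automaton (Fin k) (Fin r))
    (name : Fin r → List (Fin k)) (D : List (UPWord (Fin k))) : Prop :=
  s.var .outStates = r ∧ (M.init : ℕ) = 0 ∧
  (∀ (x : Fin r) (a : Fin k), s.tab .outDelta x a = (M.step x a : ℕ)) ∧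
  (∀ x : Fin r, s.row .outWord x (s.tab .outWordLen x 0) = (name x).map Fin.val) ∧
  s.var .outWits = D.length ∧
  ∀ i : Fin D.length,
    s.row .outU i (s.tab .outULen i 0) = (D.get i).pre.map Fin.val ∧
    s.row .outV i (s.tab .outVLen i 0) = (D.get i).per.map Fin.val

/-! The procedure that tests two states. -/

/-- The registers that the test may change. -/
def Var.TestMayChange : Var → Prop
  | .ans | .testULen | .testVLen | .tmp _ => True
  | _ => False

/-- The tables that the test may change. -/
def Tab.TestMayChange : Tab → Prop
  | .testU | .testV | .work _ => True
  | _ => False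

/-- `T` is a polynomial time procedure that tests whether two states `q₁`, `q₂` of an
acceptor have the same right congruence class. It answers `1` if they do, and otherwise it
answers `0` and returns a witness of polynomial length that is accepted from exactly one of
the two states. It changes only its results and its working memory, whose initial contents
are arbitrary. -/
def IsStateTest (T : Cmd) : Prop :=
  ∃ p : Polynomial ℕ, ∀ (k n : ℕ) (A : Acceptor (Fin k) (Fin n)) (q₁ q₂ : Fin n) (s : Store),
    s.HoldsInput A → s.var .arg₁ = (q₁ : ℕ) → s.var .arg₂ = (q₂ : ℕ) →
    ∃ (t : ℕ) (s' : Store), Exec T s t s' ∧ t ≤ p.eval A.size ∧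
      (∀ x : Var, ¬ x.TestMayChange → s'.var x = s.var x) ∧
      (∀ b : Tab, ¬ b.TestMayChange → s'.tab b = s.tab b) ∧
      ((s'.var .ans = 1 ∧ (A.withInit q₁).language = (A.withInit q₂).language) ∨
       (s'.var .ans = 0 ∧ ∃ w : UPWord (Fin k),
          s'.row .testU 0 (s'.var .testULen) = w.pre.map Fin.val ∧
          s'.row .testV 0 (s'.var .testVLen) = w.per.map Fin.val ∧
          w.pre.length + w.per.length ≤ p.eval A.size ∧
          Xor (w.word ∈ (A.withInit q₁).language) (w.word ∈ (A.withInit q₂).language)))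

/-! The algorithm. -/

/-- Copy the first `len` entries of row `i` of table `src` to row `i'` of table `dst`. -/
def copyRow (src : Tab) (i : Arith) (dst : Tab) (i' : Arith) (len : Arith) : Cmd :=
  .block [
    .assign .pos (.lit 0),
    .loop (.lt (.var .pos) len) (.block [
      .write dst i' (.var .pos) (.get src i (.var .pos)),
      .assign .pos (.add (.var .pos) (.lit 1))])]

/-- Add the witness returned by the test to the list of witnesses. -/
def addWitness : Cmd :=
  .block [
    copyRow .testU (.lit 0) .outU (.var .outWits) (.var .testULen),
    .write .outULen (.var .outWits) (.lit 0) (.var .testULen),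
    copyRow .testV (.lit 0) .outV (.var .outWits) (.var .testVLen),
    .write .outVLen (.var .outWits) (.lit 0) (.var .testVLen),
    .assign .outWits (.add (.var .outWits) (.lit 1))]

/-- Add the word obtained from the word `curWord` by appending the symbol `curSym` as a new
state (the input reaches the state `arg₁` on it), and let `curWord` go to it on `curSym`. -/
def addState : Cmd :=
  .block [
    copyRow .outWord (.var .curWord) .outWord (.var .outStates)
      (.get .outWordLen (.var .curWord) (.lit 0)),
    .write .outWord (.var .outStates) (.get .outWordLen (.var .curWord) (.lit 0)) (.var .curSym),
    .write .outWordLen (.var .outStates) (.lit 0)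
      (.add (.get .outWordLen (.var .curWord) (.lit 0)) (.lit 1)),
    .write .reached (.var .outStates) (.lit 0) (.var .arg₁),
    .write .outDelta (.var .curWord) (.var .curSym) (.var .outStates),
    .assign .outStates (.add (.var .outStates) (.lit 1))]

/-- The algorithm Right-Con, which uses the procedure `T` to test two states. Words are
referred to by their row numbers, and row `0` is the empty word. For every word `x` found
so far (`curWord`) and every symbol `a` (`curSym`), the state reached on `xa` is tested
against the states reached on the words `y` found so far (`cand`), up to the first `y` of
the same class. If there is such a `y`, then `x` goes to `y` on `a`, and the witnesses from
these tests are dropped; otherwise `xa` becomes a new state, and the witnesses are kept. -/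
def rightCon (T : Cmd) : Cmd :=
  .block [
    .assign .outStates (.lit 1),
    .assign .outWits (.lit 0),
    .write .outWordLen (.lit 0) (.lit 0) (.lit 0),
    .write .reached (.lit 0) (.lit 0) (.var .initState),
    .assign .curWord (.lit 0),
    .loop (.lt (.var .curWord) (.var .outStates)) (.block [
      .assign .curSym (.lit 0),
      .loop (.lt (.var .curSym) (.var .numSyms)) (.block [
        .assign .arg₁ (.get .delta (.get .reached (.var .curWord) (.lit 0)) (.var .curSym)),
        .assign .oldWits (.var .outWits),
        .assign .found (.lit 0),
        .assign .cand (.lit 0),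
        -- the guard says that `found = 0` and `cand < outStates`
        .loop (.sub (.lt (.var .cand) (.var .outStates)) (.var .found)) (.block [
          .assign .arg₂ (.get .reached (.var .cand) (.lit 0)),
          T,
          .cond (.var .ans)
            (.block [
              .write .outDelta (.var .curWord) (.var .curSym) (.var .cand),
              .assign .outWits (.var .oldWits),
              .assign .found (.lit 1)])
            (.block [
              addWitness,
              .assign .cand (.add (.var .cand) (.lit 1))])]),
        .cond (.var .found) .skip addState,
        .assign .curSym (.add (.var .curSym) (.lit 1))]),
      .assign .curWord (.add (.var .curWord) (.lit 1))])]

end OmegaAutomata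

open OmegaAutomata

/-!
A state test has to decide whether a product of two copies of the acceptor, started in the states
`q₁` and `q₂`, has a run whose two projections are accepted differently, and to return such a run
as an ultimately periodic word. Whether a run is accepted depends only on the set of pairs of
states that recur in it, and in a finite product this set can be any set of pairs that is strongly
connected and reachable. There are exponentially many such sets, so the test may only try the
maximal ones, in polynomially many subgraphs of the product.

All four acceptance conditions are treated alike. Each is a union of polynomially many intervals
of sets of states (`Intervals.accepts`; Büchi and coBüchi conditions are parity conditions with
two colours). The subgraphs are the products restricted to `R₁ × R₂`, where `R₁` and `R₂` are the
upper end of an interval, or the set of all states, possibly with one state removed. These suffice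
because of `Intervals.restrict`: every nonempty set `X` of states lies in such an `R` with the
property that all sets between `X` and `R` are accepted or rejected together. For a parity
condition, `R` consists of the states of at least the minimum colour in `X`. For a Muller
condition and `X` in the family, `R = X`; for `X` outside the family, a minimal `R ⊇ X` will do,
since a member `F ⊆ R` of the family above `X` would give the smaller `F \ {q} ⊇ X` for a state
`q` of `F` outside `X`. Hence, if a word distinguishes `q₁` and `q₂`, then the two sets of
recurring states determine a restricted product in which the whole strongly connected component of
a recurring pair distinguishes them as well (`exists_distinguishing_cycle`). Conversely, every
reachable component whose projections are accepted differently yields a witness: a path to a pair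
in the component, and a closed path through all its pairs (`mem_language_cycle`). Reachability and
shortest paths are computed by relaxation in the manner of Bellman and Ford (`run_closure`), which
bounds the length of the witness.

The test is written with bounded loops only (`Prog`). Such a program is a total function on the
memory, and a polynomial time bound can be read off its text (`Prog.runs_toCmd`), so that the
analysis of the test concerns its effect alone. `Prog.run_forUpTo` is the rule for loop
invariants.

Right-Con is correct because two words are right congruent if and only if the states that they
reach are equivalent. Its invariant (`Explored`) says that the words found so far are pairwise
distinguished by the collected witnesses, and that the transitions found so far respect the
classes of words. The words found therefore lead to different states of the acceptor, which bounds
their number (`Explored.le_card`), and in the end they represent all classes (`Explored.result`).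
-/

namespace OmegaAutomata

/-! ### Runs of automata on infinite words -/

section

namespace Automaton

variable {S Q Q' : Type}

theorem run_cons (M : Automaton S Q) (a : S) (w : Stream' S) (i : ℕ) :
    M.run (Stream'.cons a w) (i + 1) = (⟨M.step M.init a, M.step⟩ : Automaton S Q).run w i := by
  induction i with
  | zero => rfl
  | succ i ih =>
    change M.step (M.run (Stream'.cons a w) (i + 1)) ((Stream'.cons a w).get (i + 1)) = _
    rw [ih]; rfl

theorem run_append (M : Automaton S Q) (u : List S) (w : Stream' S) (i : ℕ) :
    M.run (u ++ₛ w) (i + u.length) = (⟨M.reach u, M.step⟩ : Automaton S Q).run w i := by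
  induction u generalizing M with
  | nil => rfl
  | cons a u ih =>
    rw [Stream'.cons_append_stream, List.length_cons, ← add_assoc, run_cons, ih]; rfl

/-- As long as the run is within the prefix `u`, it follows the finite run on `u`. -/
theorem run_append_of_le (M : Automaton S Q) (u : List S) (w : Stream' S) (i : ℕ)
    (hi : i ≤ u.length) : M.run (u ++ₛ w) i = M.reach (u.take i) := by
  have := M.run_append (u.take i) (u.drop i ++ₛ w) 0
  rw [← Stream'.append_append_stream, List.take_append_drop, List.length_take,
    min_eq_left hi, zero_add] at this
  exact this

theorem infStates_append (M : Automaton S Q) (u : List S) (w : Stream' S) :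
    M.infStates (u ++ₛ w) = (⟨M.reach u, M.step⟩ : Automaton S Q).infStates w := by
  ext q
  change (∃ᶠ i in atTop, M.run (u ++ₛ w) i = q) ↔ ∃ᶠ i in atTop, _
  conv_lhs => rw [← Filter.map_add_atTop_eq_nat u.length]
  simp only [Filter.frequently_map, run_append]

/-- On `u v^ω`, when `v` leads from the state reached on `u` back to it, the states that recur
are those on that cycle. -/
theorem infStates_append_cycle (M : Automaton S Q) (u v : List S) (hv : v ≠ [])
    (h : v.foldl M.step (M.reach u) = M.reach u) :
    M.infStates (u ++ₛ Stream'.cycle v hv) =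
      {q | ∃ v', v' <+: v ∧ v'.foldl M.step (M.reach u) = q} := by
  rw [infStates_append]
  generalize M.reach u = q₀ at h
  set N : Automaton S Q := ⟨q₀, M.step⟩
  have hl : 0 < v.length := List.length_pos_iff.2 hv
  -- The run is periodic with the length of `v` as period.
  have hper : ∀ j i, N.run (Stream'.cycle v hv) (i + v.length * j) =
      N.run (Stream'.cycle v hv) i := by
    intro j
    induction j with
    | zero => intro i; rfl
    | succ j ih =>
      intro i
      rw [Nat.mul_succ, ← add_assoc, Stream'.cycle_eq, run_append]
      have : (⟨N.reach v, N.step⟩ : Automaton S Q) = N := by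
        change (⟨v.foldl M.step q₀, M.step⟩ : Automaton S Q) = ⟨q₀, M.step⟩
        rw [h]
      rw [this, ih, ← Stream'.cycle_eq]
  have hle : ∀ i ≤ v.length, N.run (Stream'.cycle v hv) i = (v.take i).foldl M.step q₀ := by
    intro i hi
    rw [Stream'.cycle_eq, run_append_of_le _ _ _ _ hi]; rfl
  ext q
  constructor
  · intro hq
    obtain ⟨i, hi⟩ := (show ∃ᶠ i in atTop, N.run (Stream'.cycle v hv) i = q from hq).exists
    rw [← Nat.mod_add_div i v.length, hper, hle _ (Nat.mod_lt _ hl).le] at hi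
    exact ⟨_, List.take_prefix _ _, hi⟩
  · rintro ⟨v', hp, rfl⟩
    refine Filter.frequently_atTop.2 fun b => ⟨v'.length + v.length * b, ?_, ?_⟩
    · nlinarith
    · rw [hper, hle _ hp.length_le, ← List.prefix_iff_eq_take.1 hp]

/-- Two runs on the same word in parallel. -/
def prod (M : Automaton S Q) (N : Automaton S Q') : Automaton S (Q × Q') :=
  ⟨(M.init, N.init), fun p a => (M.step p.1 a, N.step p.2 a)⟩

theorem run_prod (M : Automaton S Q) (N : Automaton S Q') (w : Stream' S) (i : ℕ) :
    (M.prod N).run w i = (M.run w i, N.run w i) := by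
  induction i with
  | zero => rfl
  | succ i ih => change (M.prod N).step ((M.prod N).run w i) _ = _; rw [ih]; rfl

/-- The infinite pigeonhole principle. -/
theorem frequently_exists_finite {α : Type} [Finite α] {p : α → ℕ → Prop}
    (h : ∃ᶠ i in atTop, ∃ a, p a i) : ∃ a, ∃ᶠ i in atTop, p a i := by
  by_contra hc
  push Not at hc
  exact h ((Filter.eventually_all.2 hc).mono fun i hi ⟨a, ha⟩ => hi a ha)

theorem infStates_nonempty [Finite Q] (M : Automaton S Q) (w : Stream' S) :
    (M.infStates w).Nonempty :=
  frequently_exists_finite (p := fun q i => M.run w i = q)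
    (Filter.Frequently.of_forall fun _ => ⟨_, rfl⟩)

theorem eventually_mem_infStates [Finite Q] (M : Automaton S Q) (w : Stream' S) :
    ∀ᶠ i in atTop, M.run w i ∈ M.infStates w := by
  by_contra hc
  rw [Filter.not_eventually] at hc
  obtain ⟨q, hq⟩ := frequently_exists_finite
    (p := fun q i => M.run w i = q ∧ q ∉ M.infStates w) (hc.mono fun _ hi => ⟨_, rfl, hi⟩)
  obtain ⟨i, _, hi⟩ := hq.exists
  exact hi (hq.mono fun _ hi => hi.1)

/-- A state that recurs in the first run recurs in the product together with some fixed state of the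
second run. -/
theorem fst_image_infStates_prod [Finite Q'] (M : Automaton S Q) (N : Automaton S Q')
    (w : Stream' S) : Prod.fst '' (M.prod N).infStates w = M.infStates w := by
  ext q
  constructor
  · rintro ⟨p, hp, rfl⟩
    exact hp.mono fun i hi => by rw [run_prod] at hi; rw [← hi]
  · intro hq
    obtain ⟨q', h⟩ := frequently_exists_finite
      (p := fun q' i => M.run w i = q ∧ N.run w i = q') (hq.mono fun i hi => ⟨_, hi, rfl⟩)
    exact ⟨(q, q'), h.mono fun i hi => by rw [run_prod, hi.1, hi.2], rfl⟩

theorem snd_image_infStates_prod [Finite Q] (M : Automaton S Q) (N : Automaton S Q')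
    (w : Stream' S) : Prod.snd '' (M.prod N).infStates w = N.infStates w := by
  ext q
  constructor
  · rintro ⟨p, hp, rfl⟩
    exact hp.mono fun i hi => by rw [run_prod] at hi; rw [← hi]
  · intro hq
    obtain ⟨q', h⟩ := frequently_exists_finite
      (p := fun q' i => M.run w i = q' ∧ N.run w i = q) (hq.mono fun i hi => ⟨_, rfl, hi⟩)
    exact ⟨(q', q), h.mono fun i hi => by rw [run_prod, hi.1, hi.2], rfl⟩

theorem reach_append_singleton (M : Automaton S Q) (u : List S) (a : S) :
    M.reach (u ++ [a]) = M.step (M.reach u) a := by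
  simp [reach]

end Automaton

theorem Acceptor.append_mem_language {S Q : Type} (A : Acceptor S Q) (u : List S)
    (w : Stream' S) :
    u ++ₛ w ∈ A.language ↔ w ∈ (A.withInit (A.reach u)).language := by
  change A.acc.Accepts _ ↔ A.acc.Accepts _
  rw [Automaton.infStates_append]; rfl

/-- Two words are right congruent if and only if the states reached on them accept the same words,
so that a state test decides the right congruence. -/
theorem Acceptor.rightCongruence_iff {S Q : Type} (A : Acceptor S Q) (x y : List S) :
    (rightCongruence A.language) x y ↔
      (A.withInit (A.reach x)).language = (A.withInit (A.reach y)).language := by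
  change (∀ z, _ ↔ _) ↔ _
  simp only [A.append_mem_language, Set.ext_iff]

end

/-! ### Execution within a time bound -/

section

/-- The program `c` started in `s` halts within `τ` steps in a memory that satisfies `Q`. -/
def Runs (c : Cmd) (s : Store) (τ : ℕ) (Q : Store → Prop) : Prop :=
  ∃ t s', Exec c s t s' ∧ t ≤ τ ∧ Q s'

namespace Runs

variable {c d : Cmd} {s : Store} {τ τ' : ℕ} {Q Q' : Store → Prop}

theorem mono (h : Runs c s τ Q) (hτ : τ ≤ τ') (hQ : ∀ s', Q s' → Q' s') : Runs c s τ' Q' :=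
  let ⟨t, s', h₁, h₂, h₃⟩ := h
  ⟨t, s', h₁, h₂.trans hτ, hQ _ h₃⟩

theorem skip (h : Q s) : Runs .skip s 1 Q := ⟨1, s, .skip s, le_rfl, h⟩

theorem nil (h : Q s) : Runs (.block []) s 1 Q := skip h

theorem cons {cs : List Cmd} (h : Runs c s τ fun s' => Runs (.block cs) s' τ' Q) :
    Runs (.block (c :: cs)) s (τ + τ') Q := by
  obtain ⟨t, s', h₁, h₂, t', s'', h₃, h₄, h₅⟩ := h
  exact ⟨t + t', s'', .seq h₁ h₃, add_le_add h₂ h₄, h₅⟩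

theorem assign_cons {cs : List Cmd} {x : Var} {e : Arith}
    (h : Runs (.block cs) (s.setVar x (e.eval s)) τ Q) :
    Runs (.block (.assign x e :: cs)) s (1 + τ) Q :=
  cons ⟨1, _, .assign x e s, le_rfl, h⟩

theorem write_cons {cs : List Cmd} {t : Tab} {i j e : Arith}
    (h : Runs (.block cs) (s.setTab t (i.eval s) (j.eval s) (e.eval s)) τ Q) :
    Runs (.block (.write t i j e :: cs)) s (1 + τ) Q :=
  cons ⟨1, _, .write t i j e s, le_rfl, h⟩

theorem cond {e : Arith} (h₁ : e.eval s ≠ 0 → Runs c s τ Q) (h₂ : e.eval s = 0 → Runs d s τ Q) :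
    Runs (.cond e c d) s (τ + 1) Q := by
  by_cases he : e.eval s = 0
  · obtain ⟨t, s', h, ht, hq⟩ := h₂ he
    exact ⟨t + 1, s', .cond_false he h, by omega, hq⟩
  · obtain ⟨t, s', h, ht, hq⟩ := h₁ he
    exact ⟨t + 1, s', .cond_true he h, by omega, hq⟩

/-- A loop with invariant `I` whose variant `v` decreases in each iteration. -/
theorem loop {e : Arith} {I : Store → Prop} (v : Store → ℕ)
    (h : ∀ s, I s → e.eval s ≠ 0 → Runs c s τ fun s' => I s' ∧ v s' < v s) (s : Store) (hs : I s) :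
    Runs (.loop e c) s (v s * (τ + 1) + 1) fun s' => I s' ∧ e.eval s' = 0 := by
  induction hn : v s using Nat.strong_induction_on generalizing s with
  | _ n ih =>
    subst hn
    by_cases he : e.eval s = 0
    · exact ⟨1, s, .loop_false he, by omega, hs, he⟩
    · obtain ⟨t, s', h₁, ht, hI, hv⟩ := h s hs he
      obtain ⟨t', s'', h₂, ht', hq⟩ := ih _ hv s' hI rfl
      refine ⟨t + t' + 1, s'', .loop_true he h₁ h₂, ?_, hq⟩
      have := Nat.mul_le_mul_right (τ + 1) (Nat.succ_le_of_lt hv)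
      rw [Nat.succ_mul] at this
      omega

end Runs

@[simp] theorem Store.setVar_var (s : Store) (x y : Var) (n : ℕ) :
    (s.setVar x n).var y = if y = x then n else s.var y := by
  simp [Store.setVar, Function.update_apply]

@[simp] theorem Store.setVar_tab (s : Store) (x : Var) (n : ℕ) : (s.setVar x n).tab = s.tab := rfl

@[simp] theorem Store.setTab_var (s : Store) (t : Tab) (i j n : ℕ) :
    (s.setTab t i j n).var = s.var := rfl

theorem Store.setTab_tab_of_ne (s : Store) {t t' : Tab} (i j n : ℕ) (h : t' ≠ t) :
    (s.setTab t i j n).tab t' = s.tab t' := by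
  simp [Store.setTab, h]

theorem Store.setTab_tab_self (s : Store) {t : Tab} (i j n : ℕ) :
    (s.setTab t i j n).tab t = Function.update (s.tab t) i (Function.update (s.tab t i) j n) := by
  simp [Store.setTab]

theorem Store.ext' {s s' : Store} (h₁ : s.var = s'.var) (h₂ : s.tab = s'.tab) : s = s' := by
  cases s; cases s'; simp_all

/-- The memory after copying `L` entries into row `i` of table `t`, from a row with
entries `f`. -/
def Store.copied (s : Store) (t : Tab) (i L : ℕ) (f : ℕ → ℕ) (n : ℕ) : Store where
  var := Function.update s.var .pos n
  tab := Function.update s.tab t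
    (Function.update (s.tab t) i fun j => if j < L then f j else s.tab t i j)

/-- The condition on the values of the arguments is required during the whole loop, because the loop
re-evaluates them; `hne` ensures that the entries to be copied are not overwritten. -/
theorem runs_copyRow {src dst : Tab} {i i' len : Arith} {s : Store} {vi vi' L : ℕ}
    (h : ∀ f n, n ≤ L → i.eval (s.copied dst vi' n f n) = vi ∧
      i'.eval (s.copied dst vi' n f n) = vi' ∧ len.eval (s.copied dst vi' n f n) = L)
    (hne : src ≠ dst ∨ vi ≠ vi') :
    Runs (copyRow src i dst i' len) s (4 * L + 3)
      fun s' => s' = s.copied dst vi' L (s.tab src vi) L := by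
  have h0 : s.setVar .pos 0 = s.copied dst vi' 0 (s.tab src vi) 0 := by
    apply Store.ext' <;> simp [Store.setVar, Store.copied]
  refine (Runs.assign_cons (τ := 4 * L + 2) ?_).mono (by omega) fun _ h => h
  change Runs _ (s.setVar .pos 0) _ _
  rw [h0]
  refine (Runs.cons (τ' := 1) ((Runs.loop (τ := 3) (fun s' => L - s'.var .pos)
    (I := fun s' => ∃ n ≤ L, s' = s.copied dst vi' n (s.tab src vi) n) ?_ _ ⟨0, by omega, rfl⟩).mono
      ?_ (τ' := 4 * L + 1) ?_)).mono le_rfl fun _ h => h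
  · rintro _ ⟨n, hn, rfl⟩ hg
    obtain ⟨h₁, h₂, h₃⟩ := h (s.tab src vi) n hn
    have hp : (s.copied dst vi' n (s.tab src vi) n).var .pos = n := by simp [Store.copied]
    have hlt : n < L := by
      by_contra hc
      simp [Arith.eval, h₃, hp, hc] at hg
    refine Runs.write_cons (Runs.assign_cons (Runs.nil ?_))
    simp only [Arith.eval, h₁, h₂, hp, Store.setTab_var]
    refine ⟨⟨n + 1, hlt, Store.ext' ?_ ?_⟩, ?_⟩
    · simp [Store.setVar, Store.setTab, Store.copied]
    · have : (s.copied dst vi' n (s.tab src vi) n).tab src vi n = s.tab src vi n := by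
        rcases hne with hne | hne <;> simp [Store.copied, Function.update_apply, hne]
        split_ifs with h <;> simp_all
      rw [this]
      simp only [Store.setVar, Store.setTab, Store.copied, Function.update_self,
        Function.update_idem]
      congr 2
      funext j
      rcases lt_trichotomy j n with hj | hj | hj
      · simp [hj.ne, hj, Nat.lt_succ_of_lt hj]
      · simp [hj]
      · simp [hj.ne', not_lt.2 hj.le, show ¬ j < n + 1 by omega]
    · simp; omega
  · rw [show (s.copied dst vi' 0 (s.tab src vi) 0).var .pos = 0 by simp [Store.copied]]
    omega
  · rintro _ ⟨⟨n, hn, rfl⟩, hg⟩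
    obtain ⟨h₁, h₂, h₃⟩ := h (s.tab src vi) n hn
    have : n = L := by
      by_contra hc
      have : n < L := by omega
      have hp : (s.copied dst vi' n (s.tab src vi) n).var .pos = n := by simp [Store.copied]
      simp [Arith.eval, h₃, hp, this] at hg
    subst this
    exact Runs.nil rfl

end

/-! ### Residual languages and the size of an acceptor -/

section

variable {k n : ℕ}

/-- The words accepted from the state that `A` reaches on `u`. -/
def Acceptor.residual {S Q : Type} (A : Acceptor S Q) (u : List S) : Set (Stream' S) :=
  (A.withInit (A.reach u)).language

theorem Acceptor.residual_append {S Q : Type} (A : Acceptor S Q) {u v : List S}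
    (h : A.residual u = A.residual v) (a : S) : A.residual (u ++ [a]) = A.residual (v ++ [a]) := by
  have := (A.rightCongruence_iff u v).2 h
  refine (A.rightCongruence_iff _ _).1 fun z => ?_
  have := this (Stream'.cons a z)
  simpa [Stream'.append_append_stream] using this

theorem Store.HoldsInput.congr {A : Acceptor (Fin k) (Fin n)} {s s' : Store} (h : s.HoldsInput A)
    (hv : ∀ x ∈ [Var.kind, .numStates, .numSyms, .initState, .numSets], s'.var x = s.var x)
    (ht : ∀ t ∈ [Tab.delta, .acc], s'.tab t = s.tab t) : s'.HoldsInput A := by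
  simp only [List.mem_cons, List.not_mem_nil, or_false, forall_eq_or_imp, forall_eq] at hv ht
  unfold Store.HoldsInput at h ⊢
  simp only [hv, ht]
  exact h

/-- There is at least one state, namely the initial one. -/
theorem Acceptor.card_syms_le_size (A : Acceptor (Fin k) (Fin n)) : k ≤ A.size := by
  have : 0 < n := A.init.pos
  unfold Acceptor.size
  simp only [Fintype.card_fin]
  nlinarith [Nat.zero_le ((match A.acc with | .muller family => n * family.card | _ => 0 : ℕ))]

theorem Acceptor.card_states_le_size (A : Acceptor (Fin k) (Fin n)) (hk : 0 < k) :
    n ≤ A.size := by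
  unfold Acceptor.size
  simp only [Fintype.card_fin]
  nlinarith [Nat.zero_le ((match A.acc with | .muller family => n * family.card | _ => 0 : ℕ))]

/-! ### The output of Right-Con -/

/-- The registers that hold the input or the output of Right-Con. -/
def Var.inOut : List Var := [.kind, .numStates, .numSyms, .initState, .numSets, .outStates, .outWits]

/-- The tables that hold the input or the output of Right-Con. -/
def Tab.inOut : List Tab :=
  [.delta, .acc, .reached, .outDelta, .outWord, .outWordLen, .outU, .outULen, .outV, .outVLen]

/-- The memory holds the input `A`, the words `W 0, …, W (r - 1)` with the states that `A`
reaches on them, the transition table `dl`, and the list `D` of witnesses. -/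
structure Rep (A : Acceptor (Fin k) (Fin n)) (r : ℕ) (W : ℕ → List (Fin k))
    (D : List (UPWord (Fin k))) (dl : ℕ → ℕ → ℕ) (s : Store) : Prop where
  input : s.HoldsInput A
  outStates : s.var .outStates = r
  outDelta : s.tab .outDelta = dl
  word : ∀ i < r, s.row .outWord i (s.tab .outWordLen i 0) = (W i).map Fin.val
  reached : ∀ i < r, s.tab .reached i 0 = (A.reach (W i) : ℕ)
  outWits : s.var .outWits = D.length
  wit : ∀ i w, D[i]? = some w →
    s.row .outU i (s.tab .outULen i 0) = w.pre.map Fin.val ∧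
    s.row .outV i (s.tab .outVLen i 0) = w.per.map Fin.val

variable {A : Acceptor (Fin k) (Fin n)} {r : ℕ} {W : ℕ → List (Fin k)}
  {D : List (UPWord (Fin k))} {dl : ℕ → ℕ → ℕ} {s s' : Store}

theorem Rep.congr (h : Rep A r W D dl s) (hv : ∀ x ∈ Var.inOut, s'.var x = s.var x)
    (ht : ∀ t ∈ Tab.inOut, s'.tab t = s.tab t) : Rep A r W D dl s' := by
  simp only [Var.inOut, Tab.inOut, List.mem_cons, List.not_mem_nil, or_false, forall_eq_or_imp,
    forall_eq] at hv ht
  obtain ⟨h1, h2, h3, h4, h5, h6, h7⟩ := h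
  exact ⟨h1.congr (by simp [hv]) (by simp [ht]), by simp [hv, h2], by simp [ht, h3],
    by simpa [Store.row, ht] using h4, by simpa [ht] using h5, by simp [hv, h6],
    by simpa [Store.row, ht] using h7⟩

theorem Rep.setVar (h : Rep A r W D dl s) (x : Var) (m : ℕ) (hx : x ∉ Var.inOut) :
    Rep A r W D dl (s.setVar x m) :=
  h.congr (fun y hy => by simp [show y ≠ x by rintro rfl; exact hx hy]) fun _ _ => rfl

theorem Rep.wordLen (h : Rep A r W D dl s) {i : ℕ} (hi : i < r) :
    s.tab .outWordLen i 0 = (W i).length := by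
  simpa [Store.row] using congrArg List.length (h.word i hi)

theorem Rep.take (h : Rep A r W D dl s) (m : ℕ) :
    Rep A r W (D.take m) dl (s.setVar .outWits (D.take m).length) := by
  obtain ⟨h1, h2, h3, h4, h5, h6, h7⟩ := h
  refine ⟨h1.congr (by simp) (by simp), by simpa using h2, h3, h4, h5, by simp, fun i w hi => ?_⟩
  rw [List.getElem?_take] at hi
  split_ifs at hi
  exact h7 i w hi

theorem Rep.setOutDelta (h : Rep A r W D dl s) (i j m : ℕ) :
    Rep A r W D (Function.update dl i (Function.update (dl i) j m)) (s.setTab .outDelta i j m) := by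
  obtain ⟨h1, h2, h3, h4, h5, h6, h7⟩ := h
  refine ⟨h1.congr (by simp) (by simp [Store.setTab_tab_of_ne]), h2, ?_, ?_, ?_, h6, ?_⟩
  · rw [Store.setTab_tab_self, h3]
  · simpa [Store.row, Store.setTab_tab_of_ne] using h4
  · simpa [Store.setTab_tab_of_ne] using h5
  · simpa [Store.row, Store.setTab_tab_of_ne] using h7

theorem runs_addWitness (h : Rep A r W D dl s) (w : UPWord (Fin k))
    (hU : s.row .testU 0 (s.var .testULen) = w.pre.map Fin.val)
    (hV : s.row .testV 0 (s.var .testVLen) = w.per.map Fin.val) :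
    Runs addWitness s (4 * (w.pre.length + w.per.length) + 10) fun s' =>
      Rep A r W (D ++ [w]) dl s' ∧ ∀ x, x ≠ .pos → x ≠ .outWits → s'.var x = s.var x := by
  have hUl : s.var .testULen = w.pre.length := by
    simpa [Store.row] using congrArg List.length hU
  have hVl : s.var .testVLen = w.per.length := by
    simpa [Store.row] using congrArg List.length hV
  obtain ⟨h1, h2, h3, h4, h5, h6, h7⟩ := h
  rw [hUl] at hU
  rw [hVl] at hV
  refine (Runs.cons ((runs_copyRow (vi := 0) (vi' := D.length) (L := w.pre.length) ?_
    (Or.inl (by decide))).mono le_rfl ?_)).mono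
    (τ := (4 * w.pre.length + 3) + (1 + ((4 * w.per.length + 3) + (1 + (1 + 1))))) (by omega)
    fun _ h => h
  · intro f m _
    simp [Arith.eval, Store.copied, h6, hUl]
  rintro _ rfl
  refine Runs.write_cons ?_
  refine (Runs.cons ((runs_copyRow (vi := 0) (vi' := D.length) (L := w.per.length) ?_
    (Or.inl (by decide))).mono le_rfl ?_))
  · intro f m _
    simp [Arith.eval, Store.copied, h6, hVl, Store.setTab]
  rintro _ rfl
  refine Runs.write_cons (Runs.assign_cons (Runs.nil ⟨?_, ?_⟩))
  · refine ⟨h1.congr (by simp [Store.copied]) (by simp [Store.copied, Store.setTab]), ?_, ?_, ?_, ?_,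
      ?_, ?_⟩
    · simp [Store.copied, h2]
    · simp [Store.copied, h3, Store.setTab]
    · simpa [Store.copied, Store.setTab, Store.row] using h4
    · simpa [Store.copied, Store.setTab] using h5
    · simp [Store.copied, h6, Arith.eval]
    · intro i w' hi
      rw [List.getElem?_append] at hi
      split_ifs at hi with hlt
      · have := h7 i w' hi
        simpa [Store.copied, Store.setTab, Store.row, Arith.eval, h6, Function.update_apply,
          hlt.ne] using this
      · have hi' : i = D.length := by
          by_contra hc
          have : i - D.length ≠ 0 := by omega
          simp [this] at hi
        subst hi'
        simp at hi
        subst hi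
        rw [← hU, ← hV]
        simp only [Store.copied, Store.setTab, Store.row, Arith.eval, h6, Function.update_apply,
          Store.setVar, hUl, hVl]
        simp
        constructor <;> (intro j hj hj'; omega)
  · intro x hx hx'
    simp [Store.copied, hx, hx']

theorem runs_addState (h : Rep A r W D dl s) {x : ℕ} {a : Fin k} (hx : x < r)
    (hcw : s.var .curWord = x) (hcs : s.var .curSym = a)
    (harg : s.var .arg₁ = (A.reach (W x ++ [a]) : ℕ)) :
    Runs addState s (4 * (W x).length + 9) fun s' =>
      Rep A (r + 1) (Function.update W r (W x ++ [a])) D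
        (Function.update dl x (Function.update (dl x) a r)) s' ∧
      ∀ y, y ≠ .pos → y ≠ .outStates → s'.var y = s.var y := by
  have hlen := h.wordLen hx
  obtain ⟨h1, h2, h3, h4, h5, h6, h7⟩ := h
  refine (Runs.cons ((runs_copyRow (vi := x) (vi' := r) (L := (W x).length) ?_
    (Or.inr hx.ne)).mono le_rfl ?_)).mono
    (τ := (4 * (W x).length + 3) + (1 + (1 + (1 + (1 + (1 + 1)))))) (by omega)
    fun _ h => h
  · intro f m _
    simp [Arith.eval, Store.copied, h2, hcw, hlen]
  rintro _ rfl
  refine Runs.write_cons (Runs.write_cons (Runs.write_cons (Runs.write_cons (Runs.assign_cons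
    (Runs.nil ⟨?_, ?_⟩)))))
  · refine ⟨h1.congr (by simp [Store.copied]) (by simp [Store.copied, Store.setTab]), ?_, ?_, ?_, ?_,
      ?_, ?_⟩
    · simp [Store.copied, h2, Arith.eval]
    · simp [Store.copied, h3, Store.setTab, Arith.eval, hcw, hcs, h2]
    · intro i hi
      by_cases hir : i = r
      · subst hir
        have := h4 x hx
        rw [hlen] at this
        simp [Store.copied, Store.setTab, Store.row, Arith.eval, hcw, hcs, h2, hlen,
          List.range_succ, ← this, Function.update_apply]
        intro j hj
        simp [hj.ne, hj]
      · have := h4 i (by omega)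
        simpa [Store.copied, Store.setTab, Store.row, Arith.eval, hcw, hcs, h2, hlen, hir,
          Function.update_apply] using this
    · intro i hi
      by_cases hir : i = r
      · subst hir
        simp [Store.copied, Store.setTab, Arith.eval, h2, harg]
      · have := h5 i (by omega)
        simpa [Store.copied, Store.setTab, Arith.eval, h2, hir] using this
    · simp [Store.copied, h6]
    · simpa [Store.copied, Store.setTab, Store.row] using h7
  · intro y hy hy'
    simp [Store.copied, hy, hy']

end

/-! ### The correctness invariant of Right-Con -/

section

variable {k n : ℕ} {A : Acceptor (Fin k) (Fin n)} {r : ℕ} {W : ℕ → List (Fin k)}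
  {D : List (UPWord (Fin k))} {dl : ℕ → ℕ → ℕ} {x c : ℕ}

/-- The transition on the `a`-th symbol from the `i`-th word has been determined, when the
algorithm is about to treat the `c`-th symbol at the `x`-th word. -/
def Processed (x c i a : ℕ) : Prop := i < x ∨ i = x ∧ a < c

/-- The correctness invariant of Right-Con, when it is about to treat the `c`-th symbol at the
`x`-th word: the words `W 0, …, W (r - 1)` found so far are pairwise distinguished by witnesses in
`D` (`dist`), every determined transition goes to a word of the right class (`done`), and every word
other than the empty one extends an earlier word by a symbol, along a determined transition
(`tree`). -/
structure Explored (A : Acceptor (Fin k) (Fin n)) (r : ℕ) (W : ℕ → List (Fin k))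
    (D : List (UPWord (Fin k))) (dl : ℕ → ℕ → ℕ) (x c : ℕ) : Prop where
  pos : 0 < r
  zero : W 0 = []
  len : ∀ i < r, (W i).length ≤ i
  dist : ∀ i < r, ∀ j < i, ∃ w ∈ D, Xor (w.word ∈ A.residual (W i)) (w.word ∈ A.residual (W j))
  done : ∀ i < r, ∀ a : Fin k, Processed x c i a →
    ∃ j < r, dl i a = j ∧ A.residual (W i ++ [a]) = A.residual (W j)
  tree : ∀ j < r, 0 < j → ∃ i < j, ∃ a : Fin k, Processed x c i a ∧ W j = W i ++ [a] ∧ dl i a = j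

theorem Explored.initial : Explored A 1 (fun _ => []) [] dl 0 0 where
  pos := one_pos
  zero := rfl
  len := by simp
  dist := by simp
  done := by simp [Processed]
  tree := by omega

/-- The transition that is about to be determined is not among those determined before. -/
theorem Explored.update_of_processed {i : ℕ} {a : Fin k} {m : ℕ} (hp : Processed x c i a) :
    Function.update dl x (Function.update (dl x) c m) i a = dl i a := by
  rcases hp with h | ⟨rfl, h⟩
  · rw [Function.update_of_ne h.ne]
  · rw [Function.update_self, Function.update_of_ne h.ne]

theorem Processed.succ {i a : ℕ} (h : Processed x c i a) : Processed x (c + 1) i a :=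
  h.imp id fun h => ⟨h.1, by omega⟩

theorem Processed.of_succ {i a : ℕ} (h : Processed x (c + 1) i a) :
    Processed x c i a ∨ i = x ∧ a = c := by
  unfold Processed at *; omega

/-- The word reached by the next transition is equivalent to the known word `W j`. -/
theorem Explored.found (h : Explored A r W D dl x c) (a : Fin k) (ha : (a : ℕ) = c) {j : ℕ}
    (hj : j < r) (he : A.residual (W x ++ [a]) = A.residual (W j)) :
    Explored A r W D (Function.update dl x (Function.update (dl x) c j)) x (c + 1) where
  pos := h.pos
  zero := h.zero
  len := h.len
  dist := h.dist
  done i hi b hb := by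
    rcases hb.of_succ with hb | ⟨rfl, hbc⟩
    · rw [update_of_processed hb]; exact h.done i hi b hb
    · obtain rfl : b = a := Fin.ext (hbc.trans ha.symm)
      exact ⟨j, hj, by simp [hbc], he⟩
  tree i hi hi0 := by
    obtain ⟨i', h1, b, h2, h3, h4⟩ := h.tree i hi hi0
    exact ⟨i', h1, b, h2.succ, h3, by rw [update_of_processed h2]; exact h4⟩

/-- The word reached by the next transition is distinguished by `D'` from all known words, and
becomes a new word. -/
theorem Explored.new (h : Explored A r W D dl x c) (hx : x < r) (a : Fin k) (ha : (a : ℕ) = c)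
    {D' : List (UPWord (Fin k))} (hD : ∀ j < r, ∃ w ∈ D',
      Xor (w.word ∈ A.residual (W x ++ [a])) (w.word ∈ A.residual (W j))) :
    Explored A (r + 1) (Function.update W r (W x ++ [a])) (D ++ D')
      (Function.update dl x (Function.update (dl x) c r)) x (c + 1) := by
  have hW : ∀ i < r, Function.update W r (W x ++ [a]) i = W i := fun i hi =>
    Function.update_of_ne hi.ne _ _
  constructor
  · omega
  · rw [hW 0 h.pos, h.zero]
  · intro i hi
    rcases Nat.lt_succ_iff_lt_or_eq.1 hi with hi | rfl
    · rw [hW i hi]; exact h.len i hi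
    · have := h.len x hx
      simp; omega
  · intro i hi j hj
    rcases Nat.lt_succ_iff_lt_or_eq.1 hi with hi | rfl
    · rw [hW i hi, hW j (hj.trans hi)]
      obtain ⟨w, hw, hx⟩ := h.dist i hi j hj
      exact ⟨w, List.mem_append_left _ hw, hx⟩
    · rw [hW j hj, Function.update_self]
      obtain ⟨w, hw, hx⟩ := hD j hj
      exact ⟨w, List.mem_append_right _ hw, hx⟩
  · intro i hi b hb
    have hir : i < r := by
      rcases hb with h | ⟨rfl, -⟩ <;> omega
    rw [hW i hir]
    rcases hb.of_succ with hb | ⟨rfl, hbc⟩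
    · rw [update_of_processed hb]
      obtain ⟨j, hj, h1, h2⟩ := h.done i hir b hb
      exact ⟨j, by omega, h1, by rw [hW j hj]; exact h2⟩
    · obtain rfl : b = a := Fin.ext (hbc.trans ha.symm)
      exact ⟨r, by omega, by simp [hbc], by simp⟩
  · intro j hj hj0
    rcases Nat.lt_succ_iff_lt_or_eq.1 hj with hj | rfl
    · obtain ⟨i', h1, b, h2, h3, h4⟩ := h.tree j hj hj0
      exact ⟨i', h1, b, h2.succ, by rw [hW _ hj, hW _ (h1.trans hj), h3],
        by rw [update_of_processed h2]; exact h4⟩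
    · exact ⟨x, hx, a, Or.inr ⟨rfl, by omega⟩, by rw [hW x hx]; simp, by simp [ha]⟩

theorem Explored.next (h : Explored A r W D dl x k) : Explored A r W D dl (x + 1) 0 where
  pos := h.pos
  zero := h.zero
  len := h.len
  dist := h.dist
  done i hi a ha := h.done i hi a (by have := a.isLt; unfold Processed at *; omega)
  tree j hj hj0 := by
    obtain ⟨i', h1, b, h2, h3, h4⟩ := h.tree j hj hj0
    exact ⟨i', h1, b, Or.inl (by unfold Processed at *; omega), h3, h4⟩

/-- Words that are distinguished by a witness lead to different states of `A`, so there are at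
most `n` of them. -/
theorem Explored.le_card (h : Explored A r W D dl x c) : r ≤ n := by
  have hinj : Function.Injective fun i : Fin r => A.reach (W i) := by
    have key : ∀ i j : Fin r, (j : ℕ) < i → A.reach (W i) ≠ A.reach (W j) := by
      intro i j hji he
      obtain ⟨w, -, hw⟩ := h.dist i i.isLt j hji
      rw [Acceptor.residual, Acceptor.residual, he, xor_self] at hw
      exact hw
    intro i j hij
    rcases lt_trichotomy (i : ℕ) j with hl | hl | hl
    · exact (key j i hl hij.symm).elim
    · exact Fin.ext hl
    · exact (key i j hl hij).elim
  simpa using Fintype.card_le_of_injective _ hinj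

/-- The complete exploration yields the right congruence automaton: by `done`, each word is right
congruent to the name of the state that it reaches, by `dist`, different states have different
classes, and by `tree`, the name of a state leads to this state. -/
theorem Explored.result (h : Explored A r W D dl r 0) :
    ∃ (M : Automaton (Fin k) (Fin r)), (M.init : ℕ) = 0 ∧
      (∀ (x : Fin r) (a : Fin k), dl x a = (M.step x a : ℕ)) ∧
      W M.init = [] ∧ (∀ x : Fin r, M.reach (W x) = x) ∧
      M.Isomorphic (rightCongruenceAutomaton A.language) ∧
      ∀ x₁ x₂ : List (Fin k), M.reach x₁ ≠ M.reach x₂ →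
        ∃ w ∈ D, Xor (x₁ ++ₛ w.word ∈ A.language) (x₂ ++ₛ w.word ∈ A.language) := by
  have hdone := fun (i : Fin r) (a : Fin k) => h.done i i.isLt a (Or.inl i.isLt)
  choose f hf hdl hres using hdone
  let M : Automaton (Fin k) (Fin r) := ⟨⟨0, h.pos⟩, fun i a => ⟨f i a, hf i a⟩⟩
  have hreach : ∀ u, A.residual u = A.residual (W (M.reach u)) := by
    intro u
    induction u using List.reverseRecOn with
    | nil =>
      change _ = A.residual (W 0)
      rw [h.zero]
    | append_singleton u a ih =>
      rw [M.reach_append_singleton, A.residual_append ih a, hres]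
  have hdist : ∀ i j : Fin r, i ≠ j →
      ∃ w ∈ D, Xor (w.word ∈ A.residual (W i)) (w.word ∈ A.residual (W j)) := by
    intro i j hij
    rcases lt_or_gt_of_ne (Fin.val_ne_of_ne hij) with hl | hl
    · obtain ⟨w, hw, hx⟩ := h.dist j j.isLt i hl
      exact ⟨w, hw, by rw [xor_comm]; exact hx⟩
    · exact h.dist i i.isLt j hl
  have hiff : ∀ u v, M.reach u = M.reach v ↔ (rightCongruence A.language) u v := by
    intro u v
    rw [A.rightCongruence_iff]
    change _ ↔ A.residual u = A.residual v
    constructor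
    · intro he
      rw [hreach u, hreach v, he]
    · intro he
      by_contra hne
      obtain ⟨w, -, hx⟩ := hdist _ _ hne
      rw [← hreach, ← hreach, he, xor_self] at hx
      exact hx
  have hname : ∀ i (hi : i < r), M.reach (W i) = ⟨i, hi⟩ := by
    intro i
    induction i using Nat.strong_induction_on with
    | _ i ih =>
      intro hi
      rcases Nat.eq_zero_or_pos i with rfl | hi0
      · rw [h.zero]; rfl
      · obtain ⟨j, hj, a, -, hW, hd⟩ := h.tree i hi hi0
        rw [hW, M.reach_append_singleton, ih j hj (hj.trans hi)]
        exact Fin.ext ((hdl ⟨j, _⟩ a).symm.trans hd)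
  refine ⟨M, rfl, hdl, h.zero, fun x => hname x x.isLt, ?_, ?_⟩
  · let e : Quotient (rightCongruence A.language) ≃ Fin r :=
      ⟨Quotient.lift M.reach fun u v huv => (hiff u v).2 huv, fun i => Quotient.mk _ (W i), by
        rintro ⟨u⟩
        exact Quotient.sound ((hiff _ _).1 (hname _ (M.reach u).isLt)), fun i => hname i i.isLt⟩
    refine ⟨e.symm, e.injective ?_, fun q a => e.injective ?_⟩
    · rw [e.apply_symm_apply]; rfl
    · rw [e.apply_symm_apply]
      change _ = M.reach (W q ++ [a])
      rw [M.reach_append_singleton, hname q q.isLt]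
  · intro x₁ x₂ hne
    obtain ⟨w, hw, hx⟩ := hdist _ _ hne
    refine ⟨w, hw, ?_⟩
    rw [A.append_mem_language, A.append_mem_language]
    rw [← hreach, ← hreach] at hx
    exact hx

end

/-! ### Right-Con with a state test -/

section

variable {k n : ℕ} {A : Acceptor (Fin k) (Fin n)} {r : ℕ} {W : ℕ → List (Fin k)}
  {D : List (UPWord (Fin k))} {dl : ℕ → ℕ → ℕ} {x c : ℕ} {T : Cmd}

/-- The invariant of the search for a word equivalent to the `x`-th word followed by `a`. Either
no equivalent word has been found, and the witnesses `D'`, which the search has added to `D`,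
refute all candidates tried; or an equivalent word has been found, and the witnesses `D'` have
been dropped. -/
def Searching (A : Acceptor (Fin k) (Fin n)) (r : ℕ) (W : ℕ → List (Fin k))
    (D : List (UPWord (Fin k))) (dl : ℕ → ℕ → ℕ) (x : ℕ) (a : Fin k) (s : Store) : Prop :=
  s.var .curWord = x ∧ s.var .curSym = a ∧ s.var .arg₁ = (A.reach (W x ++ [a]) : ℕ) ∧
  s.var .oldWits = D.length ∧
  ((∃ D', Rep A r W (D ++ D') dl s ∧ s.var .found = 0 ∧ s.var .cand ≤ r ∧
      ∀ j < s.var .cand, ∃ w ∈ D',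
        Xor (w.word ∈ A.residual (W x ++ [a])) (w.word ∈ A.residual (W j))) ∨
    (s.var .found = 1 ∧ s.var .cand < r ∧
      Rep A r W D (Function.update dl x (Function.update (dl x) a (s.var .cand))) s ∧
      A.residual (W x ++ [a]) = A.residual (W (s.var .cand))))

/-- On the acceptor `A`, the program `T` is a correct test of two states that halts within `P`
steps and returns witnesses of total length at most `P`. -/
def TestsWithin (T : Cmd) (A : Acceptor (Fin k) (Fin n)) (P : ℕ) : Prop :=
  ∀ (q₁ q₂ : Fin n) (s : Store), s.HoldsInput A → s.var .arg₁ = (q₁ : ℕ) →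
    s.var .arg₂ = (q₂ : ℕ) → Runs T s P fun s' =>
      (∀ x : Var, ¬ x.TestMayChange → s'.var x = s.var x) ∧
      (∀ b : Tab, ¬ b.TestMayChange → s'.tab b = s.tab b) ∧
      ((s'.var .ans = 1 ∧ (A.withInit q₁).language = (A.withInit q₂).language) ∨
       (s'.var .ans = 0 ∧ ∃ w : UPWord (Fin k),
          s'.row .testU 0 (s'.var .testULen) = w.pre.map Fin.val ∧
          s'.row .testV 0 (s'.var .testVLen) = w.per.map Fin.val ∧
          w.pre.length + w.per.length ≤ P ∧
          Xor (w.word ∈ (A.withInit q₁).language) (w.word ∈ (A.withInit q₂).language)))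

/-- The test of one candidate in the search for an equivalent word. -/
def searchBody (T : Cmd) : Cmd :=
  .block [
    .assign .arg₂ (.get .reached (.var .cand) (.lit 0)),
    T,
    .cond (.var .ans)
      (.block [
        .write .outDelta (.var .curWord) (.var .curSym) (.var .cand),
        .assign .outWits (.var .oldWits),
        .assign .found (.lit 1)])
      (.block [
        addWitness,
        .assign .cand (.add (.var .cand) (.lit 1))])]

/-- The variant `r - cand - found` decreases, since the test either finds an equivalent word or
moves on to the next candidate. -/
theorem runs_searchBody {P : ℕ} (hT : TestsWithin T A P) {a : Fin k} {s : Store}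
    (h : Searching A r W D dl x a s)
    (hg : (Arith.sub (.lt (.var .cand) (.var .outStates)) (.var .found)).eval s ≠ 0) :
    Runs (searchBody T) s (5 * P + 20) fun s' => Searching A r W D dl x a s' ∧
      r - s'.var .cand - s'.var .found < r - s.var .cand - s.var .found := by
  obtain ⟨hcw, hcs, harg, how, ⟨D', hR, hf, hcr, hD'⟩ | ⟨hf, -⟩⟩ := h
  swap
  · simp only [Arith.eval, hf] at hg
    exact (hg (by by_cases hc : s.var .cand < s.var .outStates <;> simp [hc])).elim
  have hlt : s.var .cand < r := by
    simp only [Arith.eval, hf, hR.outStates] at hg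
    by_contra hc
    simp [hc] at hg
  refine (Runs.assign_cons (Runs.cons ((hT (A.reach (W x ++ [a])) (A.reach (W (s.var .cand))) _
    (hR.setVar .arg₂ _ (by decide)).input ?_ ?_).mono le_rfl ?_))).mono
      (τ := 1 + (P + (5 * P + 20 - P - 1))) (by omega) fun _ h => h
  · simpa using harg
  · simpa [Arith.eval] using hR.reached _ hlt
  intro s₂ ⟨hv, ht, hans⟩
  have hR₂ : Rep A r W (D ++ D') dl s₂ := hR.congr
    (fun y hy => by
      rw [hv y (by fin_cases hy <;> exact id)]
      simp [show y ≠ .arg₂ by rintro rfl; exact absurd hy (by decide)])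
    (fun t ht' => ht t (by fin_cases ht' <;> exact id))
  have e₁ : s₂.var .curWord = x := by rw [hv _ id]; simpa using hcw
  have e₂ : s₂.var .curSym = a := by rw [hv _ id]; simpa using hcs
  have e₃ : s₂.var .arg₁ = (A.reach (W x ++ [a]) : ℕ) := by rw [hv _ id]; simpa using harg
  have e₄ : s₂.var .oldWits = D.length := by rw [hv _ id]; simpa using how
  have e₅ : s₂.var .cand = s.var .cand := by rw [hv _ id]; simp
  have e₆ : s₂.var .found = 0 := by rw [hv _ id]; simpa using hf
  refine (Runs.cons (τ' := 1) (Runs.cond (τ := 4 * P + 12) ?_ ?_)).mono (by omega) fun _ h => h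
  · intro hne
    obtain ⟨-, he⟩ | ⟨h0, -⟩ := hans
    swap
    · exact (hne h0).elim
    refine (Runs.write_cons (Runs.assign_cons (Runs.assign_cons (Runs.nil (Runs.nil ?_))))).mono
      (by omega) fun _ h => h
    have hR₃ := ((hR₂.setOutDelta x a (s.var .cand)).take D.length).setVar .found 1 (by decide)
    simp only [List.take_left'] at hR₃
    simp only [Arith.eval, Store.setTab_var, e₁, e₂, e₅, Store.setVar_var]
    simp only [reduceCtorEq, if_false, e₄]
    exact ⟨⟨by simp [e₁], by simp [e₂], by simp [e₃], by simp [e₄],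
      Or.inr ⟨by simp, by simp [e₅, hlt], by simpa [e₅] using hR₃, by simpa [e₅, Acceptor.residual] using he⟩⟩,
      by simp [hf]; omega⟩
  · intro h0
    obtain ⟨h1, -⟩ | ⟨-, w, hU, hV, hlen, hx⟩ := hans
    · simp [Arith.eval, h1] at h0
    refine (Runs.cons ((runs_addWitness hR₂ w hU hV).mono (τ' := 4 * P + 10) (by omega)
      ?_)).mono (τ := (4 * P + 10) + 2) (by omega) fun _ h => h
    intro s₃ ⟨hR₃, hv₃⟩
    have h₅ : s₃.var .cand = s.var .cand := by rw [hv₃ _ (by decide) (by decide), e₅]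
    have h₆ : s₃.var .found = 0 := by rw [hv₃ _ (by decide) (by decide), e₆]
    refine Runs.assign_cons (Runs.nil (Runs.nil ⟨⟨?_, ?_, ?_, ?_,
      Or.inl ⟨D' ++ [w], ?_, ?_, ?_, ?_⟩⟩, ?_⟩))
    · simp [hv₃, e₁]
    · simp [hv₃, e₂]
    · simp [hv₃, e₃]
    · simp [hv₃, e₄]
    · rw [← List.append_assoc]; exact hR₃.setVar _ _ (by decide)
    · simp [h₆]
    · simp [Arith.eval, h₅]; omega
    · intro j hj
      simp [Arith.eval, h₅] at hj
      rcases Nat.lt_succ_iff_lt_or_eq.1 (Nat.lt_succ_of_le hj) with hj | rfl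
      · obtain ⟨w', hw', hx'⟩ := hD' j hj
        exact ⟨w', List.mem_append_left _ hw', hx'⟩
      · exact ⟨w, by simp, hx⟩
    · simp [Arith.eval, h₅, h₆, hf]; omega

/-- The treatment of one symbol at one word. -/
def symBody (T : Cmd) : Cmd :=
  .block [
    .assign .arg₁ (.get .delta (.get .reached (.var .curWord) (.lit 0)) (.var .curSym)),
    .assign .oldWits (.var .outWits),
    .assign .found (.lit 0),
    .assign .cand (.lit 0),
    .loop (.sub (.lt (.var .cand) (.var .outStates)) (.var .found)) (searchBody T),
    .cond (.var .found) .skip addState,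
    .assign .curSym (.add (.var .curSym) (.lit 1))]

/-- The memory holds a correct partial result, and the next step is to treat the symbol
`curSym` at the word `curWord`. -/
def Exploring (A : Acceptor (Fin k) (Fin n)) (x : ℕ) (s : Store) : Prop :=
  s.var .curWord = x ∧ s.var .curSym ≤ k ∧ ∃ r W D dl, x < r ∧ Rep A r W D dl s ∧
    Explored A r W D dl x (s.var .curSym)

/-- A bound for the running time of `symBody`. -/
def symTime (z P : ℕ) : ℕ := z * (5 * P + 21) + 4 * z + 20

theorem runs_symBody {P : ℕ} (hT : TestsWithin T A P) {s : Store} (h : Exploring A x s)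
    (hk : s.var .curSym < k) :
    Runs (symBody T) s (symTime A.size P) fun s' => Exploring A x s' ∧
      s'.var .curSym = s.var .curSym + 1 := by
  obtain ⟨hcw, -, r, W, D, dl, hx, hR, hE⟩ := h
  obtain ⟨a, ha⟩ : ∃ a : Fin k, (a : ℕ) = s.var .curSym := ⟨⟨_, hk⟩, rfl⟩
  have hrz : r ≤ A.size := hE.le_card.trans (A.card_states_le_size (by omega))
  have hz : r * (5 * P + 21) ≤ A.size * (5 * P + 21) := Nat.mul_le_mul_right _ hrz
  have hcs : s.var .curSym = a := ha.symm
  have hdelta : s.tab .delta (A.reach (W x)) a = (A.reach (W x ++ [a]) : ℕ) := by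
    rw [hR.input.2.2.2.1, A.reach_append_singleton]
  refine (Runs.assign_cons (Runs.assign_cons (Runs.assign_cons (Runs.assign_cons (Runs.cons
    (τ := r * (5 * P + 21) + 1) (τ' := (4 * A.size + 11) + 2)
    ((Runs.loop (fun s => r - s.var .cand - s.var .found)
      (fun s hs hg => runs_searchBody hT (x := x) (W := W) (D := D) (dl := dl) (a := a) hs hg) _ ?_).mono
        ?_ ?_)))))).mono
      (by unfold symTime; omega) fun _ h => h
  · refine ⟨by simp [hcw], by simp [hcs], ?_, by simp [Arith.eval, hR.outWits],
      Or.inl ⟨[], ?_, ?_, ?_, ?_⟩⟩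
    · simp [Arith.eval, hcw, hcs, hR.reached _ hx, hdelta]
    · rw [List.append_nil]
      exact (((hR.setVar _ _ (by decide)).setVar _ _ (by decide)).setVar _ _ (by decide)).setVar _ _
        (by decide)
    · simp [Arith.eval]
    · simp [Arith.eval]
    · simp [Arith.eval]
  · simp [Arith.eval]
  rintro s₂ ⟨⟨h₁, h₂, h₃, -, ⟨D', hR', hf, hc, hD'⟩ | ⟨hf, hc, hR', he⟩⟩, hg⟩
  · have hr : s₂.var .cand = r := by
      simp only [Arith.eval, hf, hR'.outStates] at hg
      by_contra hne
      simp [lt_of_le_of_ne hc hne] at hg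
    rw [hr] at hD'
    have hl := hE.len x hx
    refine Runs.cons (Runs.cond (τ := 4 * A.size + 10) (fun hne => (hne hf).elim) fun _ =>
      (runs_addState hR' hx h₁ h₂ h₃).mono (by omega) ?_)
    rintro s₃ ⟨hR₃, hv⟩
    have e₁ : s₃.var .curWord = x := by rw [hv _ (by decide) (by decide), h₁]
    have e₂ : s₃.var .curSym = a := by rw [hv _ (by decide) (by decide), h₂]
    refine Runs.assign_cons (Runs.nil ⟨⟨?_, ?_, r + 1, _, _, _, by omega,
      hR₃.setVar _ _ (by decide), ?_⟩, ?_⟩)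
    · simp [e₁]
    · simp [Arith.eval, e₂]
    · simp only [Store.setVar_var, if_true, Arith.eval, e₂]
      rw [hcs] at hE
      exact hE.new hx a rfl hD'
    · simp [Arith.eval, e₂, hcs]
  · refine Runs.cons (Runs.cond (τ := 4 * A.size + 10) (fun _ => (Runs.skip ?_).mono (by omega)
      fun _ h => h) fun h0 => by simp [Arith.eval, hf] at h0)
    refine Runs.assign_cons (Runs.nil ⟨⟨?_, ?_, r, _, _, _, hx,
      hR'.setVar _ _ (by decide), ?_⟩, ?_⟩)
    · simp [h₁]
    · simp [Arith.eval, h₂]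
    · simp only [Store.setVar_var, if_true, Arith.eval, h₂]
      rw [hcs] at hE
      exact hE.found a rfl hc he
    · simp [Arith.eval, h₂, hcs]

/-- Right-Con with its loop bodies as named programs. -/
theorem rightCon_eq (T : Cmd) : rightCon T = .block [
    .assign .outStates (.lit 1),
    .assign .outWits (.lit 0),
    .write .outWordLen (.lit 0) (.lit 0) (.lit 0),
    .write .reached (.lit 0) (.lit 0) (.var .initState),
    .assign .curWord (.lit 0),
    .loop (.lt (.var .curWord) (.var .outStates)) (.block [
      .assign .curSym (.lit 0),
      .loop (.lt (.var .curSym) (.var .numSyms)) (symBody T),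
      .assign .curWord (.add (.var .curWord) (.lit 1))])] := rfl

/-- A bound for the running time of Right-Con. -/
def rightConTime (z P : ℕ) : ℕ := (z + 1) * (z * (symTime z P + 1) + 6) + 10

theorem runs_wordBody {P : ℕ} (hT : TestsWithin T A P) {s : Store} {r : ℕ}
    (hx : s.var .curWord < r) (hR : Rep A r W D dl s) (hE : Explored A r W D dl (s.var .curWord) 0) :
    Runs (.block [
      .assign .curSym (.lit 0),
      .loop (.lt (.var .curSym) (.var .numSyms)) (symBody T),
      .assign .curWord (.add (.var .curWord) (.lit 1))]) s (A.size * (symTime A.size P + 1) + 5)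
      fun s' => s'.var .curWord = s.var .curWord + 1 ∧ ∃ r W D dl, s.var .curWord + 1 ≤ r ∧
        Rep A r W D dl s' ∧ Explored A r W D dl (s.var .curWord + 1) 0 := by
  have hz : k * (symTime A.size P + 1) ≤ A.size * (symTime A.size P + 1) :=
    Nat.mul_le_mul_right _ A.card_syms_le_size
  refine (Runs.assign_cons (Runs.cons (τ := A.size * (symTime A.size P + 1) + 1) (τ' := 2)
    ((Runs.loop (τ := symTime A.size P) (fun s => k - s.var .curSym)
      (I := Exploring A (s.var .curWord)) ?_ _ ?_).mono ?_ ?_))).mono (by omega) fun _ h => h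
  · intro s' hs hg
    have hk : s'.var .curSym < k := by
      obtain ⟨-, -, _, _, _, _, -, hR, -⟩ := hs
      by_contra hc
      simp [Arith.eval, hR.input.2.1, hc] at hg
    exact (runs_symBody hT hs hk).mono le_rfl fun _ h => ⟨h.1, by omega⟩
  · exact ⟨by simp, by simp [Arith.eval], r, W, D, dl, hx, hR.setVar _ _ (by decide),
      by simpa [Arith.eval] using hE⟩
  · simp only [Store.setVar_var, if_true, Arith.eval, Nat.sub_zero]
    omega
  · rintro s' ⟨⟨hcw, hle, r', W', D', dl', hx', hR', hE'⟩, hg⟩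
    have hk : s'.var .curSym = k := by
      by_contra hc
      simp [Arith.eval, hR'.input.2.1, lt_of_le_of_ne hle hc] at hg
    rw [hk] at hE'
    exact Runs.assign_cons (Runs.nil ⟨by simp [Arith.eval, hcw], r', W', D', dl', hx',
      hR'.setVar _ _ (by decide), hE'.next⟩)

theorem runs_rightCon {P : ℕ} (hT : TestsWithin T A P) {s : Store} (h : s.HoldsInput A) :
    Runs (rightCon T) s (rightConTime A.size P) fun s' =>
      ∃ r W D dl, Rep A r W D dl s' ∧ Explored A r W D dl r 0 := by
  rw [rightCon_eq]
  refine (Runs.assign_cons (Runs.assign_cons (Runs.write_cons (Runs.write_cons (Runs.assign_cons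
    (Runs.cons (τ := (A.size + 1) * (A.size * (symTime A.size P + 1) + 6) + 1) (τ' := 1)
    ((Runs.loop (τ := A.size * (symTime A.size P + 1) + 5) (fun s => A.size + 1 - s.var .curWord)
      (I := fun s => ∃ r W D dl, s.var .curWord ≤ r ∧ Rep A r W D dl s ∧
        Explored A r W D dl (s.var .curWord) 0) ?_ _ ?_).mono ?_ ?_))))))).mono
      (by unfold rightConTime; omega) fun _ h => h
  · rintro s ⟨r, W, D, dl, hle, hR, hE⟩ hg
    have hlt : s.var .curWord < r := by
      by_contra hc
      simp [Arith.eval, hR.outStates, hc] at hg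
    have hrz : r ≤ A.size + 1 := by
      rcases Nat.eq_zero_or_pos k with rfl | hk
      · by_contra hc
        obtain ⟨_, _, a, -⟩ := hE.tree 1 (by omega) one_pos
        exact a.elim0
      · exact (hE.le_card.trans (A.card_states_le_size hk)).trans (Nat.le_succ _)
    refine (runs_wordBody hT hlt hR hE).mono le_rfl ?_
    rintro s' ⟨hcw, r', W', D', dl', hle', hR', hE'⟩
    rw [hcw]
    exact ⟨⟨r', W', D', dl', hle', hR', hE'⟩, by omega⟩
  · refine ⟨1, fun _ => [], [], s.tab .outDelta, by simp [Arith.eval], ?_, ?_⟩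
    · refine ⟨h.congr (by simp) (by simp [Store.setTab_tab_of_ne]), ?_, ?_, ?_, ?_, ?_, ?_⟩
      · simp [Arith.eval]
      · simp [Store.setTab_tab_of_ne]
      · simp [Store.setTab_tab_of_ne, Store.row, Store.setTab_tab_self, Arith.eval]
      · simp [Store.setTab_tab_self, Arith.eval, h.2.2.1, Automaton.reach]
      · simp [Arith.eval]
      · simp
    · simpa [Arith.eval] using Explored.initial
  · simp only [Store.setVar_var, if_true, Arith.eval, Nat.sub_zero]
    apply le_of_eq
    ring
  · rintro s' ⟨⟨r, W, D, dl, hle, hR, hE⟩, hg⟩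
    have hr : s'.var .curWord = r := by
      by_contra hc
      simp [Arith.eval, hR.outStates, lt_of_le_of_ne hle hc] at hg
    rw [hr] at hE
    exact Runs.nil ⟨r, W, D, dl, hR, hE⟩

/-- Right-Con is correct and runs in polynomial time, with any test of two states. -/
theorem rightCon_correct (T : Cmd) (hT : IsStateTest T) :
    ∃ p : Polynomial ℕ, ∀ (k n : ℕ) (A : Acceptor (Fin k) (Fin n)) (s : Store),
      s.HoldsInput A →
      ∃ (t : ℕ) (s' : Store), Exec (rightCon T) s t s' ∧ t ≤ p.eval A.size ∧
        ∃ (r : ℕ) (M : Automaton (Fin k) (Fin r)) (name : Fin r → List (Fin k))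
          (D : List (UPWord (Fin k))),
          s'.HoldsOutput M name D ∧
          name M.init = [] ∧ (∀ x, M.reach (name x) = x) ∧
          M.Isomorphic (rightCongruenceAutomaton A.language) ∧
          ∀ x₁ x₂ : List (Fin k), M.reach x₁ ≠ M.reach x₂ →
            ∃ w ∈ D, Xor (x₁ ++ₛ w.word ∈ A.language) (x₂ ++ₛ w.word ∈ A.language) := by
  obtain ⟨p, hp⟩ := hT
  refine ⟨(.X + 1) * (.X * ((.X * (5 * p + 21) + 4 * .X + 20) + 1) + 6) + 10,
    fun k n A s hs => ?_⟩
  have hT' : TestsWithin T A (p.eval A.size) := by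
    intro q₁ q₂ s h h₁ h₂
    obtain ⟨t, s', he, ht, hv, htab, hans⟩ := hp k n A q₁ q₂ s h h₁ h₂
    exact ⟨t, s', he, ht, hv, htab, hans⟩
  obtain ⟨t, s', he, ht, r, W, D, dl, hR, hE⟩ := runs_rightCon hT' hs
  obtain ⟨M, h0, hdl, hW0, hW, hiso, hD⟩ := hE.result
  refine ⟨t, s', he, ht.trans (le_of_eq ?_), r, M, fun i => W i, D, ⟨hR.outStates, h0,
    fun x a => by rw [hR.outDelta]; exact hdl x a, fun x => hR.word x x.isLt, hR.outWits,
    fun i => hR.wit i _ (by simp)⟩, hW0, hW, hiso, hD⟩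
  simp [rightConTime, symTime]

end

/-! ### Programs with bounded loops -/

section

/-- Programs whose only loops are bounded loops: `forUpTo x b p` runs `p` with
`x = 0, 1, …, b - 1`, where `b` is a register. -/
inductive Prog where
  | skip
  | assign (x : Var) (e : Arith)
  | write (t : Tab) (i j e : Arith)
  | seq (p q : Prog)
  | ite (e : Arith) (p q : Prog)
  | forUpTo (x b : Var) (p : Prog)

namespace Prog

/-- The translation into a program of the machine. -/
def toCmd : Prog → Cmd
  | skip => .skip
  | assign x e => .assign x e
  | write t i j e => .write t i j e
  | seq p q => .seq p.toCmd q.toCmd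
  | ite e p q => .cond e p.toCmd q.toCmd
  | forUpTo x b p => .block [.assign x (.lit 0),
      .loop (.lt (.var x) (.var b)) (.block [p.toCmd, .assign x (.add (.var x) (.lit 1))])]

/-- The memory when the counter `x` of a loop whose body has the effect `f` equals `i`. -/
def iterate (x : Var) (f : Store → Store) (s : Store) : ℕ → Store
  | 0 => s.setVar x 0
  | i + 1 => (f (iterate x f s i)).setVar x (i + 1)

/-- The effect of a program on the memory. -/
def run : Prog → Store → Store
  | skip, s => s
  | assign x e, s => s.setVar x (e.eval s)
  | write t i j e, s => s.setTab t (i.eval s) (j.eval s) (e.eval s)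
  | seq p q, s => q.run (p.run s)
  | ite e p q, s => if e.eval s = 0 then q.run s else p.run s
  | forUpTo x b p, s => iterate x p.run s (s.var b)

/-- The registers that a program may change. -/
def vars : Prog → List Var
  | skip => []
  | assign x _ => [x]
  | write _ _ _ _ => []
  | seq p q => p.vars ++ q.vars
  | ite _ p q => p.vars ++ q.vars
  | forUpTo x _ p => x :: p.vars

/-- The tables that a program may change. -/
def tabs : Prog → List Tab
  | skip => []
  | assign _ _ => []
  | write t _ _ _ => [t]
  | seq p q => p.tabs ++ q.tabs
  | ite _ p q => p.tabs ++ q.tabs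
  | forUpTo _ _ p => p.tabs

/-- The registers in `fixed` are never changed, they contain the bounds of all loops, and the
body of a loop does not change the counter of the loop. -/
def Wf : Prog → List Var → Bool
  | skip, _ => true
  | assign x _, fixed => x ∉ fixed
  | write _ _ _ _, _ => true
  | seq p q, fixed => p.Wf fixed && q.Wf fixed
  | ite _ p q, fixed => p.Wf fixed && q.Wf fixed
  | forUpTo x b p, fixed => x ∉ fixed && b ∈ fixed && p.Wf (x :: fixed)

/-- A bound for the running time, as a polynomial in a bound for the registers that bound the
loops. -/
noncomputable def cost : Prog → Polynomial ℕ
  | skip => 1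
  | assign _ _ => 1
  | write _ _ _ _ => 1
  | seq p q => p.cost + q.cost
  | ite _ p q => p.cost + q.cost + 1
  | forUpTo _ _ p => .X * (p.cost + 3) + 3

theorem run_var_of_notMem {p : Prog} {y : Var} (h : y ∉ p.vars) (s : Store) :
    (p.run s).var y = s.var y := by
  induction p generalizing s with
  | skip => rfl
  | assign x e => simp only [vars, List.mem_singleton] at h; simp [run, h]
  | write t i j e => rfl
  | seq p q ihp ihq =>
    simp only [vars, List.mem_append, not_or] at h
    rw [run, ihq h.2, ihp h.1]
  | ite e p q ihp ihq =>
    simp only [vars, List.mem_append, not_or] at h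
    rw [run]
    split_ifs
    · exact ihq h.2 s
    · exact ihp h.1 s
  | forUpTo x b p ih =>
    simp only [vars, List.mem_cons, not_or] at h
    rw [run]
    induction s.var b with
    | zero => simp [iterate, h.1]
    | succ i ih' => simp [iterate, h.1, ih h.2, ih']

theorem run_tab_of_notMem {p : Prog} {t : Tab} (h : t ∉ p.tabs) (s : Store) :
    (p.run s).tab t = s.tab t := by
  induction p generalizing s with
  | skip => rfl
  | assign x e => rfl
  | write t' i j e =>
    simp only [tabs, List.mem_singleton] at h
    simp [run, Store.setTab_tab_of_ne _ _ _ _ h]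
  | seq p q ihp ihq =>
    simp only [tabs, List.mem_append, not_or] at h
    rw [run, ihq h.2, ihp h.1]
  | ite e p q ihp ihq =>
    simp only [tabs, List.mem_append, not_or] at h
    rw [run]
    split_ifs
    · exact ihq h.2 s
    · exact ihp h.1 s
  | forUpTo x b p ih =>
    rw [run]
    induction s.var b with
    | zero => simp [iterate]
    | succ i ih' => simp [iterate, ih h, ih']

/-- A well-formed program keeps the bounds of its loops. -/
theorem notMem_vars_of_wf {p : Prog} {fixed : List Var} (h : p.Wf fixed) {y : Var} (hy : y ∈ fixed) :
    y ∉ p.vars := by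
  induction p generalizing fixed with
  | skip => simp [vars]
  | assign x e =>
    simp only [Wf, decide_eq_true_eq] at h
    simp only [vars, List.mem_singleton]
    rintro rfl; exact h hy
  | write t' i j e => simp [vars]
  | seq p q ihp ihq =>
    simp only [Wf, Bool.and_eq_true] at h
    simp [vars, ihp h.1 hy, ihq h.2 hy]
  | ite e p q ihp ihq =>
    simp only [Wf, Bool.and_eq_true] at h
    simp [vars, ihp h.1 hy, ihq h.2 hy]
  | forUpTo x b p ih =>
    simp only [Wf, Bool.and_eq_true, decide_eq_true_eq] at h
    simp only [vars, List.mem_cons, not_or]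
    exact ⟨by rintro rfl; exact h.1.1 hy, ih h.2 (List.mem_cons_of_mem _ hy)⟩

theorem iterate_var_self (x : Var) (f : Store → Store) (s : Store) (i : ℕ) :
    (iterate x f s i).var x = i := by
  cases i <;> simp [iterate]

theorem iterate_var (x b : Var) (p : Prog) (s : Store) {y : Var} (h : y ∉ (forUpTo x b p).vars)
    (i : ℕ) : (iterate x p.run s i).var y = s.var y := by
  simp only [vars, List.mem_cons, not_or] at h
  induction i with
  | zero => simp [iterate, h.1]
  | succ i ih => simp [iterate, h.1, run_var_of_notMem h.2, ih]

theorem iterate_tab (x : Var) (p : Prog) (s : Store) {t : Tab} (h : t ∉ p.tabs) (i : ℕ) :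
    (iterate x p.run s i).tab t = s.tab t := by
  induction i with
  | zero => simp [iterate]
  | succ i ih => simp [iterate, run_tab_of_notMem h, ih]

/-- A bounded loop with an invariant `P`, which may mention the value of the counter. What the
body does not change is known to be unchanged. -/
theorem run_forUpTo {x b : Var} {p : Prog} {s : Store} (P : ℕ → Store → Prop)
    (h0 : P 0 (s.setVar x 0))
    (hs : ∀ i < s.var b, ∀ s', P i s' → s'.var x = i →
      (∀ y, y ∉ x :: p.vars → s'.var y = s.var y) → (∀ t, t ∉ p.tabs → s'.tab t = s.tab t) →
      P (i + 1) ((p.run s').setVar x (i + 1))) :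
    P (s.var b) ((forUpTo x b p).run s) := by
  have : ∀ i ≤ s.var b, P i (iterate x p.run s i) := by
    intro i
    induction i with
    | zero => exact fun _ => h0
    | succ i ih =>
      intro hi
      exact hs i hi _ (ih (by omega)) (iterate_var_self _ _ _ _)
        (fun y hy => iterate_var x b p s hy i) fun t ht => iterate_tab x p s ht i
  exact this _ le_rfl

/-- A program with bounded loops has the intended effect, in polynomial time. -/
theorem runs_toCmd {p : Prog} {fixed : List Var} (h : p.Wf fixed) {Z : ℕ} {s : Store}
    (hs : ∀ y ∈ fixed, s.var y ≤ Z) :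
    Runs p.toCmd s (p.cost.eval Z) fun s' => s' = p.run s := by
  induction p generalizing s fixed with
  | skip => exact ⟨1, s, .skip s, by simp [cost], rfl⟩
  | assign x e => exact ⟨1, _, .assign x e s, by simp [cost], rfl⟩
  | write t i j e => exact ⟨1, _, .write t i j e s, by simp [cost], rfl⟩
  | seq p q ihp ihq =>
    simp only [Wf, Bool.and_eq_true] at h
    obtain ⟨t, _, h₁, h₂, rfl⟩ := ihp h.1 hs
    obtain ⟨t', _, h₃, h₄, rfl⟩ := ihq h.2 (s := p.run s) fun y hy => by
      rw [run_var_of_notMem (notMem_vars_of_wf h.1 hy)]; exact hs y hy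
    exact ⟨t + t', _, .seq h₁ h₃, by simp only [cost, Polynomial.eval_add]; omega, rfl⟩
  | ite e p q ihp ihq =>
    simp only [Wf, Bool.and_eq_true] at h
    refine (Runs.cond (τ := p.cost.eval Z + q.cost.eval Z)
      (fun hne => (ihp h.1 hs).mono (by omega) ?_)
      fun h0 => (ihq h.2 hs).mono (by omega) ?_).mono
        (by simp only [cost, Polynomial.eval_add, Polynomial.eval_one]; omega) fun _ h => h
    · rintro _ rfl; rw [run, if_neg hne]
    · rintro _ rfl; rw [run, if_pos h0]
  | forUpTo x b p ih =>
    have hwf := h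
    simp only [Wf, Bool.and_eq_true, decide_eq_true_eq] at h
    obtain ⟨⟨hx, hb⟩, hp⟩ := h
    have hbv : ∀ i, (iterate x p.run s i).var b = s.var b := fun i =>
      iterate_var x b p s (notMem_vars_of_wf hwf hb) i
    refine (Runs.assign_cons (Runs.cons (τ := Z * (p.cost.eval Z + 3) + 1) (τ' := 1)
      ((Runs.loop (τ := p.cost.eval Z + 2) (fun s' => s.var b - s'.var x)
        (I := fun s' => ∃ i ≤ s.var b, s' = iterate x p.run s i) ?_ _
          ⟨0, Nat.zero_le _, rfl⟩).mono ?_ ?_))).mono ?_ fun _ h => h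
    · rintro _ ⟨i, hi, rfl⟩ hg
      have hlt : i < s.var b := by
        by_contra hc
        simp [Arith.eval, iterate_var_self, hbv, hc] at hg
      refine (Runs.cons (τ' := 2) ((ih hp fun y hy => ?_).mono le_rfl ?_)).mono le_rfl fun _ h => h
      · rcases List.mem_cons.1 hy with rfl | hy
        · rw [iterate_var_self]; exact hi.trans (hs b hb)
        · rw [iterate_var x b p s (notMem_vars_of_wf hwf hy)]; exact hs y hy
      · rintro _ rfl
        have hxv : (p.run (iterate x p.run s i)).var x = i := by
          rw [run_var_of_notMem (notMem_vars_of_wf hp (List.mem_cons_self ..)), iterate_var_self]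
        refine Runs.assign_cons (Runs.nil ⟨⟨i + 1, hlt, ?_⟩, ?_⟩)
        · simp [Arith.eval, iterate, hxv]
        · simp only [Arith.eval, hxv, Store.setVar_var, if_true, iterate_var_self]
          omega
    · exact Nat.succ_le_succ (Nat.mul_le_mul_right _ ((Nat.sub_le _ _).trans (hs b hb)))
    · rintro _ ⟨⟨i, hi, rfl⟩, hg⟩
      have : i = s.var b := by
        by_contra hc
        simp [Arith.eval, iterate_var_self, hbv, lt_of_le_of_ne hi hc] at hg
      subst this
      exact Runs.nil rfl
    · simp [cost]; omega

end Prog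

end

section

/-! ### Registers of the test -/

/-- The number of pairs of states. -/
abbrev Var.nPairs : Var := .tmp 0
/-- The number of nodes of a restricted product: the pairs of states and a sink. -/
abbrev Var.nNodes : Var := .tmp 1
/-- The value that stands for an infinite distance. -/
abbrev Var.inf : Var := .tmp 2
/-- One more than the number of states. -/
abbrev Var.nP1 : Var := .tmp 3
/-- The number of intervals whose union is the acceptance condition. -/
abbrev Var.nSets : Var := .tmp 4
/-- One more than `nSets`. -/
abbrev Var.nRows : Var := .tmp 5
/-- The first component is restricted to the states in row `i₁` of `Tab.up`, without the state
`r₁`. -/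
abbrev Var.i₁ : Var := .tmp 6
/-- The state removed from the first component; none if it is the number of states. -/
abbrev Var.r₁ : Var := .tmp 7
/-- As `i₁`, for the second component. -/
abbrev Var.i₂ : Var := .tmp 8
/-- As `r₁`, for the second component. -/
abbrev Var.r₂ : Var := .tmp 9
/-- The code of the pair of states whose cycle is tested. -/
abbrev Var.base : Var := .tmp 10
abbrev Var.node : Var := .tmp 11
abbrev Var.target : Var := .tmp 12
abbrev Var.round : Var := .tmp 13
abbrev Var.sym : Var := .tmp 14
abbrev Var.cur : Var := .tmp 15
abbrev Var.cur' : Var := .tmp 16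
/-- A flag that is cleared when the rest of a bounded loop is to have no effect. -/
abbrev Var.active : Var := .tmp 17
/-- Whether the first projection of a cycle is accepted. -/
abbrev Var.acc₁ : Var := .tmp 18
/-- Whether the second projection of a cycle is accepted. -/
abbrev Var.acc₂ : Var := .tmp 19
abbrev Var.member : Var := .tmp 20
abbrev Var.set : Var := .tmp 21
abbrev Var.state : Var := .tmp 22

/-! ### Shortest paths in a graph with labelled edges -/

/-- The graph `d` has nodes `0, …, N - 1`, and for each symbol `a < k` an edge from `p` to `d p
a`. Entries of `lev` below `N + 1` bound the lengths of nonempty paths: the symbol in `nxt` leads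
to the target at once, or to a node with a smaller entry. Hence following `nxt` reaches the
target. -/
def Policy (d : ℕ → ℕ → ℕ) (N k : ℕ) (lev nxt : ℕ → ℕ → ℕ) : Prop :=
  ∀ p < N, ∀ t < N, lev p t < N + 1 →
    nxt p t < k ∧ (d p (nxt p t) = t ∨ lev (d p (nxt p t)) t < lev p t)

/-- A nonempty path between two nodes can be replaced by one of at most `N` edges. -/
theorem exists_short_path {d : ℕ → ℕ → ℕ} {N k : ℕ} (hd : ∀ p < N, ∀ a < k, d p a < N) {p : ℕ}
    (hp : p < N) (w : List ℕ) (hw : w ≠ []) (hk : ∀ a ∈ w, a < k) :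
    ∃ w' : List ℕ, w' ≠ [] ∧ w'.length ≤ N ∧ (∀ a ∈ w', a < k) ∧ w'.foldl d p = w.foldl d p := by
  have hmem : ∀ (w : List ℕ) (p : ℕ), p < N → (∀ a ∈ w, a < k) → w.foldl d p < N := by
    intro w
    induction w with
    | nil => exact fun p hp _ => hp
    | cons a w ih =>
      intro p hp hk
      exact ih _ (hd p hp a (hk a (by simp))) fun b hb => hk b (by simp [hb])
  induction hl : w.length using Nat.strong_induction_on generalizing w with
  | _ l ih =>
    subst hl
    by_cases hN : w.length ≤ N
    · exact ⟨w, hw, hN, hk, rfl⟩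
    obtain ⟨i, hi, j, hj, hij, he⟩ := Finset.exists_ne_map_eq_of_card_lt_of_maps_to
      (s := Finset.range w.length) (t := Finset.range N)
      (f := fun i => (w.take (i + 1)).foldl d p) (by simp; omega)
      (fun i _ => by
        simpa using hmem _ p hp fun a ha => hk a (List.mem_of_mem_take ha))
    wlog hlt : i < j generalizing i j
    · exact this j hj i hi hij.symm he.symm (by omega)
    simp only [Finset.mem_range] at hi hj
    obtain ⟨w', h₁, h₂, h₃, h₄⟩ := ih (w.take (i + 1) ++ w.drop (j + 1)).length (by simp; omega)
      (w.take (i + 1) ++ w.drop (j + 1))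
      (by simp only [ne_eq, List.append_eq_nil_iff, not_and]; intro h; simp at h; exact (hw h).elim)
      (fun a ha => by
        rcases List.mem_append.1 ha with ha | ha
        · exact hk a (List.mem_of_mem_take ha)
        · exact hk a (List.mem_of_mem_drop ha)) rfl
    refine ⟨w', h₁, h₂, h₃, h₄.trans ?_⟩
    rw [List.foldl_append]
    rw [show (w.take (i + 1)).foldl d p = (w.take (j + 1)).foldl d p from he,
      ← List.foldl_append, List.take_append_drop]

section closure

variable (td tl tn : Tab)

/-- Improve the distance from `node` to `target` by the edge with label `sym`. -/
def relax : Prog :=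
  .seq (.assign .cur (.get td (.var .node) (.var .sym))) <|
  .seq (.ite (.eq (.var .cur) (.var .target)) (.assign .cur (.lit 1))
    (.assign .cur (.add (.get tl (.var .cur) (.var .target)) (.lit 1)))) <|
  .ite (.lt (.var .cur) (.get tl (.var .node) (.var .target)))
    (.seq (.write tl (.var .node) (.var .target) (.var .cur))
      (.write tn (.var .node) (.var .target) (.var .sym)))
    .skip

/-- Set all distances to infinity. -/
def clearLev : Prog :=
  .forUpTo .node .nNodes <| .forUpTo .target .nNodes <|
    .write tl (.var .node) (.var .target) (.var .inf)

/-- Compute in `tl` the lengths of the shortest nonempty paths of the graph `td`, and in `tn`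
their first symbols. -/
def closure : Prog :=
  .seq (clearLev tl) <|
  .forUpTo .round .nNodes <| .forUpTo .target .nNodes <| .forUpTo .node .nNodes <|
    .forUpTo .sym .numSyms <| relax td tl tn

variable {td tl tn} {d : ℕ → ℕ → ℕ} {N k : ℕ}

/-- Distances have not increased, and `Policy` has been preserved. -/
def Improves (tl tn : Tab) (d : ℕ → ℕ → ℕ) (N k : ℕ) (s s' : Store) : Prop :=
  (∀ p t, s'.tab tl p t ≤ s.tab tl p t) ∧
  (Policy d N k (s.tab tl) (s.tab tn) → Policy d N k (s'.tab tl) (s'.tab tn))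

theorem Improves.refl (s : Store) : Improves tl tn d N k s s := ⟨fun _ _ => le_rfl, id⟩

theorem Improves.trans {s₁ s₂ s₃ : Store} (h : Improves tl tn d N k s₁ s₂)
    (h' : Improves tl tn d N k s₂ s₃) : Improves tl tn d N k s₁ s₃ :=
  ⟨fun p t => (h'.1 p t).trans (h.1 p t), h'.2 ∘ h.2⟩

/-- The length of the path that starts with the edge from `p` with label `a` and continues to
`t` as recorded. -/
def via (d lev : ℕ → ℕ → ℕ) (t p a : ℕ) : ℕ := if d p a = t then 1 else lev (d p a) t + 1

theorem via_mono {lev lev' : ℕ → ℕ → ℕ} (h : ∀ p t, lev' p t ≤ lev p t) (t p a : ℕ) :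
    via d lev' t p a ≤ via d lev t p a := by
  unfold via
  split_ifs
  · exact le_rfl
  · exact Nat.succ_le_succ (h _ _)

theorem run_relax (hln : tl ≠ tn) {s : Store}
    (hd : s.tab td = d) (hk : s.var .sym < k) :
    Improves tl tn d N k s ((relax td tl tn).run s) ∧
    ((relax td tl tn).run s).tab tl (s.var .node) (s.var .target) ≤
      via d (s.tab tl) (s.var .target) (s.var .node) (s.var .sym) := by
  set p := s.var .node with hp
  set t := s.var .target with ht
  set a := s.var .sym with ha
  set c := via d (s.tab tl) t p a with hc
  have key : ((relax td tl tn).run s).tab tl = (if c < s.tab tl p t then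
        Function.update (s.tab tl) p (Function.update (s.tab tl p) t c) else s.tab tl) ∧
      ((relax td tl tn).run s).tab tn = (if c < s.tab tl p t then
        Function.update (s.tab tn) p (Function.update (s.tab tn p) t a) else s.tab tn) := by
    by_cases h1 : d p a = t
    · have hc1 : c = 1 := by simp [hc, via, h1]
      by_cases h2 : 1 < s.tab tl p t
      · simp [relax, Prog.run, Arith.eval, hd, ← hp, ← ht, ← ha, h1, h2, hc1,
          Store.setTab_tab_self, Store.setTab_tab_of_ne, hln, hln.symm]
      · simp [relax, Prog.run, Arith.eval, hd, ← hp, ← ht, ← ha, h1, h2, hc1]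
    · have hc1 : c = s.tab tl (d p a) t + 1 := by simp [hc, via, h1]
      by_cases h2 : s.tab tl (d p a) t + 1 < s.tab tl p t
      · simp [relax, Prog.run, Arith.eval, hd, ← hp, ← ht, ← ha, h1, h2, hc1,
          Store.setTab_tab_self, Store.setTab_tab_of_ne, hln, hln.symm]
      · simp [relax, Prog.run, Arith.eval, hd, ← hp, ← ht, ← ha, h1, h2, hc1]
  rw [Improves, key.1, key.2]
  clear_value c
  by_cases hlt : c < s.tab tl p t
  · simp only [if_pos hlt]
    have hle : ∀ p' t', Function.update (s.tab tl) p (Function.update (s.tab tl p) t c) p' t' ≤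
        s.tab tl p' t' := by
      intro p' t'
      rcases eq_or_ne p' p with rfl | hp'
      · rcases eq_or_ne t' t with rfl | ht'
        · simpa using hlt.le
        · simp [ht']
      · simp [hp']
    refine ⟨⟨hle, fun hpol p' hp' t' ht' hl => ?_⟩, by simp⟩
    by_cases heq : p' = p ∧ t' = t
    · rw [heq.1, heq.2]
      simp only [Function.update_self]
      refine ⟨hk, ?_⟩
      by_cases h1 : d p a = t
      · exact Or.inl h1
      · right
        refine lt_of_le_of_lt (hle _ _) ?_
        rw [hc, via, if_neg h1]
        exact Nat.lt_succ_self _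
    · have e1 : Function.update (s.tab tl) p (Function.update (s.tab tl p) t c) p' t' =
          s.tab tl p' t' := by
        rcases eq_or_ne p' p with rfl | hp'
        · have : t' ≠ t := fun h => heq ⟨rfl, h⟩
          simp [this]
        · simp [hp']
      have e2 : Function.update (s.tab tn) p (Function.update (s.tab tn p) t a) p' t' =
          s.tab tn p' t' := by
        rcases eq_or_ne p' p with rfl | hp'
        · have : t' ≠ t := fun h => heq ⟨rfl, h⟩
          simp [this]
        · simp [hp']
      rw [e1] at hl
      rw [e1, e2]
      obtain ⟨h1, h2⟩ := hpol p' hp' t' ht' hl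
      exact ⟨h1, h2.imp id fun h2 => lt_of_le_of_lt (hle _ _) h2⟩
  · simp only [if_neg hlt]
    exact ⟨⟨fun _ _ => le_rfl, id⟩, not_lt.1 hlt⟩

/-- Each of the nested loops brings the distances below those of one more set of first edges. -/
theorem run_relax_syms (hdl : td ≠ tl) (hdn : td ≠ tn) (hln : tl ≠ tn) {s : Store}
    (hd : s.tab td = d) (hk : s.var .numSyms = k) :
    Improves tl tn d N k s ((Prog.forUpTo .sym .numSyms (relax td tl tn)).run s) ∧
    ∀ a < k, ((Prog.forUpTo .sym .numSyms (relax td tl tn)).run s).tab tl (s.var .node)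
      (s.var .target) ≤ via d (s.tab tl) (s.var .target) (s.var .node) a := by
  rw [← hk]
  refine Prog.run_forUpTo (fun i s' => Improves tl tn d N (s.var .numSyms) s s' ∧ ∀ a < i,
    s'.tab tl (s.var .node) (s.var .target) ≤ via d (s.tab tl) (s.var .target) (s.var .node) a)
    ⟨Improves.refl s, by simp⟩ ?_
  rintro i hi s' ⟨h1, h2⟩ hx hv ht
  have hd' : s'.tab td = d := by
    rw [ht td (by simp [Prog.tabs, relax, hdl, hdn]), hd]
  obtain ⟨h3, h4⟩ := run_relax (N := N) hln hd' (hx.trans_lt hi)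
  rw [hv .node (of_decide_eq_true rfl), hv .target (of_decide_eq_true rfl), hx] at h4
  refine ⟨h1.trans h3, fun a ha => ?_⟩
  rcases Nat.lt_succ_iff_lt_or_eq.1 ha with ha | rfl
  · exact (h3.1 _ _).trans (h2 a ha)
  · exact h4.trans (via_mono h1.1 _ _ _)

theorem run_relax_nodes (hdl : td ≠ tl) (hdn : td ≠ tn) (hln : tl ≠ tn) {s : Store}
    (hd : s.tab td = d) (hk : s.var .numSyms = k) :
    Improves tl tn d N k s
      ((Prog.forUpTo .node .nNodes (.forUpTo .sym .numSyms (relax td tl tn))).run s) ∧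
    ∀ p < s.var .nNodes, ∀ a < k,
      ((Prog.forUpTo .node .nNodes (.forUpTo .sym .numSyms (relax td tl tn))).run s).tab tl p
      (s.var .target) ≤ via d (s.tab tl) (s.var .target) p a := by
  refine Prog.run_forUpTo (fun i s' => Improves tl tn d N k s s' ∧ ∀ p < i, ∀ a < k,
    s'.tab tl p (s.var .target) ≤ via d (s.tab tl) (s.var .target) p a)
    ⟨Improves.refl s, by simp⟩ ?_
  rintro i hi s' ⟨h1, h2⟩ hx hv ht
  have hd' : s'.tab td = d := by
    rw [ht td (by simp [Prog.tabs, relax, hdl, hdn]), hd]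
  obtain ⟨h3, h4⟩ := run_relax_syms (N := N) hdl hdn hln hd'
    ((hv .numSyms (of_decide_eq_true rfl)).trans hk)
  rw [hv .target (of_decide_eq_true rfl), hx] at h4
  refine ⟨h1.trans h3, fun p hp a ha => ?_⟩
  rcases Nat.lt_succ_iff_lt_or_eq.1 hp with hp | rfl
  · exact (h3.1 _ _).trans (h2 p hp a ha)
  · exact (h4 a ha).trans (via_mono h1.1 _ _ _)

theorem run_relax_targets (hdl : td ≠ tl) (hdn : td ≠ tn) (hln : tl ≠ tn) {s : Store}
    (hd : s.tab td = d) (hk : s.var .numSyms = k) (hN : s.var .nNodes = N) :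
    Improves tl tn d N k s
      ((Prog.forUpTo .target .nNodes
        (.forUpTo .node .nNodes (.forUpTo .sym .numSyms (relax td tl tn)))).run s) ∧
    ∀ t < N, ∀ p < N, ∀ a < k, ((Prog.forUpTo .target .nNodes
        (.forUpTo .node .nNodes (.forUpTo .sym .numSyms (relax td tl tn)))).run s).tab tl p t ≤
      via d (s.tab tl) t p a := by
  rw [← hN]
  refine Prog.run_forUpTo (fun i s' => Improves tl tn d (s.var .nNodes) k s s' ∧
    ∀ t < i, ∀ p < s.var .nNodes, ∀ a < k, s'.tab tl p t ≤ via d (s.tab tl) t p a)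
    ⟨Improves.refl s, by simp⟩ ?_
  rintro i hi s' ⟨h1, h2⟩ hx hv ht
  have hd' : s'.tab td = d := by
    rw [ht td (by simp [Prog.tabs, relax, hdl, hdn]), hd]
  obtain ⟨h3, h4⟩ := run_relax_nodes (N := s.var .nNodes) hdl hdn hln hd'
    ((hv .numSyms (of_decide_eq_true rfl)).trans hk)
  rw [hv .nNodes (of_decide_eq_true rfl), hx] at h4
  refine ⟨h1.trans h3, fun t ht p hp a ha => ?_⟩
  rcases Nat.lt_succ_iff_lt_or_eq.1 ht with ht | rfl
  · exact (h3.1 _ _).trans (h2 t ht p hp a ha)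
  · exact (h4 p hp a ha).trans (via_mono h1.1 _ _ _)

theorem run_clearLev {s : Store} :
    ∀ p < s.var .nNodes, ∀ t < s.var .nNodes, ((clearLev tl).run s).tab tl p t = s.var .inf := by
  refine Prog.run_forUpTo (fun i s' => ∀ p < i, ∀ t < s.var .nNodes, s'.tab tl p t = s.var .inf)
    (by simp) fun i hi s' h hx hv _ => ?_
  have h' : ∀ t < s'.var .nNodes, ∀ p, p ≤ i → ((Prog.forUpTo .target .nNodes
      (.write tl (.var .node) (.var .target) (.var .inf))).run s').tab tl p t = s.var .inf := by
    refine Prog.run_forUpTo (fun j s'' => (∀ t < j, ∀ p, p ≤ i → s''.tab tl p t = s.var .inf) ∧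
      ∀ p < i, ∀ t < s.var .nNodes, s''.tab tl p t = s.var .inf) (s := s') ?_ ?_ |>.1
    · exact ⟨by simp, h⟩
    · rintro j hj s'' ⟨h1, h2⟩ hx' hv' -
      have e1 : s''.var .node = i := by rw [hv' _ (of_decide_eq_true rfl), hx]
      have e2 : s''.var .inf = s.var .inf := by rw [hv' _ (of_decide_eq_true rfl), hv _ (of_decide_eq_true rfl)]
      have e3 : s'.var .nNodes = s.var .nNodes := hv _ (of_decide_eq_true rfl)
      simp only [Prog.run, Store.setVar_tab, Store.setTab_tab_self, Arith.eval, e1, e2, hx']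
      constructor
      · intro t ht p hp
        rcases eq_or_ne p i with rfl | hne
        · rcases Nat.lt_succ_iff_lt_or_eq.1 ht with ht | rfl
          · simp [ht.ne, h1 t ht p le_rfl]
          · simp
        · simp only [Function.update_of_ne hne]
          exact h2 p (by omega) t (by omega)
      · intro p hp t ht
        simp only [Function.update_of_ne hp.ne]
        exact h2 p hp t ht
  intro p hp t ht
  exact h' t (by rw [hv _ (of_decide_eq_true rfl)]; exact ht) p (by omega)

/-- After `i` rounds, the distances are at most the lengths of the paths of at most `i` edges, and
by `exists_short_path` paths of at most `N` edges suffice. -/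
theorem run_closure (hdl : td ≠ tl) (hdn : td ≠ tn) (hln : tl ≠ tn) {s : Store}
    (hd : s.tab td = d) (hk : s.var .numSyms = k) (hN : s.var .nNodes = N)
    (hinf : s.var .inf = N + 1) (hdN : ∀ p < N, ∀ a < k, d p a < N) :
    Policy d N k (((closure td tl tn).run s).tab tl) (((closure td tl tn).run s).tab tn) ∧
    ∀ p < N, ∀ w : List ℕ, w ≠ [] → (∀ a ∈ w, a < k) →
      ((closure td tl tn).run s).tab tl p (w.foldl d p) < N + 1 := by
  set s₁ := (clearLev tl).run s with hs₁
  have hN₁ : s₁.var .nNodes = N := by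
    rw [hs₁, Prog.run_var_of_notMem (of_decide_eq_true rfl), hN]
  have hk₁ : s₁.var .numSyms = k := by
    rw [hs₁, Prog.run_var_of_notMem (of_decide_eq_true rfl), hk]
  have hd₁ : s₁.tab td = d := by
    rw [hs₁, Prog.run_tab_of_notMem (by simpa [clearLev, Prog.tabs] using hdl), hd]
  have hclear := run_clearLev (tl := tl) (s := s)
  rw [← hs₁, hN, hinf] at hclear
  have hmem : ∀ (w : List ℕ) (p : ℕ), p < N → (∀ a ∈ w, a < k) → w.foldl d p < N := by
    intro w
    induction w with
    | nil => exact fun p hp _ => hp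
    | cons a w ih =>
      intro p hp hk
      exact ih _ (hdN p hp a (hk a (by simp))) fun b hb => hk b (by simp [hb])
  have main : Policy d N k (((closure td tl tn).run s).tab tl) (((closure td tl tn).run s).tab tn) ∧
      ∀ p < N, ∀ w : List ℕ, w ≠ [] → (∀ a ∈ w, a < k) → w.length ≤ s₁.var .nNodes →
        ((closure td tl tn).run s).tab tl p (w.foldl d p) ≤ w.length := by
    refine Prog.run_forUpTo (s := s₁) (fun i s' => Policy d N k (s'.tab tl) (s'.tab tn) ∧
      ∀ p < N, ∀ w : List ℕ, w ≠ [] → (∀ a ∈ w, a < k) → w.length ≤ i →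
        s'.tab tl p (w.foldl d p) ≤ w.length) ⟨?_, ?_⟩ ?_
    · intro p hp t ht hl
      simp only [Store.setVar_tab, hclear p hp t ht] at hl
      omega
    · intro p hp w hw _ hl
      simp only [Nat.le_zero, List.length_eq_zero_iff] at hl
      exact (hw hl).elim
    · rintro i hi s' ⟨h1, h2⟩ hx hv ht
      have hd' : s'.tab td = d := by
        rw [ht td (by simp [Prog.tabs, relax, hdl, hdn]), hd₁]
      obtain ⟨h3, h4⟩ := run_relax_targets hdl hdn hln hd' ((hv .numSyms (of_decide_eq_true rfl)).trans hk₁)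
        ((hv .nNodes (of_decide_eq_true rfl)).trans hN₁)
      refine ⟨h3.2 h1, fun p hp w hw hwk hl => ?_⟩
      obtain ⟨a, w, rfl⟩ := List.exists_cons_of_ne_nil hw
      have ha : a < k := hwk a (by simp)
      have hwk' : ∀ b ∈ w, b < k := fun b hb => hwk b (by simp [hb])
      refine (h4 _ (hmem (a :: w) p hp hwk) p hp a ha).trans ?_
      unfold via
      split_ifs with he
      · simp
      · have hw0 : w ≠ [] := by rintro rfl; exact he rfl
        exact Nat.succ_le_succ (h2 _ (hdN p hp a ha) w hw0 hwk' (by simpa using hl))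
  refine ⟨main.1, fun p hp w hw hwk => ?_⟩
  obtain ⟨w', h1, h2, h3, h4⟩ := exists_short_path hdN hp w hw hwk
  rw [← h4]
  exact Nat.lt_succ_of_le ((main.2 p hp w' h1 h3 (by omega)).trans h2)

end closure

end

/-! ### Walks along shortest paths -/

section

/-- `lev` and `nxt` describe shortest nonempty paths of the graph `d`; `N + 1` stands for an
infinite distance. -/
structure Distances (d : ℕ → ℕ → ℕ) (N k : ℕ) (lev nxt : ℕ → ℕ → ℕ) : Prop where
  closed : ∀ p < N, ∀ a < k, d p a < N
  policy : Policy d N k lev nxt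
  complete : ∀ p < N, ∀ w : List ℕ, w ≠ [] → (∀ a ∈ w, a < k) → lev p (w.foldl d p) < N + 1

namespace Distances

variable {d lev nxt : ℕ → ℕ → ℕ} {N k : ℕ} (h : Distances d N k lev nxt)
include h

theorem exists_word {p t : ℕ} (hp : p < N) (ht : t < N) (hl : lev p t < N + 1) :
    ∃ w : List ℕ, w ≠ [] ∧ (∀ a ∈ w, a < k) ∧ w.foldl d p = t := by
  induction hn : lev p t using Nat.strong_induction_on generalizing p with
  | _ m ih =>
    subst hn
    obtain ⟨ha, he | hlt⟩ := h.policy p hp t ht hl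
    · exact ⟨[nxt p t], by simp, by simpa using ha, he⟩
    · obtain ⟨w, -, h₂, h₃⟩ := ih _ hlt (h.closed p hp _ ha) (hlt.trans hl) rfl
      exact ⟨nxt p t :: w, by simp, by simpa using ⟨ha, h₂⟩, h₃⟩

theorem trans {p q t : ℕ} (hp : p < N) (hq : q < N) (ht : t < N) (h₁ : lev p q < N + 1)
    (h₂ : lev q t < N + 1) : lev p t < N + 1 := by
  obtain ⟨w, hw, hk, rfl⟩ := h.exists_word hp hq h₁
  obtain ⟨w', hw', hk', rfl⟩ := h.exists_word hq ht h₂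
  rw [← List.foldl_append]
  exact h.complete p hp _ (by simp [hw]) fun a ha =>
    (List.mem_append.1 ha).elim (hk a) (hk' a)

end Distances

theorem Store.row_setTab_self (s : Store) (t : Tab) (i L m : ℕ) :
    (s.setTab t i L m).row t i (L + 1) = s.row t i L ++ [m] := by
  simp only [Store.row, List.range_succ, List.map_append, List.map_cons, List.map_nil,
    Store.setTab_tab_self, Function.update_self, List.append_cancel_right_eq]
  exact List.map_congr_left fun j hj => by simp [(List.mem_range.1 hj).ne]

section walk

variable (td tl tn : Tab)

/-- Append to row `0` of `dst`, whose length is `len`, the labels of a shortest nonempty path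
from `cur` to `target`. -/
def walk (dst : Tab) (len : Var) : Prog :=
  .seq (.assign .active (.lit 1)) <| .forUpTo .round .inf <| .ite (.var .active)
    (.seq (.write dst (.lit 0) (.var len) (.get tn (.var .cur) (.var .target))) <|
      .seq (.assign len (.add (.var len) (.lit 1))) <|
      .seq (.assign .cur (.get td (.var .cur) (.get tn (.var .cur) (.var .target)))) <|
      .ite (.eq (.var .cur) (.var .target)) (.assign .active (.lit 0)) .skip)
    .skip

/-- The node `c` lies on a common cycle with the node `base`. -/
def onCycle (c : Var) : Arith :=
  .eq (.add (.lt (.get tl (.var .base) (.var c)) (.var .inf))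
    (.lt (.get tl (.var c) (.var .base)) (.var .inf))) (.lit 2)

/-- Write into `testV` the labels of a closed path from `base` through all pairs of states that
lie on a common cycle with `base`. -/
def writeCycle : Prog :=
  .seq (.assign .testVLen (.lit 0)) <| .seq (.assign .cur (.var .base)) <|
  .seq (.forUpTo .member .nPairs <| .ite (onCycle tl .member)
    (.seq (.assign .target (.var .member)) (walk td tn .testV .testVLen)) .skip) <|
  .seq (.assign .target (.var .base)) (walk td tn .testV .testVLen)

variable {td tl tn} {d lev nxt : ℕ → ℕ → ℕ} {N k : ℕ}

/-- Each step of the walk decreases `lev`, so that `N + 1` rounds suffice. -/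
theorem run_walk {dst : Tab} {len : Var} (hlen : len = .testULen ∨ len = .testVLen)
    (hdst : dst ≠ td ∧ dst ≠ tn) {s : Store} (h : Distances d N k lev nxt)
    (hd : s.tab td = d) (hn : s.tab tn = nxt) (hinf : s.var .inf = N + 1)
    (hp : s.var .cur < N) (ht : s.var .target < N)
    (hl : lev (s.var .cur) (s.var .target) < N + 1) :
    ∃ w : List ℕ, w ≠ [] ∧ (∀ a ∈ w, a < k) ∧ w.length ≤ N + 1 ∧
      ((walk td tn dst len).run s).row dst 0 (((walk td tn dst len).run s).var len) =
        s.row dst 0 (s.var len) ++ w ∧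
      w.foldl d (s.var .cur) = s.var .target ∧
      ((walk td tn dst len).run s).var .cur = s.var .target := by
  have main : ∃ w : List ℕ, (∀ a ∈ w, a < k) ∧ w.length ≤ (s.setVar .active 1).var .inf ∧
      ((walk td tn dst len).run s).row dst 0 (((walk td tn dst len).run s).var len) =
        s.row dst 0 (s.var len) ++ w ∧
      ((walk td tn dst len).run s).var .cur = w.foldl d (s.var .cur) ∧
      ((((walk td tn dst len).run s).var .active = 0 ∧ w ≠ [] ∧
          ((walk td tn dst len).run s).var .cur = s.var .target) ∨
        (((walk td tn dst len).run s).var .active = 1 ∧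
          ((walk td tn dst len).run s).var .cur < N ∧
          lev (((walk td tn dst len).run s).var .cur) (s.var .target) +
            (s.setVar .active 1).var .inf < N + 1)) := by
    refine Prog.run_forUpTo (s := s.setVar .active 1) (fun i s' => ∃ w : List ℕ,
      (∀ a ∈ w, a < k) ∧ w.length ≤ i ∧
      s'.row dst 0 (s'.var len) = s.row dst 0 (s.var len) ++ w ∧
      s'.var .cur = w.foldl d (s.var .cur) ∧
      ((s'.var .active = 0 ∧ w ≠ [] ∧ s'.var .cur = s.var .target) ∨
        (s'.var .active = 1 ∧ s'.var .cur < N ∧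
          lev (s'.var .cur) (s.var .target) + i < N + 1))) ?_ ?_
    · refine ⟨[], by simp, by simp, ?_, by simp, Or.inr ?_⟩
      · rcases hlen with rfl | rfl <;> simp [Store.row]
      · simpa using ⟨hp, Nat.lt_succ_iff.1 hl⟩
    · rintro i - s' ⟨w, h1, h2, h3, h4, h5⟩ - hv htab
      obtain ⟨h0, hw, he⟩ | ⟨h6, hlt, hlev⟩ := h5
      · refine ⟨w, h1, h2.trans (Nat.le_succ _), ?_, ?_, Or.inl ?_⟩
        · rw [← h3]
          rcases hlen with rfl | rfl <;> simp [Prog.run, Arith.eval, h0, Store.row]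
        · simpa [Prog.run, Arith.eval, h0] using h4
        · simpa [Prog.run, Arith.eval, h0, hw] using he
      · have ht' : s'.var .target = s.var .target := by
          rw [hv]
          · simp
          · rcases hlen with rfl | rfl <;> exact of_decide_eq_true rfl
        have hd' : s'.tab td = d := by
          rw [htab _ (by simpa [Prog.tabs] using hdst.1.symm)]; exact hd
        have hn' : s'.tab tn = nxt := by
          rw [htab _ (by simpa [Prog.tabs] using hdst.2.symm)]; exact hn
        obtain ⟨ha, hor⟩ := h.policy _ hlt _ ht (by omega)
        set a := nxt (s'.var .cur) (s.var .target) with hadef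
        have hcur' := h.closed _ hlt _ ha
        have hd2 : ∀ j m, (s'.setTab dst 0 j m).tab td = d := fun j m => by
          rw [Store.setTab_tab_of_ne _ _ _ _ hdst.1.symm, hd']
        have hn2 : ∀ j m, (s'.setTab dst 0 j m).tab tn = nxt := fun j m => by
          rw [Store.setTab_tab_of_ne _ _ _ _ hdst.2.symm, hn']
        have hrow := s'.row_setTab_self dst 0 (s'.var len) a
        refine ⟨w ++ [a], ?_, by simpa using h2, ?_, ?_, ?_⟩
        · intro b hb
          rcases List.mem_append.1 hb with hb | hb
          · exact h1 b hb
          · rw [List.mem_singleton.1 hb]; exact ha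
        · rw [← List.append_assoc, ← h3, ← hrow]
          by_cases he : d (s'.var .cur) a = s.var .target <;> rcases hlen with rfl | rfl <;>
          simp [Prog.run, Arith.eval, h6, hd2, hn2, ht', hn', ← hadef, he, Store.row]
        · rw [List.foldl_append, ← h4]
          by_cases he : d (s'.var .cur) a = s.var .target <;> rcases hlen with rfl | rfl <;>
          simp [Prog.run, Arith.eval, h6, hd2, hn2, ht', hn', ← hadef, he]
        · by_cases he : d (s'.var .cur) a = s.var .target
          · left
            rcases hlen with rfl | rfl <;>
            simp [Prog.run, Arith.eval, h6, hd2, hn2, ht', hn', ← hadef, he]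
          · right
            have hlt' := hor.resolve_left he
            have hgoal : d (s'.var .cur) a < N ∧
                lev (d (s'.var .cur) a) (s.var .target) + (i + 1) < N + 1 := ⟨hcur', by omega⟩
            rcases hlen with rfl | rfl <;>
            simpa [Prog.run, Arith.eval, h6, hd2, hn2, ht', hn', ← hadef, he] using hgoal
  obtain ⟨w, h1, h2, h3, h4, ⟨-, h5, h6⟩ | ⟨-, -, h5⟩⟩ := main
  · refine ⟨w, h5, h1, ?_, h3, h4.symm.trans h6, h6⟩
    simpa [hinf] using h2
  · simp [hinf] at h5
    omega

/-- The walks from each node on a common cycle with `base` to the next one exist by transitivity. -/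
theorem run_writeCycle (hdst : Tab.testV ≠ td ∧ Tab.testV ≠ tn) (hdl : Tab.testV ≠ tl) {s : Store}
    (h : Distances d N k lev nxt) (hd : s.tab td = d) (hl : s.tab tl = lev) (hn : s.tab tn = nxt)
    (hinf : s.var .inf = N + 1) (hm : s.var .nPairs ≤ N) (hp : s.var .base < N)
    (hpp : lev (s.var .base) (s.var .base) < N + 1) :
    ∃ v : List ℕ, v ≠ [] ∧ (∀ a ∈ v, a < k) ∧ v.length ≤ (N + 1) * (N + 1) ∧
      ((writeCycle td tl tn).run s).row .testV 0 (((writeCycle td tl tn).run s).var .testVLen) = v ∧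
      v.foldl d (s.var .base) = s.var .base ∧
      ∀ c < s.var .nPairs, lev (s.var .base) c < N + 1 → lev c (s.var .base) < N + 1 →
        ∃ v', v' <+: v ∧ v'.foldl d (s.var .base) = c := by
  set p := s.var .base with hpdef
  set loop : Prog := .forUpTo .member .nPairs <| .ite (onCycle tl .member)
    (.seq (.assign .target (.var .member)) (walk td tn .testV .testVLen)) .skip with hloop
  set s₁ := (s.setVar .testVLen 0).setVar .cur p with hs₁
  have hpairs : s₁.var .nPairs = s.var .nPairs := by simp [hs₁]
  have frame : ∀ t, t ≠ Tab.testV → (loop.run s₁).tab t = s.tab t := fun t ht => by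
    rw [Prog.run_tab_of_notMem]
    · simp [hs₁]
    · simp [hloop, Prog.tabs, walk, ht]
  have main : ∃ v : List ℕ, (∀ a ∈ v, a < k) ∧ v.length ≤ s₁.var .nPairs * (N + 1) ∧
      (loop.run s₁).row .testV 0 ((loop.run s₁).var .testVLen) = v ∧
      v.foldl d p = (loop.run s₁).var .cur ∧ (loop.run s₁).var .cur < N ∧
      lev p ((loop.run s₁).var .cur) < N + 1 ∧ lev ((loop.run s₁).var .cur) p < N + 1 ∧
      ∀ c < s₁.var .nPairs, lev p c < N + 1 → lev c p < N + 1 →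
        ∃ v', v' <+: v ∧ v'.foldl d p = c := by
    refine Prog.run_forUpTo (s := s₁) (fun i s' => ∃ v : List ℕ, (∀ a ∈ v, a < k) ∧
      v.length ≤ i * (N + 1) ∧ s'.row .testV 0 (s'.var .testVLen) = v ∧
      v.foldl d p = s'.var .cur ∧ s'.var .cur < N ∧
      lev p (s'.var .cur) < N + 1 ∧ lev (s'.var .cur) p < N + 1 ∧
      ∀ c < i, lev p c < N + 1 → lev c p < N + 1 → ∃ v', v' <+: v ∧ v'.foldl d p = c) ?_ ?_
    · exact ⟨[], by simp, by simp, by simp [hs₁, Store.row], by simp [hs₁], by simpa [hs₁] using hp,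
        by simpa [hs₁] using hpp, by simpa [hs₁] using hpp, by simp⟩
    · rintro i hi s' ⟨v, h1, h2, h3, h4, h5, h6, h7, h8⟩ hx hv ht
      have hiN : i < N := by omega
      have e1 : s'.var .base = p := by
        rw [hv _ (of_decide_eq_true rfl)]; simp [hs₁, hpdef]
      have e2 : s'.var .inf = N + 1 := by
        rw [hv _ (of_decide_eq_true rfl)]; simp [hs₁, hinf]
      have ft : ∀ t, t ≠ Tab.testV → s'.tab t = s.tab t := fun t hne => by
        rw [ht t (by simp [Prog.tabs, walk, hne])]; simp [hs₁]
      have e3 : s'.tab tl = lev := by rw [ft tl hdl.symm, hl]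
      by_cases hc : lev p i < N + 1 ∧ lev i p < N + 1
      · set s'' := s'.setVar .target i with hs''
        have hrun : (Prog.ite (onCycle tl .member) (.seq (.assign .target (.var .member))
            (walk td tn .testV .testVLen)) .skip).run s' =
            (walk td tn .testV .testVLen).run s'' := by
          simp [Prog.run, onCycle, Arith.eval, e1, e2, e3, hx, hc.1, hc.2, hs'']
        rw [hrun]
        have g1 : s''.var .cur = s'.var .cur := by simp [hs'']
        have g2 : s''.var .target = i := by simp [hs'']
        obtain ⟨w, w1, w2, w3, w4, w5, w6⟩ := run_walk (td := td) (tn := tn) (Or.inr rfl) hdst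
          (s := s'') h (by rw [← hd, ← ft td hdst.1.symm]; rfl)
          (by rw [← hn, ← ft tn hdst.2.symm]; rfl) (by simpa [hs''] using e2) (by rw [g1]; exact h5)
          (by rw [g2]; exact hiN)
          (by rw [g1, g2]; exact h.trans h5 hp hiN h7 hc.1)
        have g3 : s''.row .testV 0 (s''.var .testVLen) = v := by
          rw [← h3]; simp [hs'', Store.row]
        rw [g3] at w4
        rw [g1, g2] at w5
        rw [g2] at w6
        refine ⟨v ++ w, fun a ha => (List.mem_append.1 ha).elim (h1 a) (w2 a), ?_, ?_, ?_, ?_, ?_, ?_,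
          ?_⟩
        · rw [List.length_append, Nat.succ_mul]; omega
        · rw [← w4]; simp [Store.row]
        · rw [List.foldl_append, h4, w5]; simp [w6]
        · simpa [w6] using hiN
        · simpa [w6] using hc.1
        · simpa [w6] using hc.2
        · intro c hci hc1 hc2
          rcases Nat.lt_succ_iff_lt_or_eq.1 hci with hci | rfl
          · obtain ⟨v', hv1, hv2⟩ := h8 c hci hc1 hc2
            exact ⟨v', hv1.trans (List.prefix_append _ _), hv2⟩
          · exact ⟨v ++ w, List.prefix_rfl, by rw [List.foldl_append, h4, w5]⟩
      · have hrun : (Prog.ite (onCycle tl .member) (.seq (.assign .target (.var .member))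
            (walk td tn .testV .testVLen)) .skip).run s' = s' := by
          rw [not_and] at hc
          by_cases hc1 : lev p i < N + 1
          · simp [Prog.run, onCycle, Arith.eval, e1, e2, e3, hx, hc1, hc hc1]
          · by_cases hc2 : lev i p < N + 1 <;>
            simp [Prog.run, onCycle, Arith.eval, e1, e2, e3, hx, hc1, hc2]
        rw [hrun]
        refine ⟨v, h1, ?_, by rw [← h3]; simp [Store.row], by simpa using h4, by simpa using h5,
          by simpa using h6, by simpa using h7, fun c hci hc1 hc2 => ?_⟩
        · rw [Nat.succ_mul]; omega
        · rcases Nat.lt_succ_iff_lt_or_eq.1 hci with hci | rfl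
          · exact h8 c hci hc1 hc2
          · exact (hc ⟨hc1, hc2⟩).elim
  obtain ⟨v, h1, h2, h3, h4, h5, h6, h7, h8⟩ := main
  rw [hpairs] at h2 h8
  have e1 : (loop.run s₁).var .base = p := by
    rw [Prog.run_var_of_notMem (of_decide_eq_true rfl)]; simp [hs₁, hpdef]
  have e2 : (loop.run s₁).var .inf = N + 1 := by
    rw [Prog.run_var_of_notMem (of_decide_eq_true rfl)]; simp [hs₁, hinf]
  set s₂ := (loop.run s₁).setVar .target p with hs₂
  have hrun : (writeCycle td tl tn).run s = (walk td tn .testV .testVLen).run s₂ := by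
    rw [hs₂, ← e1]
    simp [writeCycle, Prog.run, Arith.eval, ← hpdef, hs₁, hloop]
  have g1 : s₂.var .cur = (loop.run s₁).var .cur := by simp [hs₂]
  have g2 : s₂.var .target = p := by simp [hs₂]
  obtain ⟨w, w1, w2, w3, w4, w5, w6⟩ := run_walk (td := td) (tn := tn) (Or.inr rfl) hdst
    (s := s₂) h (by rw [← hd, ← frame td hdst.1.symm]; rfl)
    (by rw [← hn, ← frame tn hdst.2.symm]; rfl) (by simpa [hs₂] using e2) (by rw [g1]; exact h5)
    (by rw [g2]; exact hp) (by rw [g1, g2]; exact h7)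
  have g3 : s₂.row .testV 0 (s₂.var .testVLen) = v := by
    rw [← h3]; simp [hs₂, Store.row]
  rw [g3] at w4
  rw [g1, g2] at w5
  rw [hrun]
  refine ⟨v ++ w, by simp [w1], fun a ha => (List.mem_append.1 ha).elim (h1 a) (w2 a), ?_, w4, ?_, ?_⟩
  · rw [List.length_append, Nat.succ_mul]
    have := Nat.mul_le_mul_right (N + 1) hm
    omega
  · rw [List.foldl_append, h4, w5]
  · intro c hci hc1 hc2
    obtain ⟨v', hv1, hv2⟩ := h8 c hci hc1 hc2
    exact ⟨v', hv1.trans (List.prefix_append _ _), hv2⟩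

end walk

end

/-! ### Restricted products and their cycles -/

section

variable {k n : ℕ}

/-- The code of a pair of states as a number below `n * n`. -/
def pairCode (x : Fin n × Fin n) : ℕ := x.1 * n + x.2

theorem pairCode_lt (x : Fin n × Fin n) : pairCode x < n * n := by
  have h₁ := x.1.isLt
  have h₂ := x.2.isLt
  unfold pairCode
  calc (x.1 : ℕ) * n + x.2 < x.1 * n + n := by omega
    _ = (x.1 + 1) * n := by ring
    _ ≤ n * n := Nat.mul_le_mul_right _ h₁

theorem pairCode_div (x : Fin n × Fin n) : pairCode x / n = x.1 := by
  rw [pairCode, Nat.mul_comm, Nat.mul_add_div x.1.pos, Nat.div_eq_of_lt x.2.isLt, add_zero]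

theorem pairCode_mod (x : Fin n × Fin n) : pairCode x % n = x.2 := by
  rw [pairCode, Nat.mul_comm, Nat.mul_add_mod, Nat.mod_eq_of_lt x.2.isLt]

theorem pairCode_injective : Function.Injective (pairCode (n := n)) := fun x y h =>
  Prod.ext (Fin.ext (by rw [← pairCode_div, h, pairCode_div]))
    (Fin.ext (by rw [← pairCode_mod, h, pairCode_mod]))

theorem exists_pairCode {p : ℕ} (hp : p < n * n) : ∃ x : Fin n × Fin n, pairCode x = p := by
  have hn : 0 < n := Nat.pos_of_mul_pos_right (Nat.zero_lt_of_lt hp)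
  refine ⟨(⟨p / n, Nat.div_lt_of_lt_mul hp⟩, ⟨p % n, Nat.mod_lt _ hn⟩), ?_⟩
  rw [pairCode, Nat.mul_comm]
  exact Nat.div_add_mod p n

theorem exists_map_val {w : List ℕ} (h : ∀ a ∈ w, a < k) :
    ∃ w' : List (Fin k), w'.map Fin.val = w := by
  refine ⟨w.pmap Fin.mk h, ?_⟩
  rw [List.map_pmap]
  simp

/-- The graph of the product of `A` with itself, restricted to the pairs in `R₁ × R₂`. All
other pairs are merged into the sink `n * n`. -/
structure IsProduct (A : Acceptor (Fin k) (Fin n)) (R₁ R₂ : Set (Fin n)) (d : ℕ → ℕ → ℕ) :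
    Prop where
  inside : ∀ (x : Fin n × Fin n) (a : Fin k), A.step x.1 a ∈ R₁ → A.step x.2 a ∈ R₂ →
    d (pairCode x) a = pairCode (A.step x.1 a, A.step x.2 a)
  outside : ∀ (x : Fin n × Fin n) (a : Fin k), ¬ (A.step x.1 a ∈ R₁ ∧ A.step x.2 a ∈ R₂) →
    d (pairCode x) a = n * n
  sink : ∀ a : Fin k, d (n * n) a = n * n

/-- The automaton that runs `A` from `q₁` and from `q₂` in parallel. -/
def Acceptor.twin (A : Acceptor (Fin k) (Fin n)) (q₁ q₂ : Fin n) :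
    Automaton (Fin k) (Fin n × Fin n) :=
  (A.withInit q₁).toAutomaton.prod (A.withInit q₂).toAutomaton

namespace IsProduct

variable {A : Acceptor (Fin k) (Fin n)} {R₁ R₂ : Set (Fin n)} {d : ℕ → ℕ → ℕ}
  (h : IsProduct A R₁ R₂ d)
include h

theorem closed : ∀ p < n * n + 1, ∀ a < k, d p a < n * n + 1 := by
  intro p hp a ha
  rcases Nat.lt_succ_iff_lt_or_eq.1 hp with hp | rfl
  · obtain ⟨x, rfl⟩ := exists_pairCode hp
    by_cases hx : A.step x.1 ⟨a, ha⟩ ∈ R₁ ∧ A.step x.2 ⟨a, ha⟩ ∈ R₂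
    · rw [h.inside x ⟨a, ha⟩ hx.1 hx.2]
      exact (pairCode_lt _).trans (Nat.lt_succ_self _)
    · rw [h.outside x ⟨a, ha⟩ hx]
      exact Nat.lt_succ_self _
  · rw [h.sink ⟨a, ha⟩]
    exact Nat.lt_succ_self _

theorem foldl_sink (w : List (Fin k)) : (w.map Fin.val).foldl d (n * n) = n * n := by
  induction w with
  | nil => rfl
  | cons a w ih => simpa [h.sink a] using ih

/-- A path of the graph is a run of the product until it enters the sink. -/
theorem foldl_eq_or (q₁ q₂ : Fin n) (w : List (Fin k)) (x : Fin n × Fin n) :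
    (w.map Fin.val).foldl d (pairCode x) = pairCode (w.foldl (A.twin q₁ q₂).step x) ∨
      (w.map Fin.val).foldl d (pairCode x) = n * n := by
  induction w generalizing x with
  | nil => exact Or.inl rfl
  | cons a w ih =>
    by_cases hx : A.step x.1 a ∈ R₁ ∧ A.step x.2 a ∈ R₂
    · simp only [List.map_cons, List.foldl_cons, h.inside x a hx.1 hx.2]
      exact ih _
    · simp only [List.map_cons, List.foldl_cons, h.outside x a hx]
      exact Or.inr (h.foldl_sink w)

theorem foldl_twin (q₁ q₂ : Fin n) {w : List (Fin k)} {x y : Fin n × Fin n}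
    (he : (w.map Fin.val).foldl d (pairCode x) = pairCode y) :
    w.foldl (A.twin q₁ q₂).step x = y := by
  rcases h.foldl_eq_or q₁ q₂ w x with h' | h'
  · exact pairCode_injective (h'.symm.trans he)
  · exact absurd (h'.symm.trans he) (pairCode_lt y).ne'

theorem mem_of_foldl {w : List (Fin k)} (hw : w ≠ []) {x y : Fin n × Fin n}
    (he : (w.map Fin.val).foldl d (pairCode x) = pairCode y) : y.1 ∈ R₁ ∧ y.2 ∈ R₂ := by
  induction w generalizing x with
  | nil => exact (hw rfl).elim
  | cons a w ih =>
    by_cases hx : A.step x.1 a ∈ R₁ ∧ A.step x.2 a ∈ R₂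
    · simp only [List.map_cons, List.foldl_cons, h.inside x a hx.1 hx.2] at he
      rcases eq_or_ne w [] with rfl | hw'
      · obtain rfl := pairCode_injective he
        exact hx
      · exact ih hw' he
    · simp only [List.map_cons, List.foldl_cons, h.outside x a hx, h.foldl_sink w] at he
      exact absurd he (pairCode_lt y).ne'

/-- A part of a run that stays in `R₁ × R₂` is a path of the graph. -/
theorem exists_path_run (q₁ q₂ : Fin n) (w : Stream' (Fin k)) (i l : ℕ)
    (hR : ∀ j, i < j → ((A.twin q₁ q₂).run w j).1 ∈ R₁ ∧ ((A.twin q₁ q₂).run w j).2 ∈ R₂) :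
    ∃ u : List (Fin k), u.length = l ∧
      (u.map Fin.val).foldl d (pairCode ((A.twin q₁ q₂).run w i)) =
        pairCode ((A.twin q₁ q₂).run w (i + l)) := by
  induction l with
  | zero => exact ⟨[], rfl, rfl⟩
  | succ l ih =>
    obtain ⟨u, hu, he⟩ := ih
    refine ⟨u ++ [w.get (i + l)], by simp [hu], ?_⟩
    have := hR (i + l + 1) (by omega)
    rw [List.map_append, List.foldl_append, he]
    exact h.inside _ _ this.1 this.2

end IsProduct

/-- The pairs of states that lie on a common cycle with `x`, as recorded in a table of
distances. -/
def cycleSet (lev : ℕ → ℕ → ℕ) (x : Fin n × Fin n) : Set (Fin n × Fin n) :=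
  {y | lev (pairCode x) (pairCode y) < n * n + 1 + 1 ∧ lev (pairCode y) (pairCode x) < n * n + 1 + 1}

/-- A closed path through all of `cycleSet` that is preceded by a path from `(q₁, q₂)` gives an
ultimately periodic word whose two runs have the projections of `cycleSet` as sets of infinitely
recurring states. -/
theorem mem_language_cycle {A : Acceptor (Fin k) (Fin n)} {R₁ R₂ R₁' R₂' : Set (Fin n)}
    {d d' lev nxt : ℕ → ℕ → ℕ} (h : IsProduct A R₁ R₂ d) (h' : IsProduct A R₁' R₂' d')
    (hD : Distances d (n * n + 1) k lev nxt) {q₁ q₂ : Fin n} {x : Fin n × Fin n}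
    (w : UPWord (Fin k))
    (hu : (w.pre.map Fin.val).foldl d' (pairCode (q₁, q₂)) = pairCode x)
    (hv : (w.per.map Fin.val).foldl d (pairCode x) = pairCode x)
    (hc : ∀ y ∈ cycleSet lev x, ∃ v', v' <+: w.per.map Fin.val ∧
      v'.foldl d (pairCode x) = pairCode y) :
    (w.word ∈ (A.withInit q₁).language ↔ A.acc.Accepts (Prod.fst '' cycleSet lev x)) ∧
    (w.word ∈ (A.withInit q₂).language ↔ A.acc.Accepts (Prod.snd '' cycleSet lev x)) := by
  have hlt : ∀ y : Fin n × Fin n, pairCode y < n * n + 1 := fun y =>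
    (pairCode_lt y).trans (Nat.lt_succ_self _)
  have hval : ∀ u : List (Fin k), ∀ a ∈ u.map Fin.val, a < k := by
    intro u a ha
    obtain ⟨b, -, rfl⟩ := List.mem_map.1 ha
    exact b.isLt
  have hreach : (A.twin q₁ q₂).reach w.pre = x := h'.foldl_twin q₁ q₂ hu
  have hcyc := h.foldl_twin q₁ q₂ hv
  have hinf : (A.twin q₁ q₂).infStates w.word = cycleSet lev x := by
    rw [UPWord.word, Automaton.infStates_append_cycle _ _ _ _ (by rw [hreach]; exact hcyc), hreach]
    ext y
    constructor
    · rintro ⟨v', ⟨v'', he⟩, rfl⟩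
      have h1 := h.foldl_eq_or q₁ q₂ v' x
      rw [← he, List.map_append, List.foldl_append] at hv
      have hy : (v'.map Fin.val).foldl d (pairCode x) =
          pairCode (v'.foldl (A.twin q₁ q₂).step x) := by
        refine h1.resolve_right fun h2 => ?_
        rw [h2, h.foldl_sink] at hv
        exact (pairCode_lt x).ne' hv
      set y := v'.foldl (A.twin q₁ q₂).step x
      rw [hy] at hv
      have hxx : (w.per.map Fin.val).foldl d (pairCode x) = pairCode x := by
        rw [← he, List.map_append, List.foldl_append, hy, hv]
      have hxy : ((w.per ++ v').map Fin.val).foldl d (pairCode x) = pairCode y := by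
        rw [List.map_append, List.foldl_append, hxx, hy]
      have hyx : ((v'' ++ w.per).map Fin.val).foldl d (pairCode y) = pairCode x := by
        rw [List.map_append, List.foldl_append, hv, hxx]
      constructor
      · rw [← hxy]
        exact hD.complete _ (hlt x) _ (by simp [w.per_ne]) (hval _)
      · rw [← hyx]
        exact hD.complete _ (hlt y) _ (by simp [w.per_ne]) (hval _)
    · intro hy
      obtain ⟨v', hp, he⟩ := hc y hy
      obtain ⟨v'', hp', rfl⟩ := List.prefix_map_iff.1 hp
      exact ⟨v'', hp', h.foldl_twin q₁ q₂ he⟩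
  constructor
  · change A.acc.Accepts ((A.withInit q₁).infStates w.word) ↔ _
    rw [← Automaton.fst_image_infStates_prod _ (A.withInit q₂).toAutomaton, ← hinf]
    rfl
  · change A.acc.Accepts ((A.withInit q₂).infStates w.word) ↔ _
    rw [← Automaton.snd_image_infStates_prod (A.withInit q₁).toAutomaton, ← hinf]
    rfl

/-- If a word distinguishes `q₁` and `q₂`, then so does the cycle through a pair that recurs
infinitely often, in the product restricted to sets on which acceptance is the same as for the
recurring states. -/
theorem exists_distinguishing_cycle {A : Acceptor (Fin k) (Fin n)} {q₁ q₂ : Fin n}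
    {w : Stream' (Fin k)} (hx : Xor (w ∈ (A.withInit q₁).language) (w ∈ (A.withInit q₂).language))
    {R₁ R₂ : Set (Fin n)} (hR₁ : (A.withInit q₁).infStates w ⊆ R₁)
    (hR₂ : (A.withInit q₂).infStates w ⊆ R₂)
    (hA₁ : ∀ Y, (A.withInit q₁).infStates w ⊆ Y → Y ⊆ R₁ →
      (A.acc.Accepts Y ↔ A.acc.Accepts ((A.withInit q₁).infStates w)))
    (hA₂ : ∀ Y, (A.withInit q₂).infStates w ⊆ Y → Y ⊆ R₂ →
      (A.acc.Accepts Y ↔ A.acc.Accepts ((A.withInit q₂).infStates w))) :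
    ∃ x : Fin n × Fin n, ∀ {d d' lev nxt lev' nxt' : ℕ → ℕ → ℕ}, IsProduct A R₁ R₂ d →
      IsProduct A Set.univ Set.univ d' → Distances d (n * n + 1) k lev nxt →
      Distances d' (n * n + 1) k lev' nxt' →
      lev' (pairCode (q₁, q₂)) (pairCode x) < n * n + 1 + 1 ∧ x ∈ cycleSet lev x ∧
      Xor (A.acc.Accepts (Prod.fst '' cycleSet lev x)) (A.acc.Accepts (Prod.snd '' cycleSet lev x)) := by
  set P := A.twin q₁ q₂ with hP
  have hfst : Prod.fst '' P.infStates w = (A.withInit q₁).infStates w :=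
    Automaton.fst_image_infStates_prod _ _ _
  have hsnd : Prod.snd '' P.infStates w = (A.withInit q₂).infStates w :=
    Automaton.snd_image_infStates_prod _ _ _
  obtain ⟨x, hxI⟩ := P.infStates_nonempty w
  refine ⟨x, fun {d d' lev nxt lev' nxt'} h h' hD hD' => ?_⟩
  have hlt : ∀ y : Fin n × Fin n, pairCode y < n * n + 1 := fun y =>
    (pairCode_lt y).trans (Nat.lt_succ_self _)
  have hval : ∀ u : List (Fin k), ∀ a ∈ u.map Fin.val, a < k := by
    intro u a ha
    obtain ⟨b, -, rfl⟩ := List.mem_map.1 ha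
    exact b.isLt
  obtain ⟨i₀, hi₀⟩ := Filter.eventually_atTop.1 (P.eventually_mem_infStates w)
  have hin : ∀ j, i₀ ≤ j → (P.run w j).1 ∈ R₁ ∧ (P.run w j).2 ∈ R₂ := fun j hj =>
    ⟨hR₁ (hfst ▸ Set.mem_image_of_mem _ (hi₀ j hj)), hR₂ (hsnd ▸ Set.mem_image_of_mem _ (hi₀ j hj))⟩
  have hpath : ∀ y ∈ P.infStates w, ∀ z ∈ P.infStates w,
      lev (pairCode y) (pairCode z) < n * n + 1 + 1 := by
    intro y hy z hz
    obtain ⟨i, hi, rfl⟩ := Filter.frequently_atTop.1 hy i₀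
    obtain ⟨j, hj, rfl⟩ := Filter.frequently_atTop.1 hz (i + 1)
    obtain ⟨l, rfl⟩ := Nat.exists_eq_add_of_le (Nat.le_of_succ_le hj)
    obtain ⟨u, hu, he⟩ := h.exists_path_run q₁ q₂ w i l fun j hij => hin j (by omega)
    rw [hP, ← he]
    refine hD.complete _ (hlt _) _ (fun h0 => ?_) (hval u)
    rw [List.map_eq_nil_iff.1 h0, List.length_nil] at hu
    omega
  have hsub : P.infStates w ⊆ cycleSet lev x := fun y hy => ⟨hpath x hxI y hy, hpath y hy x hxI⟩
  have hmem : ∀ y ∈ cycleSet lev x, y.1 ∈ R₁ ∧ y.2 ∈ R₂ := by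
    intro y hy
    obtain ⟨u, hu, huk, he⟩ := hD.exists_word (hlt x) (hlt y) hy.1
    obtain ⟨u', rfl⟩ := exists_map_val huk
    exact h.mem_of_foldl (by simpa using hu) he
  refine ⟨?_, hsub hxI, ?_⟩
  · obtain ⟨i, hi, hix⟩ := Filter.frequently_atTop.1 (show ∃ᶠ i in atTop, P.run w i = x from hxI) 1
    obtain ⟨u, hu, he⟩ := h'.exists_path_run q₁ q₂ w 0 i fun j _ => ⟨trivial, trivial⟩
    rw [zero_add] at he
    rw [← hix, hP, ← he]
    refine hD'.complete _ (hlt (q₁, q₂)) _ (fun h0 => ?_) (hval u)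
    rw [List.map_eq_nil_iff.1 h0, List.length_nil] at hu
    omega
  · have e₁ := hA₁ (Prod.fst '' cycleSet lev x) (by rw [← hfst]; exact Set.image_mono hsub)
      (by rintro _ ⟨y, hy, rfl⟩; exact (hmem y hy).1)
    have e₂ := hA₂ (Prod.snd '' cycleSet lev x) (by rw [← hsnd]; exact Set.image_mono hsub)
      (by rintro _ ⟨y, hy, rfl⟩; exact (hmem y hy).2)
    rw [e₁, e₂]
    exact hx

end

/-! ### Acceptance conditions as unions of intervals -/

section

variable {n : ℕ}

/-- The tables `lo`, `up` and `good` describe the acceptance condition `α` as a union of intervals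
of sets of states: the `i`-th interval, for `i < M` with `good 0 i ≠ 0`, consists of the sets that
contain the states in row `i` of `lo` and are contained in row `i` of `up`. The rows of `up`, of
which row `M` is the set of all states, are the sets from which restrictions of the product are
built: by `restrict`, each nonempty set `X` of states is contained in a row, possibly with one
state removed, such that acceptance is constant between `X` and this set. -/
structure Intervals (α : Acceptance (Fin n)) (M : ℕ) (lo up good : ℕ → ℕ → ℕ) : Prop where
  lo_le : ∀ i < M, ∀ q : Fin n, lo i q ≤ 1
  up_le : ∀ i ≤ M, ∀ q : Fin n, up i q ≤ 1
  accepts : ∀ X : Set (Fin n), X.Nonempty → (α.Accepts X ↔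
    ∃ i < M, good 0 i ≠ 0 ∧ ∀ q : Fin n, (lo i q = 1 → q ∈ X) ∧ (q ∈ X → up i q = 1))
  univ : ∀ q : Fin n, up M q = 1
  restrict : ∀ X : Set (Fin n), X.Nonempty → ∃ i ≤ M, ∃ r ≤ n,
    X ⊆ {q : Fin n | up i q = 1 ∧ (q : ℕ) ≠ r} ∧
    ∀ Y, X ⊆ Y → Y ⊆ {q : Fin n | up i q = 1 ∧ (q : ℕ) ≠ r} → (α.Accepts Y ↔ α.Accepts X)

theorem exists_eq_sInf_image {X : Set (Fin n)} (hX : X.Nonempty) (c : ℕ → ℕ) :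
    ∃ q ∈ X, c q = sInf ((fun q : Fin n => c q) '' X) := by
  obtain ⟨q, hq, he⟩ := Nat.sInf_mem (hX.image fun q : Fin n => c q)
  exact ⟨q, hq, he⟩

theorem sInf_image_le {X : Set (Fin n)} {q : Fin n} (hq : q ∈ X) (c : ℕ → ℕ) :
    sInf ((fun q : Fin n => c q) '' X) ≤ c q :=
  Nat.sInf_le (Set.mem_image_of_mem _ hq)

/-- For a parity condition, the interval of the state `i` of odd colour consists of the sets that
contain `i` and no state of smaller colour; and the restriction that suits `X` is to the states of
at least the minimum colour in `X`. -/
theorem Intervals.of_color {α : Acceptance (Fin n)} {lo up good : ℕ → ℕ → ℕ} (c : ℕ → ℕ)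
    (hα : ∀ X : Set (Fin n), X.Nonempty →
      (α.Accepts X ↔ Odd (sInf ((fun q : Fin n => c q) '' X))))
    (hlo : ∀ i < n, ∀ q < n, lo i q = if q = i then 1 else 0)
    (hup : ∀ i < n, ∀ q < n, up i q = if c q < c i then 0 else 1)
    (hgood : ∀ i < n, good 0 i = c i % 2) (huniv : ∀ q < n, up n q = 1) :
    Intervals α n lo up good where
  lo_le i hi q := by rw [hlo i hi q q.isLt]; split_ifs <;> simp
  up_le i hi q := by
    rcases hi.lt_or_eq with hi | rfl
    · rw [hup i hi q q.isLt]; split_ifs <;> simp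
    · rw [huniv q q.isLt]
  univ q := huniv q q.isLt
  accepts X hX := by
    rw [hα X hX]
    obtain ⟨q, hq, he⟩ := exists_eq_sInf_image hX c
    constructor
    · intro hodd
      refine ⟨q, q.isLt, ?_, fun x => ⟨fun hx => ?_, fun hx => ?_⟩⟩
      · rw [hgood q q.isLt, he, Nat.odd_iff.1 hodd]; simp
      · rw [hlo q q.isLt x x.isLt] at hx
        have : x = q := by
          by_contra hne
          simp [Fin.val_ne_of_ne hne] at hx
        rw [this]; exact hq
      · rw [hup q q.isLt x x.isLt, if_neg]
        rw [he, not_lt]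
        exact sInf_image_le hx c
    · rintro ⟨i, hi, hg, h⟩
      have hiX : (⟨i, hi⟩ : Fin n) ∈ X := (h ⟨i, hi⟩).1 (by rw [hlo i hi _ hi]; simp)
      have : c q = c i := by
        refine le_antisymm (he ▸ sInf_image_le hiX c) ?_
        have := (h q).2 hq
        rw [hup i hi q q.isLt] at this
        by_contra hc
        rw [if_pos (not_le.1 hc)] at this
        exact zero_ne_one this
      rw [hgood i hi] at hg
      rw [← he, this, Nat.odd_iff]
      omega
  restrict X hX := by
    obtain ⟨q, hq, he⟩ := exists_eq_sInf_image hX c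
    have hmem : ∀ x : Fin n, (up q x = 1 ∧ (x : ℕ) ≠ n) ↔ c q ≤ c x := by
      intro x
      rw [hup q q.isLt x x.isLt]
      by_cases hc : c x < c q
      · simp [hc]
      · simp [hc, x.isLt.ne, not_lt.1 hc]
    refine ⟨q, q.isLt.le, n, le_rfl, fun x hx => (hmem x).2 (he ▸ sInf_image_le hx c),
      fun Y hXY hY => ?_⟩
    rw [hα X hX, hα Y (hX.mono hXY)]
    obtain ⟨y, hy, hey⟩ := exists_eq_sInf_image (hX.mono hXY) c
    rw [← he, ← hey, show c y = c q from
      le_antisymm (hey ▸ sInf_image_le (hXY hq) c) ((hmem y).1 (hY hy))]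

/-- A Büchi condition is the parity condition with colours `1` on `F` and `2` elsewhere. -/
theorem accepts_buchi_iff {F : Finset (Fin n)} {c : ℕ → ℕ}
    (hc : ∀ q : Fin n, c q = if q ∈ F then 1 else 2) {X : Set (Fin n)} (hX : X.Nonempty) :
    (Acceptance.buchi F).Accepts X ↔ Odd (sInf ((fun q : Fin n => c q) '' X)) := by
  obtain ⟨q, hq, he⟩ := exists_eq_sInf_image hX c
  change (X ∩ F).Nonempty ↔ _
  constructor
  · rintro ⟨x, hx, hxF⟩
    have h1 := sInf_image_le hx c
    rw [← he, hc x, if_pos (by simpa using hxF)] at h1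
    have h2 := hc q
    rw [← he]
    split_ifs at h2
    · rw [h2]; exact odd_one
    · omega
  · intro hodd
    rw [← he, hc q] at hodd
    refine ⟨q, hq, ?_⟩
    by_contra hF
    rw [if_neg (by simpa using hF)] at hodd
    exact absurd hodd (by decide)

/-- A coBüchi condition is the parity condition with colours `0` on `F` and `1` elsewhere. -/
theorem accepts_cobuchi_iff {F : Finset (Fin n)} {c : ℕ → ℕ}
    (hc : ∀ q : Fin n, c q = if q ∈ F then 0 else 1) {X : Set (Fin n)} (hX : X.Nonempty) :
    (Acceptance.cobuchi F).Accepts X ↔ Odd (sInf ((fun q : Fin n => c q) '' X)) := by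
  obtain ⟨q, hq, he⟩ := exists_eq_sInf_image hX c
  change X ∩ F = ∅ ↔ _
  rw [← he, hc q]
  constructor
  · intro h
    rw [if_neg fun hF => (h ▸ (⟨hq, by simpa using hF⟩ : q ∈ X ∩ F) : q ∈ (∅ : Set (Fin n)))]
    exact odd_one
  · intro hodd
    ext x
    simp only [Set.mem_inter_iff, Set.mem_empty_iff_false, iff_false, not_and]
    intro hx hxF
    have h1 := sInf_image_le hx c
    rw [← he, hc x, if_pos (by simpa using hxF), hc q] at h1
    rw [Nat.le_zero.1 h1] at hodd
    exact absurd hodd (by decide)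

/-- For a Muller condition, each member of the family is an interval. A minimal restriction that
contains a set outside the family contains no member of the family above that set. -/
theorem Intervals.of_muller {family : Finset (Finset (Fin n))}
    (e : Fin family.card ≃ {F // F ∈ family}) {lo up good : ℕ → ℕ → ℕ}
    (hlo : ∀ (i : Fin family.card) (q : Fin n), lo i q = if q ∈ (e i).1 then 1 else 0)
    (hup : ∀ (i : Fin family.card) (q : Fin n), up i q = if q ∈ (e i).1 then 1 else 0)
    (hgood : ∀ i < family.card, good 0 i = 1) (huniv : ∀ q < n, up family.card q = 1) :
    Intervals (.muller family) family.card lo up good where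
  lo_le i hi q := by rw [hlo ⟨i, hi⟩ q]; split_ifs <;> simp
  up_le i hi q := by
    rcases hi.lt_or_eq with hi | rfl
    · rw [hup ⟨i, hi⟩ q]; split_ifs <;> simp
    · rw [huniv q q.isLt]
  univ q := huniv q q.isLt
  accepts X _ := by
    constructor
    · rintro ⟨F, hF, rfl⟩
      obtain ⟨i, hi⟩ := e.surjective ⟨F, hF⟩
      refine ⟨i, i.isLt, by rw [hgood i i.isLt]; simp, fun q => ?_⟩
      rw [hlo, hup, hi]
      simp
    · rintro ⟨i, hi, -, h⟩
      refine ⟨(e ⟨i, hi⟩).1, (e ⟨i, hi⟩).2, ?_⟩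
      ext q
      have := h q
      rw [hlo ⟨i, hi⟩ q, hup ⟨i, hi⟩ q] at this
      simpa using ⟨fun hq => this.1 (by simpa using hq), fun hq => by simpa using this.2 hq⟩
  restrict X hX := by
    classical
    set α : Acceptance (Fin n) := .muller family
    have hup' : ∀ F ∈ family, ∃ i < family.card, ∀ q : Fin n, up i q = 1 ↔ q ∈ F := by
      intro F hF
      obtain ⟨i, hi⟩ := e.surjective ⟨F, hF⟩
      refine ⟨i, i.isLt, fun q => ?_⟩
      rw [hup, hi]
      simp
    by_cases hXF : α.Accepts X
    · obtain ⟨F, hF, rfl⟩ := id hXF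
      obtain ⟨i, hi, h⟩ := hup' F hF
      refine ⟨i, hi.le, n, le_rfl, fun q hq => ⟨(h q).2 (by simpa using hq), q.isLt.ne⟩,
        fun Y h1 h2 => ?_⟩
      rw [show Y = F from Set.Subset.antisymm (fun q hq => by simpa using (h q).1 (h2 hq).1) h1]
    · -- Among the restrictions that contain `X`, choose one with as few states as possible.
      let R : ℕ → ℕ → Set (Fin n) := fun i r => {q | up i q = 1 ∧ (q : ℕ) ≠ r}
      have hex : ∃ m, ∃ i ≤ family.card, ∃ r ≤ n, X ⊆ R i r ∧ (R i r).ncard = m :=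
        ⟨_, family.card, le_rfl, n, le_rfl, fun q _ => ⟨huniv q q.isLt, q.isLt.ne⟩, rfl⟩
      obtain ⟨i, hi, r, hr, hXR, hcard⟩ := Nat.find_spec hex
      refine ⟨i, hi, r, hr, hXR, fun Y hXY hYR => iff_of_false ?_ hXF⟩
      rintro ⟨F, hF, rfl⟩
      have hne : X ≠ F := by rintro rfl; exact hXF ⟨F, hF, rfl⟩
      obtain ⟨q, hqF, hqX⟩ := Set.exists_of_ssubset (hXY.ssubset_of_ne hne)
      obtain ⟨j, hj, h⟩ := hup' F hF
      have hss : R j q ⊂ R i r := by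
        refine ⟨fun x hx => hYR (by simpa using (h x).1 hx.1), fun hc => ?_⟩
        exact (hc (hYR hqF)).2 rfl
      refine Nat.find_min hex (m := (R j q).ncard) ?_
        ⟨j, hj.le, q, q.isLt.le, fun x hx => ⟨(h x).2 (by simpa using hXY hx), ?_⟩, rfl⟩
      · rw [← hcard]
        exact Set.ncard_lt_ncard hss
      · intro hxq
        exact hqX (Fin.ext hxq ▸ hx)

end

/-! ### Tables of the test and loops that fill them -/

section

variable {k n : ℕ}

/-- The multiples of the number of states, in row `0`. -/
abbrev Tab.mul : Tab := .work 0
/-- The first components of pairs of states, in row `0`. -/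
abbrev Tab.fst : Tab := .work 1
/-- The second components of pairs of states, in row `0`. -/
abbrev Tab.snd : Tab := .work 2
/-- The colours of the states, in row `0`, for conditions other than Muller's. -/
abbrev Tab.color : Tab := .work 3
/-- The least sets of the intervals that describe the acceptance condition, one per row. -/
abbrev Tab.lo : Tab := .work 4
/-- The greatest sets of these intervals, and the set of all states in the row after them. -/
abbrev Tab.up : Tab := .work 5
/-- Which of the intervals are used, in row `0`. -/
abbrev Tab.good : Tab := .work 6
/-- The two projections of a set of pairs of states, in rows `0` and `1`. -/
abbrev Tab.proj : Tab := .work 7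
/-- The graph of a restricted product; `lev` and `nxt` hold its distances and the first symbols of
shortest paths. -/
abbrev Tab.graph : Tab := .work 8
abbrev Tab.lev : Tab := .work 9
abbrev Tab.nxt : Tab := .work 10
/-- The graph of the unrestricted product; `lev'` and `nxt'` hold its distances and the first
symbols of shortest paths. -/
abbrev Tab.graph' : Tab := .work 11
abbrev Tab.lev' : Tab := .work 12
abbrev Tab.nxt' : Tab := .work 13

theorem Store.setTab_tab_apply (s : Store) (t t' : Tab) (i j m p q : ℕ) :
    (s.setTab t i j m).tab t' p q = if t' = t ∧ p = i ∧ q = j then m else s.tab t' p q := by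
  by_cases ht : t' = t
  · subst ht
    rw [Store.setTab_tab_self]
    by_cases hp : p = i
    · subst hp
      by_cases hq : q = j <;> simp [hq]
    · simp [hp]
  · rw [Store.setTab_tab_of_ne _ _ _ _ ht]
    simp [ht]

/-- A loop that fills a part of a row of a table. -/
theorem Prog.run_fillRow {x b : Var} {p : Prog} {t : Tab} {s : Store} (i : ℕ) (f : ℕ → ℕ)
    (h : ∀ j < s.var b, ∀ s', s'.var x = j → (∀ y, y ∉ x :: p.vars → s'.var y = s.var y) →
      (∀ t, t ∉ p.tabs → s'.tab t = s.tab t) →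
      ∀ a c, (p.run s').tab t a c = if a = i ∧ c = j then f c else s'.tab t a c) (a c : ℕ) :
    ((forUpTo x b p).run s).tab t a c = if a = i ∧ c < s.var b then f c else s.tab t a c := by
  revert a c
  refine run_forUpTo (fun j s' => ∀ a c, s'.tab t a c = if a = i ∧ c < j then f c else s.tab t a c)
    (by simp) ?_
  intro j hj s' h1 hx hv ht a c
  rw [Store.setVar_tab, h j hj s' hx hv ht, h1]
  by_cases ha : a = i
  · rcases lt_trichotomy c j with hc | hc | hc
    · simp [ha, hc, hc.ne, Nat.lt_succ_of_lt hc]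
    · simp [ha, hc]
    · simp [ha, hc.ne', not_lt.2 hc.le, show ¬ c < j + 1 by omega]
  · simp [ha]

/-- A loop whose body fills the rows of a table. -/
theorem Prog.run_fillRows {x b : Var} {p : Prog} {t : Tab} {s : Store} (m : ℕ) (f : ℕ → ℕ → ℕ)
    (h : ∀ i < s.var b, ∀ s', s'.var x = i → (∀ y, y ∉ x :: p.vars → s'.var y = s.var y) →
      (∀ t, t ∉ p.tabs → s'.tab t = s.tab t) →
      ∀ a c, (p.run s').tab t a c = if a = i ∧ c < m then f a c else s'.tab t a c) (a c : ℕ) :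
    ((forUpTo x b p).run s).tab t a c = if a < s.var b ∧ c < m then f a c else s.tab t a c := by
  revert a c
  refine run_forUpTo
    (fun i s' => ∀ a c, s'.tab t a c = if a < i ∧ c < m then f a c else s.tab t a c) (by simp) ?_
  intro i hi s' h1 hx hv ht a c
  rw [Store.setVar_tab, h i hi s' hx hv ht, h1]
  by_cases hc : c < m
  · rcases lt_trichotomy a i with ha | ha | ha
    · simp [ha, hc, ha.ne, Nat.lt_succ_of_lt ha]
    · simp [ha, hc]
    · simp [hc, ha.ne', not_lt.2 ha.le, show ¬ a < i + 1 by omega]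
  · simp [hc]

/-! ### Tables of pairs -/

/-- Compute the tables that translate between pairs of states and their codes. -/
def pairTables : Prog :=
  .seq (.assign .cur (.lit 0)) <| .forUpTo .state .numStates <|
    .seq (.write .mul (.lit 0) (.var .state) (.var .cur)) <| .forUpTo .member .numStates <|
      .seq (.write .fst (.lit 0) (.var .cur) (.var .state)) <|
      .seq (.write .snd (.lit 0) (.var .cur) (.var .member)) <|
      .assign .cur (.add (.var .cur) (.lit 1))

/-- Compute the registers that bound loops. The register `cur` holds the number of pairs. -/
def sizes : Prog :=
  .seq (.assign .nPairs (.var .cur)) <|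
  .seq (.assign .nNodes (.add (.var .cur) (.lit 1))) <|
  .seq (.assign .inf (.add (.var .cur) (.lit 2))) <|
  .seq (.assign .nP1 (.add (.var .numStates) (.lit 1))) <|
  .seq (.ite (.eq (.var .kind) (.lit 3)) (.assign .nSets (.var .numSets))
    (.assign .nSets (.var .numStates))) <|
  .assign .nRows (.add (.var .nSets) (.lit 1))

theorem run_pairTables {s : Store} (hn : s.var .numStates = n) :
    (pairTables.run s).var .cur = n * n ∧ (∀ q < n, (pairTables.run s).tab .mul 0 q = q * n) ∧
    ∀ p < n * n, (pairTables.run s).tab .fst 0 p = p / n ∧ (pairTables.run s).tab .snd 0 p = p % n := by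
  have key := Prog.run_forUpTo (x := .state) (b := .numStates) (p := .seq
    (.write .mul (.lit 0) (.var .state) (.var .cur)) <| .forUpTo .member .numStates <|
      .seq (.write .fst (.lit 0) (.var .cur) (.var .state)) <|
      .seq (.write .snd (.lit 0) (.var .cur) (.var .member)) <|
      .assign .cur (.add (.var .cur) (.lit 1))) (s := s.setVar .cur 0)
    (fun i s' => s'.var .cur = i * n ∧ (∀ q < i, s'.tab .mul 0 q = q * n) ∧
      ∀ p < i * n, s'.tab .fst 0 p = p / n ∧ s'.tab .snd 0 p = p % n)
    (by simp) ?_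
  · rw [show (s.setVar .cur 0).var .numStates = n by simpa using hn] at key
    exact key
  · rintro i hi s' ⟨h1, h2, h3⟩ hx hv ht
    set s₁ := s'.setTab .mul 0 i (i * n) with hs₁
    have hn' : s₁.var .numStates = n := by
      rw [hs₁, Store.setTab_var, hv _ (by decide)]; simpa using hn
    have inner := Prog.run_forUpTo (x := .member) (b := .numStates) (p :=
      .seq (.write .fst (.lit 0) (.var .cur) (.var .state)) <|
      .seq (.write .snd (.lit 0) (.var .cur) (.var .member)) <|
      .assign .cur (.add (.var .cur) (.lit 1))) (s := s₁)
      (fun j s'' => s''.var .cur = i * n + j ∧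
        ∀ p < i * n + j, s''.tab .fst 0 p = p / n ∧ s''.tab .snd 0 p = p % n)
      ⟨by simp [hs₁, h1], by
        simpa [hs₁, Store.setTab_tab_apply] using h3⟩ ?_
    · rw [hn'] at inner
      have hmul : ∀ q, ((Prog.forUpTo .member .numStates <|
          .seq (.write .fst (.lit 0) (.var .cur) (.var .state)) <|
          .seq (.write .snd (.lit 0) (.var .cur) (.var .member)) <|
          .assign .cur (.add (.var .cur) (.lit 1))).run s₁).tab .mul 0 q = s₁.tab .mul 0 q :=
        fun q => by rw [Prog.run_tab_of_notMem (by decide)]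
      simp only [Prog.run] at inner hmul ⊢
      simp only [Arith.eval, hx, h1, ← hs₁, Store.setVar_var, if_false,
        Store.setVar_tab, Var.tmp.injEq, Nat.reduceEqDiff] at inner hmul ⊢
      refine ⟨by rw [inner.1]; ring, fun q hq => ?_, fun p hp => inner.2 p (by
        rw [Nat.succ_mul] at hp; exact hp)⟩
      rw [hmul, hs₁, Store.setTab_tab_apply]
      rcases Nat.lt_succ_iff_lt_or_eq.1 hq with hq | rfl
      · simp [hq.ne, h2 q hq]
      · simp
    · rintro j hj s'' ⟨h4, h5⟩ hx' hv' ht'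
      have e1 : s''.var .state = i := by rw [hv' _ (by decide), hs₁, Store.setTab_var, hx]
      have hjn : j < n := by rwa [hn'] at hj
      refine ⟨by simp [Prog.run, Arith.eval, h4]; ring, fun p hp => ?_⟩
      simp only [Prog.run, Arith.eval, h4, e1, hx', Store.setVar_tab, Store.setTab_var,
        Store.setTab_tab_apply]
      rcases (show p < i * n + j ∨ p = i * n + j by omega) with hp | rfl
      · simpa [hp.ne] using h5 p hp
      · have hn0 : 0 < n := by omega
        rw [Nat.mul_comm i n, Nat.mul_add_div hn0, Nat.div_eq_of_lt hjn, Nat.mul_add_mod,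
          Nat.mod_eq_of_lt hjn]
        simp

/-- The tables for pairs of states and the registers that bound loops are in place. -/
structure Sized (A : Acceptor (Fin k) (Fin n)) (q₁ q₂ : Fin n) (M : ℕ) (s : Store) : Prop where
  numStates : s.var .numStates = n
  numSyms : s.var .numSyms = k
  nPairs : s.var .nPairs = n * n
  nNodes : s.var .nNodes = n * n + 1
  inf : s.var .inf = n * n + 1 + 1
  nP1 : s.var .nP1 = n + 1
  nSets : s.var .nSets = M
  nRows : s.var .nRows = M + 1
  arg₁ : s.var .arg₁ = (q₁ : ℕ)
  arg₂ : s.var .arg₂ = (q₂ : ℕ)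
  delta : ∀ (q : Fin n) (a : Fin k), s.tab .delta q a = (A.step q a : ℕ)
  mul : ∀ q : Fin n, s.tab .mul 0 q = q * n
  fst : ∀ x : Fin n × Fin n, s.tab .fst 0 (pairCode x) = (x.1 : ℕ)
  snd : ∀ x : Fin n × Fin n, s.tab .snd 0 (pairCode x) = (x.2 : ℕ)

/-- The registers that occur in `Sized`. -/
def Var.sized : List Var :=
  [.numStates, .numSyms, .nPairs, .nNodes, .inf, .nP1, .nSets, .nRows, .arg₁, .arg₂]

/-- The tables that occur in `Sized`. -/
def Tab.sized : List Tab := [.delta, .mul, .fst, .snd]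

theorem Sized.congr {A : Acceptor (Fin k) (Fin n)} {q₁ q₂ : Fin n} {M : ℕ} {s s' : Store}
    (h : Sized A q₁ q₂ M s) (hv : ∀ x ∈ Var.sized, s'.var x = s.var x)
    (ht : ∀ t ∈ Tab.sized, s'.tab t = s.tab t) : Sized A q₁ q₂ M s' := by
  simp only [Var.sized, Tab.sized, List.mem_cons, List.not_mem_nil, or_false, forall_eq_or_imp,
    forall_eq] at hv ht
  obtain ⟨h1, h2, h3, h4, h5, h6, h7, h8, h9, h10, h11, h12, h13, h14⟩ := h
  constructor <;> simp only [hv, ht] <;> assumption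

/-- The number of intervals that describe the acceptance condition of `A`. -/
def Acceptor.numIntervals (A : Acceptor (Fin k) (Fin n)) : ℕ :=
  match A.acc with
  | .muller family => family.card
  | _ => n

theorem run_sizes {A : Acceptor (Fin k) (Fin n)} {q₁ q₂ : Fin n} {s : Store} (h : s.HoldsInput A)
    (h₁ : s.var .arg₁ = (q₁ : ℕ)) (h₂ : s.var .arg₂ = (q₂ : ℕ)) :
    Sized A q₁ q₂ A.numIntervals ((Prog.seq pairTables sizes).run s) := by
  obtain ⟨hc, hm, hp⟩ := run_pairTables h.1
  have hv : ∀ y, y ∉ pairTables.vars → (pairTables.run s).var y = s.var y := fun y hy =>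
    Prog.run_var_of_notMem hy s
  have hM : (if s.var .kind = 3 then s.var .numSets else n) = A.numIntervals := by
    have := h.2.2.2.2
    unfold Acceptor.numIntervals
    split at this <;> rename_i heq
    · simp [this.1, heq]
    · simp [this.1, heq]
    · simp [this.1, heq]
    · simp [this.1, this.2.1, heq]
  have hsets : ((Prog.seq pairTables sizes).run s).var .nSets = A.numIntervals := by
    rw [← hM]
    by_cases hk : s.var .kind = 3 <;>
    simp [Prog.run, sizes, Arith.eval, hv _ (show Var.kind ∉ pairTables.vars by decide), hk,
      hv _ (show Var.numSets ∉ pairTables.vars by decide),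
      hv _ (show Var.numStates ∉ pairTables.vars by decide), h.1]
  have hrows : ((Prog.seq pairTables sizes).run s).var .nRows = A.numIntervals + 1 := by
    rw [← hM]
    by_cases hk : s.var .kind = 3 <;>
    simp [Prog.run, sizes, Arith.eval, hv _ (show Var.kind ∉ pairTables.vars by decide), hk,
      hv _ (show Var.numSets ∉ pairTables.vars by decide),
      hv _ (show Var.numStates ∉ pairTables.vars by decide), h.1]
  have hv' : ∀ y, y ∉ (Prog.seq pairTables sizes).vars →
      ((Prog.seq pairTables sizes).run s).var y = s.var y := fun y hy =>
    Prog.run_var_of_notMem hy s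
  have ht : ((Prog.seq pairTables sizes).run s).tab = (pairTables.run s).tab := by
    funext t
    exact Prog.run_tab_of_notMem (p := sizes) (by simp [sizes, Prog.tabs]) _
  have hlit : ∀ y ∈ [Var.nPairs, .nNodes, .inf, .nP1], ((Prog.seq pairTables sizes).run s).var y =
      if y = .nPairs then n * n else if y = .nNodes then n * n + 1 else if y = .inf then n * n + 2
        else n + 1 := by
    intro y hy
    fin_cases hy <;> by_cases hk : s.var .kind = 3 <;>
    simp [Prog.run, sizes, Arith.eval, hc, hv _ (show Var.kind ∉ pairTables.vars by decide), hk,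
      hv _ (show Var.numStates ∉ pairTables.vars by decide), h.1]
  refine ⟨?_, ?_, ?_, ?_, ?_, ?_, hsets, hrows, ?_, ?_, ?_, ?_, ?_, ?_⟩
  · rw [hv' _ (by decide)]; exact h.1
  · rw [hv' _ (by decide)]; exact h.2.1
  · rw [hlit _ (by simp)]; simp
  · rw [hlit _ (by simp)]; simp
  · rw [hlit _ (by simp)]; simp
  · rw [hlit _ (by simp)]; simp
  · rw [hv' _ (by decide)]; exact h₁
  · rw [hv' _ (by decide)]; exact h₂
  · rw [ht, Prog.run_tab_of_notMem (by decide)]; exact h.2.2.2.1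
  · rw [ht]; exact fun q => hm q q.isLt
  · rw [ht]; exact fun x => by rw [(hp _ (pairCode_lt x)).1, pairCode_div]
  · rw [ht]; exact fun x => by rw [(hp _ (pairCode_lt x)).2, pairCode_mod]

/-! ### Tables of the acceptance condition -/

/-- Compute the colours of the states, for conditions other than Muller's. -/
def colorTable : Prog :=
  .forUpTo .state .numStates <| .ite (.eq (.var .kind) (.lit 0))
    (.write .color (.lit 0) (.var .state) (.sub (.lit 2) (.get .acc (.lit 0) (.var .state)))) <|
    .ite (.eq (.var .kind) (.lit 1))
      (.write .color (.lit 0) (.var .state) (.sub (.lit 1) (.get .acc (.lit 0) (.var .state))))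
      (.write .color (.lit 0) (.var .state) (.get .acc (.lit 0) (.var .state)))

/-- Compute row `set` of the tables of the intervals: for a Muller condition, both bounds are the
`set`-th member of the family; otherwise, they are the state `set` and the states of at least its
colour, and the interval is used if this colour is odd. -/
def intervalRow : Prog :=
  .seq (.ite (.eq (.var .kind) (.lit 3)) (.write .good (.lit 0) (.var .set) (.lit 1))
    (.write .good (.lit 0) (.var .set) (.parity (.get .color (.lit 0) (.var .set))))) <|
  .forUpTo .state .numStates <| .ite (.eq (.var .kind) (.lit 3))
    (.seq (.write .lo (.var .set) (.var .state) (.get .acc (.var .set) (.var .state)))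
      (.write .up (.var .set) (.var .state) (.get .acc (.var .set) (.var .state))))
    (.seq (.write .lo (.var .set) (.var .state) (.eq (.var .state) (.var .set)))
      (.write .up (.var .set) (.var .state) (.sub (.lit 1)
        (.lt (.get .color (.lit 0) (.var .state)) (.get .color (.lit 0) (.var .set))))))

/-- Compute the tables of the intervals. -/
def intervalTables : Prog :=
  .seq colorTable <| .seq (.forUpTo .set .nSets intervalRow) <|
    .forUpTo .state .numStates (.write .up (.var .nSets) (.var .state) (.lit 1))

/-- The colour of a state, as computed from its entry in the acceptance table. -/
def colorOf (kind m : ℕ) : ℕ := if kind = 0 then 2 - m else if kind = 1 then 1 - m else m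

theorem run_colorTable (s : Store) (q : ℕ) (hq : q < s.var .numStates) :
    (colorTable.run s).tab .color 0 q = colorOf (s.var .kind) (s.tab .acc 0 q) := by
  have := Prog.run_fillRow (x := .state) (b := .numStates) (t := .color) (s := s) (p :=
    .ite (.eq (.var .kind) (.lit 0))
    (.write .color (.lit 0) (.var .state) (.sub (.lit 2) (.get .acc (.lit 0) (.var .state)))) <|
    .ite (.eq (.var .kind) (.lit 1))
      (.write .color (.lit 0) (.var .state) (.sub (.lit 1) (.get .acc (.lit 0) (.var .state))))
      (.write .color (.lit 0) (.var .state) (.get .acc (.lit 0) (.var .state)))) 0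
    (fun q => colorOf (s.var .kind) (s.tab .acc 0 q)) ?_ 0 q
  · rw [if_pos ⟨rfl, hq⟩] at this
    exact this
  · intro j _ s' hx hv ht a c
    have e1 : s'.var .kind = s.var .kind := hv _ (by decide)
    have e2 : s'.tab .acc = s.tab .acc := ht _ (by decide)
    unfold colorOf
    by_cases h0 : s.var .kind = 0
    · simp [Prog.run, Arith.eval, e1, e2, h0, hx, Store.setTab_tab_apply]
      split_ifs with h <;> simp [h]
    · by_cases h1 : s.var .kind = 1
      · simp [Prog.run, Arith.eval, e1, e2, h1, hx, Store.setTab_tab_apply]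
        split_ifs with h <;> simp [h]
      · simp [Prog.run, Arith.eval, e1, e2, h0, h1, hx, Store.setTab_tab_apply]
        split_ifs with h <;> simp [h]

theorem run_intervalRow {s : Store} :
    (∀ a c, (intervalRow.run s).tab .lo a c = if a = s.var .set ∧ c < s.var .numStates then
      (if s.var .kind = 3 then s.tab .acc a c else if c = a then 1 else 0) else s.tab .lo a c) ∧
    (∀ a c, (intervalRow.run s).tab .up a c = if a = s.var .set ∧ c < s.var .numStates then
      (if s.var .kind = 3 then s.tab .acc a c else
        if s.tab .color 0 c < s.tab .color 0 a then 0 else 1) else s.tab .up a c) ∧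
    ∀ a c, (intervalRow.run s).tab .good a c = if a = 0 ∧ c = s.var .set then
      (if s.var .kind = 3 then 1 else s.tab .color 0 c % 2) else s.tab .good a c := by
  set s₁ := (Prog.ite (.eq (.var .kind) (.lit 3)) (.write .good (.lit 0) (.var .set) (.lit 1))
    (.write .good (.lit 0) (.var .set) (.parity (.get .color (.lit 0) (.var .set))))).run s with hs₁
  have hv₁ : ∀ y, s₁.var y = s.var y := fun y => Prog.run_var_of_notMem (by simp [Prog.vars]) s
  have ht₁ : ∀ t, t ≠ .good → s₁.tab t = s.tab t := fun t ht =>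
    Prog.run_tab_of_notMem (by simp [Prog.tabs, ht]) s
  refine ⟨fun a c => ?_, fun a c => ?_, fun a c => ?_⟩
  · have := Prog.run_fillRow (x := .state) (b := .numStates) (t := .lo) (s := s₁)
      (p := .ite (.eq (.var .kind) (.lit 3))
        (.seq (.write .lo (.var .set) (.var .state) (.get .acc (.var .set) (.var .state)))
          (.write .up (.var .set) (.var .state) (.get .acc (.var .set) (.var .state))))
        (.seq (.write .lo (.var .set) (.var .state) (.eq (.var .state) (.var .set)))
          (.write .up (.var .set) (.var .state) (.sub (.lit 1)
            (.lt (.get .color (.lit 0) (.var .state)) (.get .color (.lit 0) (.var .set)))))))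
      (s.var .set)
      (fun c => if s.var .kind = 3 then s.tab .acc (s.var .set) c else
        if c = s.var .set then 1 else 0) ?_ a c
    · rw [hv₁, ht₁ .lo (by decide)] at this
      refine Eq.trans this ?_
      by_cases hac : a = s.var .set
      · subst hac; rfl
      · simp [hac]
    · intro j _ s' hx hv ht a c
      have e1 : s'.var .kind = s.var .kind := by rw [hv _ (by decide), hv₁]
      have e2 : s'.var .set = s.var .set := by rw [hv _ (by decide), hv₁]
      have e3 : s'.tab .acc = s.tab .acc := by rw [ht _ (by decide), ht₁ _ (by decide)]
      by_cases hk : s.var .kind = 3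
      · simp [Prog.run, Arith.eval, e1, e2, e3, hk, hx, Store.setTab_tab_apply]
        split_ifs with h <;> simp [h]
      · simp [Prog.run, Arith.eval, e1, e2, hk, hx, Store.setTab_tab_apply]
        split_ifs with h <;> simp_all
  · have := Prog.run_fillRow (x := .state) (b := .numStates) (t := .up) (s := s₁)
      (p := .ite (.eq (.var .kind) (.lit 3))
        (.seq (.write .lo (.var .set) (.var .state) (.get .acc (.var .set) (.var .state)))
          (.write .up (.var .set) (.var .state) (.get .acc (.var .set) (.var .state))))
        (.seq (.write .lo (.var .set) (.var .state) (.eq (.var .state) (.var .set)))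
          (.write .up (.var .set) (.var .state) (.sub (.lit 1)
            (.lt (.get .color (.lit 0) (.var .state)) (.get .color (.lit 0) (.var .set)))))))
      (s.var .set)
      (fun c => if s.var .kind = 3 then s.tab .acc (s.var .set) c else
        if s.tab .color 0 c < s.tab .color 0 (s.var .set) then 0 else 1) ?_ a c
    · rw [hv₁, ht₁ .up (by decide)] at this
      refine Eq.trans this ?_
      by_cases hac : a = s.var .set
      · subst hac; rfl
      · simp [hac]
    · intro j _ s' hx hv ht a c
      have e1 : s'.var .kind = s.var .kind := by rw [hv _ (by decide), hv₁]
      have e2 : s'.var .set = s.var .set := by rw [hv _ (by decide), hv₁]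
      have e3 : s'.tab .acc = s.tab .acc := by rw [ht _ (by decide), ht₁ _ (by decide)]
      have e4 : s'.tab .color = s.tab .color := by rw [ht _ (by decide), ht₁ _ (by decide)]
      by_cases hk : s.var .kind = 3
      · simp [Prog.run, Arith.eval, e1, e2, e3, hk, hx, Store.setTab_tab_apply]
        split_ifs with h <;> simp [h]
      · by_cases hac : a = s.var .set ∧ c = j
        · obtain ⟨rfl, rfl⟩ := hac
          by_cases hlt : s.tab .color 0 c < s.tab .color 0 (s.var .set) <;>
          simp [Prog.run, Arith.eval, e1, e2, e4, hk, hx, Store.setTab_tab_apply, hlt]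
        · simp [Prog.run, Arith.eval, e1, e2, hk, hx, Store.setTab_tab_apply, hac]
  · rw [intervalRow, Prog.run, Prog.run_tab_of_notMem (by decide)]
    by_cases hk : s.var .kind = 3
    · simp [Prog.run, Arith.eval, hk, Store.setTab_tab_apply]
    · simp [Prog.run, Arith.eval, hk, Store.setTab_tab_apply]
      split_ifs with h <;> simp [h]

theorem run_intervalTables {A : Acceptor (Fin k) (Fin n)} {s : Store} (h : s.HoldsInput A)
    (hM : s.var .nSets = A.numIntervals) :
    Intervals A.acc A.numIntervals ((intervalTables.run s).tab .lo)
      ((intervalTables.run s).tab .up) ((intervalTables.run s).tab .good) := by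
  set M := A.numIntervals with hMdef
  set s₁ := colorTable.run s with hs₁
  have hv₁ : ∀ y, y ≠ .state → s₁.var y = s.var y := fun y hy =>
    Prog.run_var_of_notMem (by simp [colorTable, Prog.vars, hy]) s
  have hacc₁ : s₁.tab .acc = s.tab .acc := Prog.run_tab_of_notMem (by decide) s
  have hcol₁ : ∀ q < n, s₁.tab .color 0 q = colorOf (s.var .kind) (s.tab .acc 0 q) := fun q hq =>
    run_colorTable s q (by rw [h.1]; exact hq)
  set s₂ := (Prog.forUpTo .set .nSets intervalRow).run s₁ with hs₂
  have hrow : ∀ i < s₁.var .nSets, ∀ s' : Store, s'.var .set = i →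
      (∀ y, y ∉ Var.set :: intervalRow.vars → s'.var y = s₁.var y) →
      (∀ t, t ∉ intervalRow.tabs → s'.tab t = s₁.tab t) →
      s'.var .kind = s.var .kind ∧ s'.var .numStates = n ∧ s'.tab .acc = s.tab .acc ∧
      s'.tab .color = s₁.tab .color := fun i _ s' _ hv ht =>
    ⟨by rw [hv _ (by decide), hv₁ _ (by decide)],
      by rw [hv _ (by decide), hv₁ _ (by decide), h.1],
      by rw [ht _ (by decide), hacc₁], ht _ (by decide)⟩
  have hlo : ∀ a < M, ∀ c < n, s₂.tab .lo a c =
      if s.var .kind = 3 then s.tab .acc a c else if c = a then 1 else 0 := by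
    intro a ha c hc
    rw [hs₂, Prog.run_fillRows n
      (fun a c => if s.var .kind = 3 then s.tab .acc a c else if c = a then 1 else 0),
      if_pos ⟨by rw [hv₁ _ (by decide), hM]; exact ha, hc⟩]
    intro i hi s' hx hv ht a c
    obtain ⟨e1, e2, e3, e4⟩ := hrow i hi s' hx hv ht
    rw [run_intervalRow.1, e1, e2, e3, hx]
  have hup : ∀ a c, s₂.tab .up a c = if a < M ∧ c < n then
      (if s.var .kind = 3 then s.tab .acc a c else
        if s₁.tab .color 0 c < s₁.tab .color 0 a then 0 else 1) else s₁.tab .up a c := by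
    intro a c
    rw [hs₂, Prog.run_fillRows n (fun a c => if s.var .kind = 3 then s.tab .acc a c else
        if s₁.tab .color 0 c < s₁.tab .color 0 a then 0 else 1), hv₁ _ (by decide), hM]
    intro i hi s' hx hv ht a c
    obtain ⟨e1, e2, e3, e4⟩ := hrow i hi s' hx hv ht
    rw [run_intervalRow.2.1, e1, e2, e3, e4, hx]
  have hgood : ∀ c < M, s₂.tab .good 0 c =
      if s.var .kind = 3 then 1 else s₁.tab .color 0 c % 2 := by
    intro c hc
    rw [hs₂, Prog.run_fillRow 0 (fun c => if s.var .kind = 3 then 1 else s₁.tab .color 0 c % 2),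
      if_pos ⟨rfl, by rw [hv₁ _ (by decide), hM]; exact hc⟩]
    intro i hi s' hx hv ht a c
    obtain ⟨e1, e2, e3, e4⟩ := hrow i hi s' hx hv ht
    rw [run_intervalRow.2.2, e1, e4, hx]
  have hn₂ : s₂.var .numStates = n := by
    rw [hs₂, Prog.run_var_of_notMem (by decide), hv₁ _ (by decide), h.1]
  have hM₂ : s₂.var .nSets = M := by
    rw [hs₂, Prog.run_var_of_notMem (by decide), hv₁ _ (by decide), hM]
  have hup₃ : ∀ a c, (intervalTables.run s).tab .up a c =
      if a = M ∧ c < n then 1 else s₂.tab .up a c := by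
    intro a c
    change ((Prog.forUpTo .state .numStates
      (.write .up (.var .nSets) (.var .state) (.lit 1))).run s₂).tab .up a c = _
    rw [Prog.run_fillRow M (fun _ => 1), hn₂]
    intro i hi s' hx hv ht a c
    have e1 : s'.var .nSets = M := by rw [hv _ (by decide), hM₂]
    simp [Prog.run, Arith.eval, e1, hx, Store.setTab_tab_apply]
  have ht₃ : ∀ t, t ≠ .up → (intervalTables.run s).tab t = s₂.tab t := fun t ht =>
    Prog.run_tab_of_notMem (p := .forUpTo .state .numStates
      (.write .up (.var .nSets) (.var .state) (.lit 1))) (by simp [Prog.tabs, ht]) s₂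
  rw [ht₃ .lo (by decide), ht₃ .good (by decide)]
  have huniv : ∀ q < n, (intervalTables.run s).tab .up M q = 1 := fun q hq => by
    rw [hup₃, if_pos ⟨rfl, hq⟩]
  have hup' : ∀ i < M, ∀ q < n, (intervalTables.run s).tab .up i q =
      if s.var .kind = 3 then s.tab .acc i q else
        if s₁.tab .color 0 q < s₁.tab .color 0 i then 0 else 1 := fun i hi q hq => by
    rw [hup₃, if_neg fun hc => hi.ne hc.1, hup, if_pos ⟨hi, hq⟩]
  have hcase := h.2.2.2.2
  clear_value M
  split at hcase <;> rename_i param heq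
  · have hMn : M = n := by rw [hMdef, Acceptor.numIntervals, heq]
    subst hMn
    rw [heq]
    simp only [hcase.1, colorOf, OfNat.zero_ne_ofNat, if_false, if_true] at hlo hup' hgood hcol₁
    refine Intervals.of_color (s₁.tab .color 0) (fun X hX => accepts_buchi_iff (fun q => ?_) hX)
      hlo hup' hgood huniv
    rw [hcol₁ q q.isLt, hcase.2]
    split_ifs <;> rfl
  · have hMn : M = n := by rw [hMdef, Acceptor.numIntervals, heq]
    subst hMn
    rw [heq]
    simp only [hcase.1, colorOf, OfNat.one_ne_ofNat, one_ne_zero, if_false, if_true]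
      at hlo hup' hgood hcol₁
    refine Intervals.of_color (s₁.tab .color 0) (fun X hX => accepts_cobuchi_iff (fun q => ?_) hX)
      hlo hup' hgood huniv
    rw [hcol₁ q q.isLt, hcase.2]
    split_ifs <;> rfl
  · have hMn : M = n := by rw [hMdef, Acceptor.numIntervals, heq]
    subst hMn
    rw [heq]
    simp only [hcase.1, colorOf, Nat.reduceEqDiff, OfNat.ofNat_ne_zero, OfNat.ofNat_ne_one, if_false]
      at hlo hup' hgood hcol₁
    refine Intervals.of_color (s₁.tab .color 0) (fun X hX => ?_) hlo hup' hgood huniv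
    change Odd _ ↔ _
    rw [Set.image_congr fun (q : Fin M) _ => (hcol₁ q q.isLt).trans (hcase.2 q)]
  · obtain ⟨h3, -, e, he⟩ := hcase
    have hMn : M = param.card := by rw [hMdef, Acceptor.numIntervals, heq]
    subst hMn
    rw [heq]
    simp only [h3, if_true] at hlo hup' hgood
    exact Intervals.of_muller e (fun i q => by rw [hlo i i.isLt q q.isLt, he])
      (fun i q => by rw [hup' i i.isLt q q.isLt, he]) hgood huniv

end

section

variable {k n : ℕ}

/-! ### The test of a restricted product -/

/-- Compute the graph of the product restricted to the pairs whose first component is in row `i₁`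
of `up` and differs from `r₁`, and whose second component is in row `i₂` and differs from `r₂`. -/
def buildGraph (td : Tab) : Prog :=
  .seq (.forUpTo .node .nPairs <| .forUpTo .sym .numSyms <|
    .seq (.assign .cur (.get .delta (.get .fst (.lit 0) (.var .node)) (.var .sym))) <|
    .seq (.assign .cur' (.get .delta (.get .snd (.lit 0) (.var .node)) (.var .sym))) <|
    .ite (.eq (.add (.sub (.get .up (.var .i₁) (.var .cur)) (.eq (.var .cur) (.var .r₁)))
        (.sub (.get .up (.var .i₂) (.var .cur')) (.eq (.var .cur') (.var .r₂)))) (.lit 2))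
      (.write td (.var .node) (.var .sym) (.add (.get .mul (.lit 0) (.var .cur)) (.var .cur')))
      (.write td (.var .node) (.var .sym) (.var .nPairs))) <|
  .forUpTo .sym .numSyms (.write td (.var .nPairs) (.var .sym) (.var .nPairs))

/-- Write the two projections of the set of pairs of states that lie on a common cycle with
`base` into rows `0` and `1` of `proj`. -/
def project : Prog :=
  .seq (.forUpTo .state .numStates <| .seq (.write .proj (.lit 0) (.var .state) (.lit 0))
    (.write .proj (.lit 1) (.var .state) (.lit 0))) <|
  .forUpTo .member .nPairs <| .ite (onCycle .lev .member)
    (.seq (.write .proj (.lit 0) (.get .fst (.lit 0) (.var .member)) (.lit 1))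
      (.write .proj (.lit 1) (.get .snd (.lit 0) (.var .member)) (.lit 1))) .skip

/-- Set `res` to `1` if the set in row `j` of `proj` is accepted, and to `0` otherwise. -/
def evalAcc (j : ℕ) (res : Var) : Prog :=
  .seq (.assign res (.lit 0)) <| .forUpTo .set .nSets <|
    .seq (.assign .active (.get .good (.lit 0) (.var .set))) <|
    .seq (.forUpTo .state .numStates <|
      .ite (.add (.lt (.get .up (.var .set) (.var .state)) (.get .proj (.lit j) (.var .state)))
          (.lt (.get .proj (.lit j) (.var .state)) (.get .lo (.var .set) (.var .state))))
        (.assign .active (.lit 0)) .skip) <|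
    .ite (.var .active) (.assign res (.lit 1)) .skip

/-- Write into `testU` the labels of a path from the pair of the tested states to `base`. -/
def writePath : Prog :=
  .seq (.assign .testULen (.lit 0)) <|
  .seq (.assign .cur (.add (.get .mul (.lit 0) (.var .arg₁)) (.var .arg₂))) <|
  .seq (.assign .target (.var .base)) (walk .graph' .nxt' .testU .testULen)

/-- Report a difference if the two projections of the set of pairs of states that lie on a common
cycle with the reachable pair `base` are not both accepted or both rejected. -/
def testPair : Prog :=
  .seq project <| .seq (evalAcc 0 .acc₁) <| .seq (evalAcc 1 .acc₂) <|
  .ite (.eq (.add (.add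
      (.lt (.get .lev' (.add (.get .mul (.lit 0) (.var .arg₁)) (.var .arg₂)) (.var .base)) (.var .inf))
      (.lt (.get .lev (.var .base) (.var .base)) (.var .inf)))
      (.sub (.lit 1) (.eq (.var .acc₁) (.var .acc₂)))) (.lit 3))
    (.seq (writeCycle .graph .lev .nxt) <| .seq writePath (.assign .ans (.lit 0)))
    .skip

/-- Test all pairs of states in all restricted products. -/
def search : Prog :=
  .seq (.assign .ans (.lit 1)) <|
  .forUpTo .i₁ .nRows <| .forUpTo .r₁ .nP1 <| .forUpTo .i₂ .nRows <| .forUpTo .r₂ .nP1 <|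
    .seq (buildGraph .graph) <| .seq (closure .graph .lev .nxt) <|
    .forUpTo .base .nPairs (.ite (.var .ans) testPair .skip)

variable {A : Acceptor (Fin k) (Fin n)} {q₁ q₂ : Fin n} {M : ℕ} {s : Store}

/-- The set of states in row `i` of `up` without the state `r`. -/
def restriction (n : ℕ) (up : ℕ → ℕ → ℕ) (i r : ℕ) : Set (Fin n) :=
  {q | up i q = 1 ∧ (q : ℕ) ≠ r}

/-- The tables for pairs of states and for the acceptance condition are in place. -/
structure Ready (A : Acceptor (Fin k) (Fin n)) (q₁ q₂ : Fin n) (M : ℕ) (s : Store) : Prop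
    extends Sized A q₁ q₂ M s where
  intervals : Intervals A.acc M (s.tab .lo) (s.tab .up) (s.tab .good)

/-- The tables that occur in `Ready`. -/
def Tab.ready : List Tab := [.delta, .mul, .fst, .snd, .lo, .up, .good]

theorem Ready.congr {s' : Store} (h : Ready A q₁ q₂ M s)
    (hv : ∀ x ∈ Var.sized, s'.var x = s.var x)
    (ht : ∀ t ∈ Tab.ready, s'.tab t = s.tab t) : Ready A q₁ q₂ M s' := by
  refine ⟨h.toSized.congr hv fun t h' => ht t ?_, ?_⟩
  · simp only [Tab.sized, Tab.ready, List.mem_cons, List.not_mem_nil, or_false] at h' ⊢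
    tauto
  · rw [ht .lo (by decide), ht .up (by decide), ht .good (by decide)]
    exact h.intervals

theorem run_buildGraph {td : Tab} (htd : td ∉ Tab.ready) (h : Ready A q₁ q₂ M s)
    (h₁ : s.var .i₁ ≤ M) (h₂ : s.var .i₂ ≤ M) :
    IsProduct A (restriction n (s.tab .up) (s.var .i₁) (s.var .r₁))
      (restriction n (s.tab .up) (s.var .i₂) (s.var .r₂)) (((buildGraph td).run s).tab td) := by
  classical
  set R₁ := restriction n (s.tab .up) (s.var .i₁) (s.var .r₁) with hR₁
  set R₂ := restriction n (s.tab .up) (s.var .i₂) (s.var .r₂) with hR₂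
  simp only [Tab.ready, List.mem_cons, List.not_mem_nil, or_false, not_or] at htd
  obtain ⟨t1, t2, t3, t4, t5, t6, t7⟩ := htd
  -- The graph as a function of the memory before the computation.
  let f : ℕ → ℕ → ℕ := fun p a =>
    let x := s.tab .delta (s.tab .fst 0 p) a
    let y := s.tab .delta (s.tab .snd 0 p) a
    if (s.tab .up (s.var .i₁) x - if x = s.var .r₁ then 1 else 0) +
      (s.tab .up (s.var .i₂) y - if y = s.var .r₂ then 1 else 0) = 2 then s.tab .mul 0 x + y
    else n * n
  have hf : ∀ (x : Fin n × Fin n) (a : Fin k), f (pairCode x) a =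
      if A.step x.1 a ∈ R₁ ∧ A.step x.2 a ∈ R₂ then pairCode (A.step x.1 a, A.step x.2 a)
      else n * n := by
    intro x a
    have u1 := h.intervals.up_le _ h₁ (A.step x.1 a)
    have u2 := h.intervals.up_le _ h₂ (A.step x.2 a)
    simp only [f, h.fst, h.snd, h.delta, h.mul]
    refine if_congr ?_ rfl rfl
    rw [hR₁, hR₂]
    simp only [restriction, Set.mem_ofPred_eq]
    split_ifs <;> omega
  set s₁ := (Prog.forUpTo .node .nPairs <| .forUpTo .sym .numSyms <|
    .seq (.assign .cur (.get .delta (.get .fst (.lit 0) (.var .node)) (.var .sym))) <|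
    .seq (.assign .cur' (.get .delta (.get .snd (.lit 0) (.var .node)) (.var .sym))) <|
    .ite (.eq (.add (.sub (.get .up (.var .i₁) (.var .cur)) (.eq (.var .cur) (.var .r₁)))
        (.sub (.get .up (.var .i₂) (.var .cur')) (.eq (.var .cur') (.var .r₂)))) (.lit 2))
      (.write td (.var .node) (.var .sym) (.add (.get .mul (.lit 0) (.var .cur)) (.var .cur')))
      (.write td (.var .node) (.var .sym) (.var .nPairs))).run s with hs₁
  have key : ∀ p a, s₁.tab td p a = if p < n * n ∧ a < k then f p a else s.tab td p a := by
    intro p a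
    rw [hs₁, Prog.run_fillRows k f, h.nPairs]
    intro i _ s' hx hv ht p a
    have hk' : s'.var .numSyms = k := by rw [hv _ (of_decide_eq_true rfl), h.numSyms]
    rw [Prog.run_fillRow i (fun a => f i a), hk']
    · by_cases hp : p = i
      · subst hp; rfl
      · simp [hp]
    intro j _ s'' hx' hv' ht' p a
    have v : ∀ y ∈ [Var.i₁, .i₂, .r₁, .r₂, .nPairs], s''.var y = s.var y := by
      intro y hy
      have e : y ∉ [Var.node, .sym, .cur, .cur'] := by
        fin_cases hy <;> decide
      simp only [List.mem_cons, List.not_mem_nil, or_false, not_or] at e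
      rw [hv' y (by simp [Prog.vars, e]), hv y (by simp [Prog.vars, e])]
    have tb : ∀ t ∈ [Tab.delta, .fst, .snd, .up, .mul], s''.tab t = s.tab t := by
      intro t htm
      have e : t ≠ td := by
        rintro rfl
        simp only [List.mem_cons, List.not_mem_nil, or_false] at htm
        tauto
      rw [ht' t (by simp [Prog.tabs, e]), ht t (by simp [Prog.tabs, e])]
    have hx'' : s''.var .node = i := by rw [hv' _ (of_decide_eq_true rfl), hx]
    simp only [List.mem_cons, List.not_mem_nil, or_false, forall_eq_or_imp, forall_eq] at v tb
    obtain ⟨v1, v2, v3, v4, v5⟩ := v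
    obtain ⟨b1, b2, b3, b4, b5⟩ := tb
    set x := s.tab .delta (s.tab .fst 0 i) j with hxdef
    set y := s.tab .delta (s.tab .snd 0 i) j with hydef
    have hrw : (if p = i ∧ a = j then f i a else s''.tab td p a) =
        if p = i ∧ a = j then f i j else s''.tab td p a := by
      split_ifs with hh
      · rw [hh.2]
      · rfl
    rw [hrw]
    have hfij : f i j = if (s.tab .up (s.var .i₁) x - if x = s.var .r₁ then 1 else 0) +
      (s.tab .up (s.var .i₂) y - if y = s.var .r₂ then 1 else 0) = 2 then s.tab .mul 0 x + y
      else n * n := rfl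
    clear_value f
    by_cases hc : (s.tab .up (s.var .i₁) x - if x = s.var .r₁ then 1 else 0) +
      (s.tab .up (s.var .i₂) y - if y = s.var .r₂ then 1 else 0) = 2
    · rw [if_pos hc] at hfij
      simp [Prog.run, Arith.eval, v1, v2, v3, v4, b1, b2, b3, b4, b5, hx', hx'',
        ← hxdef, ← hydef, hc, Store.setTab_tab_apply, hfij]
    · rw [if_neg hc] at hfij
      simp [Prog.run, Arith.eval, v1, v2, v3, v4, v5, b1, b2, b3, b4, hx', hx'',
        ← hxdef, ← hydef, hc, Store.setTab_tab_apply, hfij, h.nPairs]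
  have key₂ : ∀ p a, ((buildGraph td).run s).tab td p a =
      if p = n * n ∧ a < k then n * n else s₁.tab td p a := by
    intro p a
    have hk₁ : s₁.var .numSyms = k := by
      rw [hs₁, Prog.run_var_of_notMem (of_decide_eq_true rfl), h.numSyms]
    have hN₁ : s₁.var .nPairs = n * n := by
      rw [hs₁, Prog.run_var_of_notMem (of_decide_eq_true rfl), h.nPairs]
    change ((Prog.forUpTo .sym .numSyms
      (.write td (.var .nPairs) (.var .sym) (.var .nPairs))).run s₁).tab td p a = _
    rw [Prog.run_fillRow (n * n) (fun _ => n * n), hk₁]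
    intro j _ s' hx hv ht p a
    have e1 : s'.var .nPairs = n * n := by rw [hv _ (of_decide_eq_true rfl), hN₁]
    simp [Prog.run, Arith.eval, e1, hx, Store.setTab_tab_apply]
  have hval : ∀ (x : Fin n × Fin n) (a : Fin k),
      ((buildGraph td).run s).tab td (pairCode x) a = f (pairCode x) a := fun x a => by
    rw [key₂, if_neg fun hc => (pairCode_lt x).ne hc.1, key, if_pos ⟨pairCode_lt x, a.isLt⟩]
  refine ⟨fun x a hx hy => ?_, fun x a hx => ?_, fun a => ?_⟩
  · rw [hval, hf, if_pos ⟨hx, hy⟩]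
  · rw [hval, hf, if_neg hx]
  · rw [key₂, if_pos ⟨rfl, a.isLt⟩]

theorem run_closure_distances {td tl tn : Tab} (hdl : td ≠ tl) (hdn : td ≠ tn) (hln : tl ≠ tn)
    (h : Ready A q₁ q₂ M s) {R₁ R₂ : Set (Fin n)} (hp : IsProduct A R₁ R₂ (s.tab td)) :
    Distances (s.tab td) (n * n + 1) k (((closure td tl tn).run s).tab tl)
      (((closure td tl tn).run s).tab tn) :=
  have := run_closure hdl hdn hln rfl h.numSyms h.nNodes h.inf hp.closed
  ⟨hp.closed, this.1, this.2⟩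

end

/-! ### Acceptance of the projections of a cycle -/

section

variable {k n : ℕ} {A : Acceptor (Fin k) (Fin n)} {q₁ q₂ : Fin n} {M : ℕ} {s : Store}

open Classical in
/-- The rows of `proj` are the projections of `cycleSet`. -/
theorem run_project (h : Ready A q₁ q₂ M s) {x : Fin n × Fin n}
    (hx : s.var .base = pairCode x) (q : Fin n) :
    (project.run s).tab .proj 0 q =
      (if q ∈ Prod.fst '' cycleSet (s.tab .lev) x then 1 else 0) ∧
    (project.run s).tab .proj 1 q =
      (if q ∈ Prod.snd '' cycleSet (s.tab .lev) x then 1 else 0) := by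
  set L := s.tab .lev with hL
  -- `C c`: the pair with code `c` lies on a common cycle with `x`.
  let C : ℕ → Prop := fun c =>
    L (pairCode x) c < n * n + 1 + 1 ∧ L c (pairCode x) < n * n + 1 + 1
  set s₁ := (Prog.forUpTo .state .numStates <| .seq (.write .proj (.lit 0) (.var .state) (.lit 0))
    (.write .proj (.lit 1) (.var .state) (.lit 0))).run s with hs₁
  have clear : ∀ j < 2, ∀ q < n, s₁.tab .proj j q = 0 := by
    have := Prog.run_forUpTo (x := .state) (b := .numStates) (s := s)
      (p := .seq (.write .proj (.lit 0) (.var .state) (.lit 0))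
        (.write .proj (.lit 1) (.var .state) (.lit 0)))
      (fun i s' => ∀ j < 2, ∀ q < i, s'.tab .proj j q = 0) (by simp) ?_
    · rw [h.numStates] at this; exact this
    · intro i _ s' h1 hx _ _ j hj q hq
      simp only [Prog.run, Arith.eval, hx, Store.setVar_tab, Store.setTab_var,
        Store.setTab_tab_apply]
      rcases Nat.lt_succ_iff_lt_or_eq.1 hq with hq | rfl
      · simp [hq.ne, h1 j hj q hq]
      · interval_cases j <;> simp
  have e1 : s₁.var .nPairs = n * n := by rw [hs₁, Prog.run_var_of_notMem (by decide), h.nPairs]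
  have main : ∀ q < n,
      (project.run s).tab .proj 0 q =
        (if ∃ c < s₁.var .nPairs, C c ∧ s.tab .fst 0 c = q then 1 else 0) ∧
      (project.run s).tab .proj 1 q =
        (if ∃ c < s₁.var .nPairs, C c ∧ s.tab .snd 0 c = q then 1 else 0) := by
    refine Prog.run_forUpTo (s := s₁) (fun i s' => ∀ q < n,
      s'.tab .proj 0 q = (if ∃ c < i, C c ∧ s.tab .fst 0 c = q then 1 else 0) ∧
      s'.tab .proj 1 q = (if ∃ c < i, C c ∧ s.tab .snd 0 c = q then 1 else 0)) ?_ ?_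
    · intro q hq
      simp [clear 0 (by simp) q hq, clear 1 (by simp) q hq]
    · intro i hi s' h1 hi' hv ht q hq
      have v1 : s'.var .base = pairCode x := by
        rw [hv _ (by decide), hs₁, Prog.run_var_of_notMem (by decide), hx]
      have v2 : s'.var .inf = n * n + 1 + 1 := by
        rw [hv _ (by decide), hs₁, Prog.run_var_of_notMem (by decide), h.inf]
      have t1 : s'.tab .lev = L := by
        rw [ht _ (by decide), hs₁, Prog.run_tab_of_notMem (by decide)]
      have t2 : s'.tab .fst = s.tab .fst := by
        rw [ht _ (by decide), hs₁, Prog.run_tab_of_notMem (by decide)]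
      have t3 : s'.tab .snd = s.tab .snd := by
        rw [ht _ (by decide), hs₁, Prog.run_tab_of_notMem (by decide)]
      have hex : ∀ f : ℕ → ℕ, (∃ c < i + 1, C c ∧ f c = q) ↔
          (∃ c < i, C c ∧ f c = q) ∨ (C i ∧ f i = q) := fun f => by
        constructor
        · rintro ⟨c, hc, hcC, hcq⟩
          rcases Nat.lt_succ_iff_lt_or_eq.1 hc with hc | rfl
          · exact Or.inl ⟨c, hc, hcC, hcq⟩
          · exact Or.inr ⟨hcC, hcq⟩
        · rintro (⟨c, hc, h⟩ | h)
          · exact ⟨c, by omega, h⟩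
          · exact ⟨i, by omega, h⟩
      simp only [hex]
      by_cases hC : C i
      · have hg : (onCycle .lev .member).eval s' = 1 := by
          simp [onCycle, Arith.eval, v1, v2, t1, hi', hC.1, hC.2]
        simp only [Prog.run, hg, one_ne_zero, if_false, Arith.eval, hi', t2, Store.setVar_tab,
          Store.setTab_var, Store.setTab_tab_apply]
        simp only [reduceCtorEq, Tab.work.injEq, Nat.reduceEqDiff, false_and, if_false, t3]
        obtain ⟨h1, h2⟩ := h1 q hq
        constructor
        · by_cases hq' : s.tab .fst 0 i = q
          · simp [hq', hC]
          · simp [hq', Ne.symm hq', h1]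
        · by_cases hq' : s.tab .snd 0 i = q
          · simp [hq', hC]
          · simp [hq', Ne.symm hq', h2]
      · have hg : (onCycle .lev .member).eval s' = 0 := by
          by_cases c1 : L (pairCode x) i < n * n + 1 + 1
          · have c2 : ¬ L i (pairCode x) < n * n + 1 + 1 := fun c2 => hC ⟨c1, c2⟩
            simp [onCycle, Arith.eval, v1, v2, t1, hi', c1, c2]
          · by_cases c2 : L i (pairCode x) < n * n + 1 + 1 <;>
            simp [onCycle, Arith.eval, v1, v2, t1, hi', c1, c2]
        simp only [Prog.run, hg, if_true, Store.setVar_tab, hC, false_and, or_false]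
        exact h1 q hq
  rw [e1] at main
  obtain ⟨m1, m2⟩ := main q q.isLt
  rw [m1, m2]
  constructor
  · refine if_congr ?_ rfl rfl
    constructor
    · rintro ⟨c, hc, hC, hq⟩
      obtain ⟨y, rfl⟩ := exists_pairCode hc
      rw [h.fst] at hq
      exact ⟨y, hC, Fin.ext hq⟩
    · rintro ⟨y, hy, rfl⟩
      exact ⟨pairCode y, pairCode_lt y, hy, h.fst y⟩
  · refine if_congr ?_ rfl rfl
    constructor
    · rintro ⟨c, hc, hC, hq⟩
      obtain ⟨y, rfl⟩ := exists_pairCode hc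
      rw [h.snd] at hq
      exact ⟨y, hC, Fin.ext hq⟩
    · rintro ⟨y, hy, rfl⟩
      exact ⟨pairCode y, pairCode_lt y, hy, h.snd y⟩

open Classical in
/-- The set is accepted if and only if it lies in one of the intervals. -/
theorem run_evalAcc (h : Ready A q₁ q₂ M s) {j : ℕ} {res : Var} (hres : res = .acc₁ ∨ res = .acc₂)
    {X : Set (Fin n)} (hX : X.Nonempty)
    (hj : ∀ q : Fin n, s.tab .proj j q = if q ∈ X then 1 else 0) :
    ((evalAcc j res).run s).var res = if A.acc.Accepts X then 1 else 0 := by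
  -- `G i`: the set `X` lies in the `i`-th interval.
  let G : ℕ → Prop := fun i => s.tab .good 0 i ≠ 0 ∧
    ∀ q : Fin n, (s.tab .lo i q = 1 → q ∈ X) ∧ (q ∈ X → s.tab .up i q = 1)
  have main : ((evalAcc j res).run s).var res =
      if ∃ i < (s.setVar res 0).var .nSets, G i then 1 else 0 := by
    refine Prog.run_forUpTo (s := s.setVar res 0)
      (fun i s' => s'.var res = if ∃ i' < i, G i' then 1 else 0) ?_ ?_
    · rcases hres with rfl | rfl <;> simp
    · intro i hi s' h1 hx hv ht
      have hiM : i < M := by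
        rcases hres with rfl | rfl <;> simpa [h.nSets] using hi
      have t0 : s'.tab = s.tab := by
        funext t
        rw [ht t (by simp [Prog.tabs])]; rfl
      have v1 : s'.var .numStates = n := by
        rcases hres with rfl | rfl <;>
        (rw [hv _ (by simp [Prog.vars])]; simpa using h.numStates)
      set s₁ := s'.setVar .active (s.tab .good 0 i) with hs₁
      have inner := Prog.run_forUpTo (x := .state) (b := .numStates) (s := s₁)
        (p := .ite (.add (.lt (.get .up (.var .set) (.var .state)) (.get .proj (.lit j) (.var .state)))
            (.lt (.get .proj (.lit j) (.var .state)) (.get .lo (.var .set) (.var .state))))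
          (.assign .active (.lit 0)) .skip)
        (fun m s'' => s''.var .active ≠ 0 ↔ s.tab .good 0 i ≠ 0 ∧ ∀ q : Fin n, (q : ℕ) < m →
          (s.tab .lo i q = 1 → q ∈ X) ∧ (q ∈ X → s.tab .up i q = 1)) (by simp [hs₁]) ?_
      · rw [show s₁.var .numStates = n by simpa [hs₁] using v1] at inner
        simp only [Fin.is_lt, forall_const] at inner
        set s₂ := (Prog.forUpTo .state .numStates (.ite (.add (.lt (.get .up (.var .set)
          (.var .state)) (.get .proj (.lit j) (.var .state)))
            (.lt (.get .proj (.lit j) (.var .state)) (.get .lo (.var .set) (.var .state))))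
          (.assign .active (.lit 0)) .skip)).run s₁ with hs₂
        have hr : s₂.var res = s'.var res := by
          rw [hs₂]
          rcases hres with rfl | rfl <;>
          (rw [Prog.run_var_of_notMem (of_decide_eq_true rfl)]; simp [hs₁])
        have hrun : (Prog.seq (.assign .active (.get .good (.lit 0) (.var .set)))
            (.seq (.forUpTo .state .numStates
              (.ite (.add (.lt (.get .up (.var .set) (.var .state))
                (.get .proj (.lit j) (.var .state)))
                (.lt (.get .proj (.lit j) (.var .state)) (.get .lo (.var .set) (.var .state))))
                (.assign .active (.lit 0)) .skip))
              (.ite (.var .active) (.assign res (.lit 1)) .skip))).run s' =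
            if s₂.var .active = 0 then s₂ else s₂.setVar res 1 := by
          rw [hs₂, hs₁, ← hx, ← t0]
          rfl
        rw [hrun]
        have hex : (∃ i' < i + 1, G i') ↔ (∃ i' < i, G i') ∨ G i := by
          constructor
          · rintro ⟨c, hc, hG⟩
            rcases Nat.lt_succ_iff_lt_or_eq.1 hc with hc | rfl
            · exact Or.inl ⟨c, hc, hG⟩
            · exact Or.inr hG
          · rintro (⟨c, hc, h⟩ | h)
            · exact ⟨c, by omega, h⟩
            · exact ⟨i, by omega, h⟩
        have hset : res ≠ .set := by rcases hres with rfl | rfl <;> decide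
        by_cases h0 : s₂.var .active = 0
        · have hG : ¬ G i := fun hG => (inner.2 hG) h0
          simp only [h0, if_true, Store.setVar_var, hset, if_false, hr, h1, hex, hG, or_false]
        · have hG : G i := inner.1 h0
          have hor : (∃ i' < i, G i') ∨ G i := Or.inr hG
          rw [if_neg h0, if_pos (hex.2 hor)]
          simp [hset]
      · intro m hm s'' h2 hx' hv' ht'
        have hmn : m < n := by simpa [hs₁, v1] using hm
        have e1 : s''.var .set = i := by rw [hv' _ (of_decide_eq_true rfl)]; simp [hs₁, hx]
        have e2 : s''.tab = s.tab := by
          funext t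
          rw [ht' t (by simp [Prog.tabs]), hs₁, Store.setVar_tab, t0]
        have hlo := h.intervals.lo_le i hiM ⟨m, hmn⟩
        have hup := h.intervals.up_le i hiM.le ⟨m, hmn⟩
        have hproj := hj ⟨m, hmn⟩
        simp only at hlo hup hproj
        have hall : (∀ q : Fin n, (q : ℕ) < m + 1 →
            (s.tab .lo i q = 1 → q ∈ X) ∧ (q ∈ X → s.tab .up i q = 1)) ↔
            (∀ q : Fin n, (q : ℕ) < m →
              (s.tab .lo i q = 1 → q ∈ X) ∧ (q ∈ X → s.tab .up i q = 1)) ∧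
            ((s.tab .lo i m = 1 → (⟨m, hmn⟩ : Fin n) ∈ X) ∧
              ((⟨m, hmn⟩ : Fin n) ∈ X → s.tab .up i m = 1)) := by
          constructor
          · intro hq
            exact ⟨fun q hqm => hq q (by omega), hq ⟨m, hmn⟩ (Nat.lt_succ_self m)⟩
          · rintro ⟨ha, hb⟩ q hq
            rcases Nat.lt_succ_iff_lt_or_eq.1 hq with hq | hq
            · exact ha q hq
            · obtain rfl : q = ⟨m, hmn⟩ := Fin.ext hq
              exact hb
        rw [hall, ← and_assoc, ← h2]
        by_cases hmX : (⟨m, hmn⟩ : Fin n) ∈ X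
        · rw [if_pos hmX] at hproj
          by_cases hu : s.tab .up i m = 1
          · have hl : ¬ 1 < s.tab .lo i m := by omega
            simp [Prog.run, Arith.eval, e1, e2, hx', hproj, hmX, hu, hl]
          · have hu0 : s.tab .up i m = 0 := by omega
            simp [Prog.run, Arith.eval, e1, e2, hx', hproj, hmX, hu0]
        · rw [if_neg hmX] at hproj
          by_cases hl : s.tab .lo i m = 1
          · simp [Prog.run, Arith.eval, e1, e2, hx', hproj, hmX, hl]
          · have hl0 : s.tab .lo i m = 0 := by omega
            simp [Prog.run, Arith.eval, e1, e2, hx', hproj, hmX, hl0]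
  rw [main]
  have hM : (s.setVar res 0).var .nSets = M := by
    rcases hres with rfl | rfl <;> simpa using h.nSets
  rw [hM]
  exact if_congr (h.intervals.accepts X hX).symm rfl rfl

end

/-! ### The search for a difference -/

section

variable {k n : ℕ} {A : Acceptor (Fin k) (Fin n)} {q₁ q₂ : Fin n} {M : ℕ} {up : ℕ → ℕ → ℕ}
  {R₁ R₂ : Set (Fin n)} {s s' : Store}

/-- In addition to the tables of `Ready`, the graph of the unrestricted product and its shortest
paths are in place. -/
structure Prepared (A : Acceptor (Fin k) (Fin n)) (q₁ q₂ : Fin n) (M : ℕ) (up : ℕ → ℕ → ℕ)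
    (s : Store) : Prop extends Ready A q₁ q₂ M s where
  up_eq : s.tab .up = up
  graph : IsProduct A Set.univ Set.univ (s.tab .graph')
  dist : Distances (s.tab .graph') (n * n + 1) k (s.tab .lev') (s.tab .nxt')

/-- The tables that occur in `Prepared`. -/
def Tab.prepared : List Tab := Tab.ready ++ [.graph', .lev', .nxt']

theorem Prepared.congr (h : Prepared A q₁ q₂ M up s)
    (hv : ∀ x ∈ Var.sized, s'.var x = s.var x)
    (ht : ∀ t ∈ Tab.prepared, s'.tab t = s.tab t) : Prepared A q₁ q₂ M up s' := by
  refine ⟨h.toReady.congr hv fun t h' => ht t (List.mem_append_left _ h'), ?_, ?_, ?_⟩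
  · rw [ht .up (by decide), h.up_eq]
  · rw [ht .graph' (by decide)]
    exact h.graph
  · rw [ht .graph' (by decide), ht .lev' (by decide), ht .nxt' (by decide)]
    exact h.dist

/-- A program that writes none of the registers and tables in question preserves `Prepared`. -/
theorem Prepared.run {p : Prog} (h : Prepared A q₁ q₂ M up s) (hv : ∀ x ∈ Var.sized, x ∉ p.vars)
    (ht : ∀ t ∈ Tab.prepared, t ∉ p.tabs) : Prepared A q₁ q₂ M up (p.run s) :=
  h.congr (fun x hx => Prog.run_var_of_notMem (hv x hx) s) fun t h => Prog.run_tab_of_notMem (ht t h) s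

/-- The test has found a difference and has returned a witness. -/
def Valid (A : Acceptor (Fin k) (Fin n)) (q₁ q₂ : Fin n) (s : Store) : Prop :=
  s.var .ans = 0 ∧ ∃ w : UPWord (Fin k),
    s.row .testU 0 (s.var .testULen) = w.pre.map Fin.val ∧
    s.row .testV 0 (s.var .testVLen) = w.per.map Fin.val ∧
    w.pre.length + w.per.length ≤ (n * n + 1 + 1) + (n * n + 1 + 1) * (n * n + 1 + 1) ∧
    Xor (w.word ∈ (A.withInit q₁).language) (w.word ∈ (A.withInit q₂).language)

/-- The test has not found a difference, or has returned a witness. -/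
def Sound (A : Acceptor (Fin k) (Fin n)) (q₁ q₂ : Fin n) (s : Store) : Prop :=
  s.var .ans = 1 ∨ Valid A q₁ q₂ s

theorem Sound.congr (h : Sound A q₁ q₂ s)
    (hv : ∀ x ∈ [Var.ans, .testULen, .testVLen], s'.var x = s.var x)
    (ht : ∀ t ∈ [Tab.testU, .testV], s'.tab t = s.tab t) : Sound A q₁ q₂ s' := by
  simp only [List.mem_cons, List.not_mem_nil, or_false, forall_eq_or_imp, forall_eq] at hv ht
  unfold Sound Valid Store.row at h ⊢
  simp only [hv, ht]
  exact h

/-- From the memory `s`, the search has gone on to the memory `s'`; unless it has found a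
difference, it has established `P`. -/
def Searched (A : Acceptor (Fin k) (Fin n)) (q₁ q₂ : Fin n) (P : Prop) (s s' : Store) : Prop :=
  Sound A q₁ q₂ s' ∧ (s'.var .ans = 1 → s.var .ans = 1 ∧ P)

theorem Searched.imp {P Q : Prop} (h : Searched A q₁ q₂ P s s') (hPQ : P → Q) :
    Searched A q₁ q₂ Q s s' :=
  ⟨h.1, fun ha => ⟨(h.2 ha).1, hPQ (h.2 ha).2⟩⟩

/-- If every iteration of a loop refutes a difference of one more kind, the loop refutes all of
them. -/
theorem searched_forUpTo {x b : Var} {p : Prog} (P : ℕ → Prop)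
    (hx : x ∉ [Var.ans, .testULen, .testVLen]) (hs : Sound A q₁ q₂ s)
    (body : ∀ i < s.var b, ∀ s', s'.var x = i → (∀ y, y ∉ x :: p.vars → s'.var y = s.var y) →
      (∀ t, t ∉ p.tabs → s'.tab t = s.tab t) → Sound A q₁ q₂ s' →
      Searched A q₁ q₂ (P i) s' (p.run s')) :
    Searched A q₁ q₂ (∀ i < s.var b, P i) s ((Prog.forUpTo x b p).run s) := by
  have hset : ∀ s' i, ∀ y ∈ [Var.ans, .testULen, .testVLen],
      (Store.setVar s' x i).var y = s'.var y := fun s' i y hy => by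
    rw [Store.setVar_var, if_neg]
    rintro rfl
    exact hx hy
  refine Prog.run_forUpTo (s := s) (fun i s' => Searched A q₁ q₂ (∀ j < i, P j) s s') ?_ ?_
  · exact ⟨hs.congr (hset s 0) (by simp), fun ha => ⟨by rwa [hset _ _ _ (by simp)] at ha, by simp⟩⟩
  · intro i hi s' h hx' hv ht
    obtain ⟨h1, h2⟩ := body i hi s' hx' hv ht h.1
    refine ⟨h1.congr (hset _ _) (by simp), fun ha => ?_⟩
    rw [hset _ _ _ (by simp)] at ha
    obtain ⟨h3, h4⟩ := h2 ha
    obtain ⟨h5, h6⟩ := h.2 h3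
    refine ⟨h5, fun j hj => ?_⟩
    rcases Nat.lt_succ_iff_lt_or_eq.1 hj with hj | rfl
    · exact h6 j hj
    · exact h4

/-- In terms of the computed distances: the pair `x` is reachable and, in the product restricted
to `R₁ × R₂`, lies on a cycle; and of the two projections of the set of pairs on a common cycle
with `x`, exactly one is accepted. -/
def Distinguishes (A : Acceptor (Fin k) (Fin n)) (q₁ q₂ : Fin n) (R₁ R₂ : Set (Fin n))
    (x : Fin n × Fin n) : Prop :=
  ∀ {d d' lev nxt lev' nxt' : ℕ → ℕ → ℕ}, IsProduct A R₁ R₂ d →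
    IsProduct A Set.univ Set.univ d' → Distances d (n * n + 1) k lev nxt →
    Distances d' (n * n + 1) k lev' nxt' →
    lev' (pairCode (q₁, q₂)) (pairCode x) < n * n + 1 + 1 ∧ x ∈ cycleSet lev x ∧
    Xor (A.acc.Accepts (Prod.fst '' cycleSet lev x)) (A.acc.Accepts (Prod.snd '' cycleSet lev x))

/-- The path to `x` and the closed path through its cycle form a valid witness. -/
theorem run_witness (h : Prepared A q₁ q₂ M up s) (hd : IsProduct A R₁ R₂ (s.tab .graph))
    (hD : Distances (s.tab .graph) (n * n + 1) k (s.tab .lev) (s.tab .nxt)) {x : Fin n × Fin n}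
    (hb : s.var .base = pairCode x)
    (h₁ : s.tab .lev' (pairCode (q₁, q₂)) (pairCode x) < n * n + 1 + 1)
    (h₂ : x ∈ cycleSet (s.tab .lev) x)
    (h₃ : Xor (A.acc.Accepts (Prod.fst '' cycleSet (s.tab .lev) x))
      (A.acc.Accepts (Prod.snd '' cycleSet (s.tab .lev) x))) :
    Valid A q₁ q₂ ((Prog.seq (writeCycle .graph .lev .nxt)
      (.seq writePath (.assign .ans (.lit 0)))).run s) := by
  have hlt : ∀ y : Fin n × Fin n, pairCode y < n * n + 1 := fun y =>
    (pairCode_lt y).trans (Nat.lt_succ_self _)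
  obtain ⟨v, v1, v2, v3, v4, v5, v6⟩ := run_writeCycle (td := .graph) (tl := .lev) (tn := .nxt)
    (by decide) (by decide) hD rfl rfl rfl h.inf (by rw [h.nPairs]; omega) (by rw [hb]; exact hlt x)
    (by rw [hb]; exact h₂.1)
  set s₁ := (writeCycle .graph .lev .nxt).run s with hs₁
  have p₁ : Prepared A q₁ q₂ M up s₁ := h.run (by decide) (by decide)
  have hb₁ : s₁.var .base = pairCode x := by
    rw [hs₁, Prog.run_var_of_notMem (by decide), hb]
  have hg₁ : s₁.tab .graph' = s.tab .graph' := Prog.run_tab_of_notMem (by decide) s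
  have hl₁ : s₁.tab .lev' = s.tab .lev' := Prog.run_tab_of_notMem (by decide) s
  set s₂ := ((s₁.setVar .testULen 0).setVar .cur (pairCode (q₁, q₂))).setVar .target (pairCode x)
    with hs₂
  have hrun : writePath.run s₁ = (walk .graph' .nxt' .testU .testULen).run s₂ := by
    simp [writePath, Prog.run, Arith.eval, p₁.arg₁, p₁.arg₂, p₁.mul, hb₁, hs₂, pairCode]
  have c₂ : s₂.var .cur = pairCode (q₁, q₂) := by simp [hs₂]
  have t₂ : s₂.var .target = pairCode x := by simp [hs₂]
  obtain ⟨u, -, u2, u3, u4, u5, -⟩ := run_walk (td := .graph') (tn := .nxt') (dst := .testU)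
    (Or.inl rfl) (by decide) (s := s₂) p₁.dist rfl rfl (by simpa [hs₂] using p₁.inf)
    (by rw [c₂]; exact hlt _) (by rw [t₂]; exact hlt _) (by rw [c₂, t₂, hl₁]; exact h₁)
  rw [c₂, t₂] at u5
  rw [show s₂.row .testU 0 (s₂.var .testULen) = [] by simp [hs₂, Store.row], List.nil_append] at u4
  rw [← hrun] at u4
  obtain ⟨u, rfl⟩ := exists_map_val u2
  obtain ⟨v, rfl⟩ := exists_map_val v2
  simp only [List.length_map] at u3 v3
  have w4 : (writePath.run s₁).row .testV 0 ((writePath.run s₁).var .testVLen) = v.map Fin.val := by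
    rw [← v4, Store.row, Store.row, Prog.run_tab_of_notMem (by decide),
      Prog.run_var_of_notMem (by decide)]
  let w : UPWord (Fin k) := ⟨u, v, by simpa using v1⟩
  refine ⟨by simp [Prog.run, Arith.eval], w, ?_, ?_, by simp only [w]; omega, ?_⟩
  · simpa [Prog.run, Arith.eval, Store.row] using u4
  · simpa [Prog.run, Arith.eval, Store.row] using w4
  · rw [hb] at v5 v6
    obtain ⟨e₁, e₂⟩ := mem_language_cycle hd h.graph hD (q₁ := q₁) (q₂ := q₂) (x := x) w
      (by rw [← hg₁]; exact u5) v5 fun y hy =>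
        v6 _ (by rw [h.nPairs]; exact pairCode_lt y) hy.1 hy.2
    rw [e₁, e₂]
    exact h₃

theorem run_testPair (h : Prepared A q₁ q₂ M up s) (hd : IsProduct A R₁ R₂ (s.tab .graph))
    (hD : Distances (s.tab .graph) (n * n + 1) k (s.tab .lev) (s.tab .nxt)) {x : Fin n × Fin n}
    (hb : s.var .base = pairCode x) (ha : s.var .ans = 1) :
    Searched A q₁ q₂ (¬ Distinguishes A q₁ q₂ R₁ R₂ x) s (testPair.run s) := by
  classical
  set L := s.tab .lev with hL
  set s₁ := (evalAcc 1 .acc₂).run ((evalAcc 0 .acc₁).run (project.run s)) with hs₁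
  have hv : ∀ y, y ∉ (Prog.seq project (.seq (evalAcc 0 .acc₁) (evalAcc 1 .acc₂))).vars →
      s₁.var y = s.var y := fun y hy => Prog.run_var_of_notMem hy s
  have ht : ∀ t, t ∉ (Prog.seq project (.seq (evalAcc 0 .acc₁) (evalAcc 1 .acc₂))).tabs →
      s₁.tab t = s.tab t := fun t ht => Prog.run_tab_of_notMem ht s
  have p₁ : Prepared A q₁ q₂ M up s₁ :=
    h.congr (fun y hy => hv y (by revert y; decide)) fun t hy => ht t (by revert t; decide)
  have ha₁ : s₁.var .ans = 1 := by rw [hv _ (by decide), ha]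
  have hb₁ : s₁.var .base = pairCode x := by rw [hv _ (by decide), hb]
  have hl₁ : s₁.tab .lev = L := ht _ (by decide)
  have hacc : x ∈ cycleSet L x →
      s₁.var .acc₁ = (if A.acc.Accepts (Prod.fst '' cycleSet L x) then 1 else 0) ∧
      s₁.var .acc₂ = (if A.acc.Accepts (Prod.snd '' cycleSet L x) then 1 else 0) := by
    intro hx
    have r₀ : Prepared A q₁ q₂ M up (project.run s) := h.run (by decide) (by decide)
    have r₁ : Prepared A q₁ q₂ M up ((evalAcc 0 .acc₁).run (project.run s)) :=
      r₀.run (by decide) (by decide)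
    constructor
    · rw [hs₁, Prog.run_var_of_notMem (by decide)]
      exact run_evalAcc r₀.toReady (Or.inl rfl) ⟨_, x, hx, rfl⟩
        fun q => (run_project h.toReady hb q).1
    · refine run_evalAcc r₁.toReady (Or.inr rfl) ⟨_, x, hx, rfl⟩ fun q => ?_
      rw [Prog.run_tab_of_notMem (by decide)]
      exact (run_project h.toReady hb q).2
  have hmul : s₁.tab .mul 0 (q₁ : ℕ) + (q₂ : ℕ) = pairCode (q₁, q₂) := by
    rw [p₁.mul]; rfl
  by_cases hc : s₁.tab .lev' (pairCode (q₁, q₂)) (pairCode x) < n * n + 1 + 1 ∧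
      L (pairCode x) (pairCode x) < n * n + 1 + 1 ∧ s₁.var .acc₁ ≠ s₁.var .acc₂
  · obtain ⟨c₁, c₂, c₃⟩ := hc
    have hx : x ∈ cycleSet L x := ⟨c₂, c₂⟩
    have hrun : testPair.run s = (Prog.seq (writeCycle .graph .lev .nxt)
        (.seq writePath (.assign .ans (.lit 0)))).run s₁ := by
      change (if Arith.eval s₁ _ = 0 then _ else _) = _
      rw [if_neg]
      · simp [Arith.eval, p₁.arg₁, p₁.arg₂, hmul, hb₁, hl₁, p₁.inf, c₁, c₂, c₃]
    have hxor : Xor (A.acc.Accepts (Prod.fst '' cycleSet L x))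
        (A.acc.Accepts (Prod.snd '' cycleSet L x)) := by
      rw [(hacc hx).1, (hacc hx).2] at c₃
      rw [xor_iff_not_iff]
      intro hiff
      exact c₃ (if_congr hiff rfl rfl)
    have hV := run_witness p₁ (R₁ := R₁) (R₂ := R₂) (x := x) (by rw [ht _ (by decide)]; exact hd)
      (by rw [ht .graph (by decide), ht .nxt (by decide), hl₁]; exact hD) hb₁ c₁
      (by rw [hl₁]; exact hx) (by rw [hl₁]; exact hxor)
    rw [hrun]
    exact ⟨Or.inr hV, fun ha => absurd (hV.1.symm.trans ha) zero_ne_one⟩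
  · have hrun : testPair.run s = s₁ := by
      change (if Arith.eval s₁ _ = 0 then _ else _) = _
      rw [if_pos]
      · rfl
      · simp only [Arith.eval, p₁.arg₁, p₁.arg₂, hmul, hb₁, hl₁, p₁.inf]
        rw [if_neg]
        intro he
        refine hc ?_
        split_ifs at he <;> simp_all
    rw [hrun]
    refine ⟨Or.inl ha₁, fun _ => ⟨ha, fun hdist => hc ?_⟩⟩
    obtain ⟨d₁, d₂, d₃⟩ := hdist hd p₁.graph hD p₁.dist
    refine ⟨d₁, d₂.1, ?_⟩
    rw [(hacc d₂).1, (hacc d₂).2]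
    rw [xor_iff_not_iff] at d₃
    intro he
    refine d₃ ?_
    split_ifs at he <;> simp_all

theorem run_search (h : Prepared A q₁ q₂ M up s) :
    Searched A q₁ q₂ (∀ i₁ ≤ M, ∀ r₁ ≤ n, ∀ i₂ ≤ M, ∀ r₂ ≤ n, ∀ x,
      ¬ Distinguishes A q₁ q₂ (restriction n up i₁ r₁) (restriction n up i₂ r₂) x)
      (s.setVar .ans 1) (search.run s) := by
  have h0 : Prepared A q₁ q₂ M up (s.setVar .ans 1) :=
    h.congr (fun y hy => by revert y; simp [Var.sized]) (by simp)
  refine (searched_forUpTo (s := s.setVar .ans 1) (fun i₁ => ∀ r₁ ≤ n, ∀ i₂ ≤ M, ∀ r₂ ≤ n, ∀ x,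
    ¬ Distinguishes A q₁ q₂ (restriction n up i₁ r₁) (restriction n up i₂ r₂) x) (by decide)
    (Or.inl (by simp)) ?_).imp fun H i hi => H i (by rw [h0.nRows]; omega)
  intro i₁ b₁ s₁ e₁ hv₁ ht₁ snd₁
  have h1 : Prepared A q₁ q₂ M up s₁ :=
    h0.congr (fun y hy => hv₁ y (by revert y; decide)) fun t hy => ht₁ t (by revert t; decide)
  refine (searched_forUpTo (s := s₁) (fun r₁ => ∀ i₂ ≤ M, ∀ r₂ ≤ n, ∀ x,
    ¬ Distinguishes A q₁ q₂ (restriction n up i₁ r₁) (restriction n up i₂ r₂) x) (by decide)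
    snd₁ ?_).imp fun H i hi => H i (by rw [h1.nP1]; omega)
  intro r₁ _ s₂ e₂ hv₂ ht₂ snd₂
  have h2 : Prepared A q₁ q₂ M up s₂ :=
    h1.congr (fun y hy => hv₂ y (by revert y; decide)) fun t hy => ht₂ t (by revert t; decide)
  refine (searched_forUpTo (s := s₂) (fun i₂ => ∀ r₂ ≤ n, ∀ x,
    ¬ Distinguishes A q₁ q₂ (restriction n up i₁ r₁) (restriction n up i₂ r₂) x) (by decide)
    snd₂ ?_).imp fun H i hi => H i (by rw [h2.nRows]; omega)
  intro i₂ b₃ s₃ e₃ hv₃ ht₃ snd₃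
  have h3 : Prepared A q₁ q₂ M up s₃ :=
    h2.congr (fun y hy => hv₃ y (by revert y; decide)) fun t hy => ht₃ t (by revert t; decide)
  refine (searched_forUpTo (s := s₃) (fun r₂ => ∀ x,
    ¬ Distinguishes A q₁ q₂ (restriction n up i₁ r₁) (restriction n up i₂ r₂) x) (by decide)
    snd₃ ?_).imp fun H i hi => H i (by rw [h3.nP1]; omega)
  intro r₂ _ s₄ e₄ hv₄ ht₄ snd₄
  have h4 : Prepared A q₁ q₂ M up s₄ :=
    h3.congr (fun y hy => hv₄ y (by revert y; decide)) fun t hy => ht₄ t (by revert t; decide)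
  have f₁ : s₄.var .i₁ = i₁ := by
    rw [hv₄ _ (by decide), hv₃ _ (by decide), hv₂ _ (by decide), e₁]
  have f₂ : s₄.var .r₁ = r₁ := by rw [hv₄ _ (by decide), hv₃ _ (by decide), e₂]
  have f₃ : s₄.var .i₂ = i₂ := by rw [hv₄ _ (by decide), e₃]
  rw [h0.nRows] at b₁
  rw [h2.nRows] at b₃
  have hd := run_buildGraph (td := .graph) (by decide) h4.toReady (by rw [f₁]; omega)
    (by rw [f₃]; omega)
  rw [f₁, f₂, f₃, e₄, h4.up_eq] at hd
  have h5 : Prepared A q₁ q₂ M up ((buildGraph .graph).run s₄) := h4.run (by decide) (by decide)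
  have hD := run_closure_distances (td := .graph) (tl := .lev) (tn := .nxt) (by decide) (by decide)
    (by decide) h5.toReady hd
  have h6 : Prepared A q₁ q₂ M up ((closure .graph .lev .nxt).run ((buildGraph .graph).run s₄)) :=
    h5.run (by decide) (by decide)
  set s₅ := (closure .graph .lev .nxt).run ((buildGraph .graph).run s₄) with hs₅
  have hv₅ : ∀ y, y ∉ (Prog.seq (buildGraph .graph) (closure .graph .lev .nxt)).vars →
    s₅.var y = s₄.var y := fun y hy => Prog.run_var_of_notMem hy s₄
  have ht₅ : ∀ t, t ∉ (Prog.seq (buildGraph .graph) (closure .graph .lev .nxt)).tabs →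
    s₅.tab t = s₄.tab t := fun t ht => Prog.run_tab_of_notMem ht s₄
  have hg₅ : s₅.tab .graph = ((buildGraph .graph).run s₄).tab .graph :=
    Prog.run_tab_of_notMem (by decide) _
  rw [← hg₅] at hd hD
  have snd₅ : Sound A q₁ q₂ s₅ :=
    snd₄.congr (fun y hy => hv₅ y (by revert y; decide)) fun t hy => ht₅ t (by revert t; decide)
  have hans : s₅.var .ans = s₄.var .ans := hv₅ _ (by decide)
  have main := searched_forUpTo (s := s₅) (x := .base) (b := .nPairs)
    (p := .ite (.var .ans) testPair .skip) (fun p => ∀ x, pairCode x = p →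
    ¬ Distinguishes A q₁ q₂ (restriction n up i₁ r₁) (restriction n up i₂ r₂) x) (by decide)
    snd₅ ?_
  · refine ⟨main.1, fun ha => ⟨hans ▸ (main.2 ha).1, fun x => ?_⟩⟩
    exact (main.2 ha).2 _ (by rw [h6.nPairs]; exact pairCode_lt x) x rfl
  intro p hp s₆ e₆ hv₆ ht₆ snd₆
  have h7 : Prepared A q₁ q₂ M up s₆ :=
    h6.congr (fun y hy => hv₆ y (by revert y; decide)) fun t hy => ht₆ t (by revert t; decide)
  by_cases ha : s₆.var .ans = 0
  · rw [Prog.run, if_pos (by simpa [Arith.eval] using ha)]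
    exact ⟨snd₆, fun hb => absurd (ha.symm.trans hb) zero_ne_one⟩
  · rw [Prog.run, if_neg (by simpa [Arith.eval] using ha)]
    have ha : s₆.var .ans = 1 := snd₆.resolve_right fun hV => ha hV.1
    obtain ⟨x, rfl⟩ := exists_pairCode (h6.nPairs ▸ hp)
    refine (run_testPair h7 (by rw [ht₆ _ (by decide)]; exact hd)
      (by rw [ht₆ .graph (by decide), ht₆ .lev (by decide), ht₆ .nxt (by decide)]; exact hD) e₆
      ha).imp fun H y hy => ?_
    rw [pairCode_injective hy]
    exact H

/-- If the search finds no difference, there is none: the sets of states that recur in two runs on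
a word determine restrictions on which acceptance is constant above these sets. -/
theorem search_correct (h : Prepared A q₁ q₂ M up s) :
    Valid A q₁ q₂ (search.run s) ∨ ((search.run s).var .ans = 1 ∧
      (A.withInit q₁).language = (A.withInit q₂).language) := by
  obtain ⟨h₁ | h₁, h₂⟩ := run_search h
  · refine Or.inr ⟨h₁, ?_⟩
    have H := (h₂ h₁).2
    by_contra hne
    obtain ⟨w, hw⟩ : ∃ w, ¬ (w ∈ (A.withInit q₁).language ↔ w ∈ (A.withInit q₂).language) := by
      by_contra hc
      push Not at hc
      exact hne (Set.ext hc)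
    obtain ⟨i₁, hi₁, r₁, hr₁, hX₁, hY₁⟩ := h.intervals.restrict _
      ((A.withInit q₁).infStates_nonempty w)
    obtain ⟨i₂, hi₂, r₂, hr₂, hX₂, hY₂⟩ := h.intervals.restrict _
      ((A.withInit q₂).infStates_nonempty w)
    rw [h.up_eq] at hX₁ hY₁ hX₂ hY₂
    obtain ⟨x, hx⟩ := exists_distinguishing_cycle ((xor_iff_not_iff _ _).2 hw) hX₁ hX₂ hY₁ hY₂
    exact H i₁ hi₁ r₁ hr₁ i₂ hi₂ r₂ hr₂ x hx
  · exact Or.inl h₁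

end

section

variable {k n : ℕ} {A : Acceptor (Fin k) (Fin n)} {q₁ q₂ : Fin n} {M : ℕ} {s : Store}

/-! ### The state test -/

/-- Compute the tables for pairs of states and the registers that bound the loops of `compare`. -/
def prepare : Prog := .seq pairTables sizes

/-- Compute the intervals, the unrestricted product, which is the restriction to row `nSets` of `up`
without removal of a state, and its shortest paths; then test the pairs of states. -/
def compare : Prog :=
  .seq intervalTables <|
  .seq (.seq (.assign .i₁ (.var .nSets)) <| .seq (.assign .r₁ (.var .numStates)) <|
    .seq (.assign .i₂ (.var .nSets)) (.assign .r₂ (.var .numStates))) <|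
  .seq (buildGraph .graph') <| .seq (closure .graph' .lev' .nxt') search

/-- The state test. Without symbols there are no words, and the states are equivalent. -/
def stateTest : Cmd :=
  .cond (.var .numSyms) (.seq prepare.toCmd compare.toCmd) (.assign .ans (.lit 1))

theorem Intervals.restriction_univ {α : Acceptance (Fin n)} {lo up good : ℕ → ℕ → ℕ}
    (h : Intervals α M lo up good) : restriction n up M n = Set.univ :=
  Set.eq_univ_of_forall fun q => ⟨h.univ q, q.isLt.ne⟩

theorem run_compare (hA : s.HoldsInput A) (h : Sized A q₁ q₂ A.numIntervals s) :
    Valid A q₁ q₂ (compare.run s) ∨ ((compare.run s).var .ans = 1 ∧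
      (A.withInit q₁).language = (A.withInit q₂).language) := by
  set M := A.numIntervals with hM
  have h₁ : Ready A q₁ q₂ M (intervalTables.run s) :=
    ⟨h.congr (fun x hx => Prog.run_var_of_notMem (by revert x; decide) s)
      fun t ht => Prog.run_tab_of_notMem (by revert t; decide) s, run_intervalTables hA h.nSets⟩
  set s₁ := intervalTables.run s
  set s₂ := (Prog.seq (.assign .i₁ (.var .nSets)) <| .seq (.assign .r₁ (.var .numStates)) <|
    .seq (.assign .i₂ (.var .nSets)) (.assign .r₂ (.var .numStates))).run s₁ with hs₂
  have h₂ : Ready A q₁ q₂ M s₂ :=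
    h₁.congr (fun x hx => Prog.run_var_of_notMem (by revert x; decide) s₁) fun _ _ => rfl
  have e₁ : s₂.var .i₁ = M := by simp [hs₂, Prog.run, Arith.eval, h₁.nSets]
  have e₂ : s₂.var .r₁ = n := by simp [hs₂, Prog.run, Arith.eval, h₁.numStates]
  have e₃ : s₂.var .i₂ = M := by simp [hs₂, Prog.run, Arith.eval, h₁.nSets]
  have e₄ : s₂.var .r₂ = n := by simp [hs₂, Prog.run, Arith.eval, h₁.numStates]
  have hg := run_buildGraph (td := .graph') (by decide) h₂ e₁.le e₃.le
  rw [e₁, e₂, e₃, e₄, h₂.intervals.restriction_univ] at hg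
  set s₃ := (buildGraph .graph').run s₂ with hs₃
  have h₃ : Ready A q₁ q₂ M s₃ :=
    h₂.congr (fun x hx => Prog.run_var_of_notMem (by revert x; decide) s₂)
      fun t ht => Prog.run_tab_of_notMem (by revert t; decide) s₂
  have hD := run_closure_distances (td := .graph') (tl := .lev') (tn := .nxt') (by decide)
    (by decide) (by decide) h₃ hg
  set s₄ := (closure .graph' .lev' .nxt').run s₃ with hs₄
  have hg₄ : s₄.tab .graph' = s₃.tab .graph' := Prog.run_tab_of_notMem (by decide) s₃
  rw [← hg₄] at hg hD
  have h₄ : Prepared A q₁ q₂ M (s₄.tab .up) s₄ :=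
    ⟨h₃.congr (fun x hx => Prog.run_var_of_notMem (by revert x; decide) s₃)
      fun t ht => Prog.run_tab_of_notMem (by revert t; decide) s₃, rfl, hg, hD⟩
  exact search_correct h₄

theorem Acceptor.numIntervals_le_size (A : Acceptor (Fin k) (Fin n)) (hk : 0 < k) :
    A.numIntervals ≤ A.size := by
  have hn : 0 < n := A.init.pos
  have hnk : n ≤ n * k := Nat.le_mul_of_pos_right n hk
  unfold Acceptor.numIntervals Acceptor.size
  simp only [Fintype.card_fin]
  split
  · rename_i heq
    rw [heq]
    exact (Nat.le_mul_of_pos_left _ hn).trans (Nat.le_add_left _ _)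
  · exact hnk.trans (Nat.le_add_right _ _)

theorem Acceptor.language_eq_of_no_syms (A B : Acceptor (Fin 0) (Fin n)) :
    A.language = B.language :=
  Set.ext fun w => (w.get 0).elim0

instance : DecidablePred Var.TestMayChange := fun x => by
  cases x <;> first | exact isTrue trivial | exact isFalse id

instance : DecidablePred Tab.TestMayChange := fun t => by
  cases t <;> first | exact isTrue trivial | exact isFalse id

theorem testMayChange_of_mem_vars :
    ∀ x ∈ (Prog.seq prepare compare).vars, x.TestMayChange := by decide

theorem testMayChange_of_mem_tabs :
    ∀ t ∈ (Prog.seq prepare compare).tabs, t.TestMayChange := by decide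

theorem isStateTest_stateTest : IsStateTest stateTest := by
  -- `Z` bounds all registers that bound loops; the last summand bounds the length of a witness.
  let Z : Polynomial ℕ := .X * .X + .X + 3
  refine ⟨prepare.cost.comp Z + compare.cost.comp Z + 2 +
    ((.X * .X + 2) + (.X * .X + 2) * (.X * .X + 2)), fun k n A q₁ q₂ s hA h₁ h₂ => ?_⟩
  simp only [Polynomial.eval_add, Polynomial.eval_comp, Polynomial.eval_mul, Polynomial.eval_X,
    Polynomial.eval_ofNat]
  obtain rfl | hk := Nat.eq_zero_or_pos k
  · refine ⟨2, _, .cond_false hA.2.1 (.assign _ _ _), by omega, fun x hx => ?_, fun _ _ => rfl,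
      Or.inl ⟨by simp [Arith.eval], Acceptor.language_eq_of_no_syms _ _⟩⟩
    rw [Store.setVar_var, if_neg]
    rintro rfl
    exact hx trivial
  · have hn := A.card_states_le_size hk
    have hM := A.numIntervals_le_size hk
    have hkn := A.card_syms_le_size
    have hnn : n * n ≤ A.size * A.size := Nat.mul_le_mul hn hn
    have hS : Sized A q₁ q₂ A.numIntervals (prepare.run s) := run_sizes hA h₁ h₂
    have hZ : Z.eval A.size = A.size * A.size + A.size + 3 := by simp [Z]
    obtain ⟨t₁, _, x₁, b₁, rfl⟩ := Prog.runs_toCmd (p := prepare) (fixed := [.numStates])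
      (by decide) (Z := Z.eval A.size) (s := s) (by
        simp only [List.mem_singleton, forall_eq, hA.1]; omega)
    obtain ⟨t₂, s₂, x₂, b₂, e₂⟩ := Prog.runs_toCmd (p := compare) (fixed := [.numStates,
      .numSyms, .nPairs, .nNodes, .inf, .nP1, .nSets, .nRows]) (by decide) (Z := Z.eval A.size)
      (s := prepare.run s) (by
        simp only [List.mem_cons, List.not_mem_nil, or_false, forall_eq_or_imp, forall_eq,
          hS.numStates, hS.numSyms, hS.nPairs, hS.nNodes, hS.inf, hS.nP1, hS.nSets, hS.nRows]
        omega)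
    have e : s₂ = (Prog.seq prepare compare).run s := by rw [Prog.run, e₂]
    refine ⟨t₁ + t₂ + 1, s₂, .cond_true (by rw [Arith.eval, hA.2.1]; omega) (.seq x₁ x₂), by omega,
      fun x hx => ?_, fun t ht => ?_, ?_⟩
    · rw [e]
      exact Prog.run_var_of_notMem (mt (testMayChange_of_mem_vars x) hx) s
    · rw [e]
      exact Prog.run_tab_of_notMem (mt (testMayChange_of_mem_tabs t) ht) s
    · have hA' : (prepare.run s).HoldsInput A :=
        hA.congr (fun x hx => Prog.run_var_of_notMem (by revert x; decide) s)
          fun t ht => Prog.run_tab_of_notMem (by revert t; decide) s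
      rw [e₂]
      rcases run_compare hA' hS with ⟨h₀, w, hu, hv, hlen, hx⟩ | h
      · refine Or.inr ⟨h₀, w, hu, hv, hlen.trans ?_, hx⟩
        have := Nat.mul_le_mul (show n * n + 1 + 1 ≤ A.size * A.size + 2 by omega)
          (show n * n + 1 + 1 ≤ A.size * A.size + 2 by omega)
        omega
      · exact Or.inl h

end

end OmegaAutomata

/-- There is a polynomial time test of two states for Right-Con to use; and, whichever such
test it uses, Right-Con runs in polynomial time on every DBA, DCA, DPA and DMA, and returns an
automaton `M` isomorphic to the right congruence automaton, with states represented by words,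
and a list `D` of ultimately periodic words that distinguish the states of `M`. -/
theorem mainTheorem7 :
    (∃ T : Cmd, IsStateTest T) ∧
    ∀ T : Cmd, IsStateTest T →
      ∃ p : Polynomial ℕ, ∀ (k n : ℕ) (A : Acceptor (Fin k) (Fin n)) (s : Store),
        s.HoldsInput A →
        ∃ (t : ℕ) (s' : Store), Exec (rightCon T) s t s' ∧ t ≤ p.eval A.size ∧
          ∃ (r : ℕ) (M : Automaton (Fin k) (Fin r)) (name : Fin r → List (Fin k))
            (D : List (UPWord (Fin k))),
            s'.HoldsOutput M name D ∧
            name M.init = [] ∧ (∀ x, M.reach (name x) = x) ∧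
            M.Isomorphic (rightCongruenceAutomaton A.language) ∧
            ∀ x₁ x₂ : List (Fin k), M.reach x₁ ≠ M.reach x₂ →
              ∃ w ∈ D, Xor (x₁ ++ₛ w.word ∈ A.language) (x₂ ++ₛ w.word ∈ A.language) :=
  ⟨⟨stateTest, isStateTest_stateTest⟩, rightCon_correct⟩
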